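/- Theorem. Exact Perfect Matching logspace many-one reduces to 2-Approval-CCRV!. Here an instance of *Exact Perfect Matching* consists of a finite simple graph $G=(V,E)$, a set $R\subseteq E$ of red edges, and an integer $k\ge 0$; the question is whether there is a perfect matching of $G$ with exactly $k$ red edges, that is, a set $E'\subseteq E$ such that every $v\in V$ is incident with exactly one edge of $E'$ and $|E'\cap R|=k$. In a *2-Approval* election with a finite set $C$ of candidates, each voter casts a vote that is a total order of $C$; a candidate receives one point from every voter who ranks it first or second, and the winners are the candidates with the highest total score. An instance of *2-Approval-CCRV!* (exact constructive control by replacing voters) consists of a candidate set $C$, a finite collection $X$ of registered voters and a finite collection $Y$ of unregistered voters (each with a vote over $C$; several voters may cast the same vote), an integer $k\ge 0$, and a preferred candidate $p\in C$; the question is whether there are $X'\subseteq X$ and $Y'\subseteq Y$ with $|X'|=|Y'|=k$ such that $p$ is a 2-Approval winner of the election with candidates $C$ and voters $(X\setminus X')\cup Y'$. Instances are encoded as strings over a finite alphabet (integers in binary, the graph by its adjacency matrix with the red edges marked, each vote by the list of all candidates in order of preference), and each problem is identified with the language of the encodings of its yes-instances. A language $A$ *logspace many-one reduces* to a language $B$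 if there is a function $f$ from strings to strings, computed by a deterministic Turing machine with a read-only input tape, a write-only output tape and work space $O(\log |x|)$ on every input $x$, such that $x\in A \iff f(x)\in B$ for all strings $x$. -/

import Mathlib

/-! ### Logspace-computable functions and logspace many-one reductions -/

namespace Logspace

/-- Moves of a tape head. -/
inductive Move
  | left
  | stay
  | right

/-- The symbols that can be read on the input tape: the input sits between two end markers. -/
inductive InputSymbol (α : Type)
  | leftEnd
  | letter (a : α)
  | rightEnd

/-- What a machine does in one step: the next state, the move of the input head, the symbol to write
and the move to make on every work tape, and the symbol (if any) to append to the output. -/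
structure Action (Q Γ T β : Type) where
  state : Q
  inputMove : Move
  write : T → Γ
  workMove : T → Move
  emit : Option β

/-- A deterministic Turing machine with a two-way read-only input tape over `α`, finitely many
two-way infinite read-write work tapes (indexed by `T`) over a finite work alphabet `Γ`, and a
one-way write-only output tape over `β`. The machine halts when `δ` yields `none`. -/
structure Transducer (α β : Type) where
  /-- states -/
  Q : Type
  /-- work alphabet -/
  Γ : Type
  /-- index set of the work tapes -/
  T : Type
  finite_Q : Finite Q
  finite_Γ : Finite Γ
  finite_T : Finite T
  start : Q
  blank : Γ
  /-- transition function: state, scanned input symbol, scanned work symbols -/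
  δ : Q → InputSymbol α → (T → Γ) → Option (Action Q Γ T β)

/-- The content of cell `i` of the input tape on input `x`: the left end marker is in cell `0`, the
letters of `x` are in cells `1, …, |x|`, and the right end marker is in cell `|x| + 1`. -/
def inputCell {α : Type} (x : List α) : ℕ → InputSymbol α
  | 0 => .leftEnd
  | i + 1 => match x[i]? with
    | some a => .letter a
    | none => .rightEnd

/-- Moves of the input head, which cannot leave the cells `0, …, len + 1`. -/
def moveInput (len : ℕ) : Move → ℕ → ℕ
  | .left, i => i - 1
  | .stay, i => i
  | .right, i => min (i + 1) (len + 1)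

/-- Moves of a work head. -/
def moveWork : Move → ℤ → ℤ
  | .left, i => i - 1
  | .stay, i => i
  | .right, i => i + 1

namespace Transducer

variable {α β : Type} (M : Transducer α β)

/-- A configuration. `out` is what has been written on the output tape so far. -/
structure Config where
  state : M.Q
  inputPos : ℕ
  work : M.T → ℤ → M.Γ
  workPos : M.T → ℤ
  out : List β

/-- The initial configuration: blank work tapes, empty output, input head on the left end marker. -/
def initial : M.Config where
  state := M.start
  inputPos := 0
  work := fun _ _ => M.blank
  workPos := fun _ => 0
  out := []

/-- One step of the machine on input `x`; `none` if it has halted. -/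
def step (x : List α) (c : M.Config) : Option M.Config :=
  (M.δ c.state (inputCell x c.inputPos) (fun t => c.work t (c.workPos t))).map fun a =>
    { state := a.state
      inputPos := moveInput x.length a.inputMove c.inputPos
      work := fun t => Function.update (c.work t) (c.workPos t) (a.write t)
      workPos := fun t => moveWork (a.workMove t) (c.workPos t)
      out := c.out ++ a.emit.toList }

/-- On input `x`, the machine halts with output `y`. -/
def HaltsWith (x : List α) (y : List β) : Prop :=
  ∃ c, StateTransition.Reaches (M.step x) M.initial c ∧ M.step x c = none ∧ c.out = y

/-- On input `x`, every work head stays within distance `s` of its initial cell. -/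
def UsesSpaceAtMost (x : List α) (s : ℕ) : Prop :=
  ∀ c, StateTransition.Reaches (M.step x) M.initial c → ∀ t, |c.workPos t| ≤ (s : ℤ)

end Transducer

/-- For finite alphabets `α` and `β`: `f` is computed by a deterministic Turing machine in work space `O(log |x|)`.
(The summand `1` serves inputs of length at most one.) -/
def Computable {α β : Type} (f : List α → List β) : Prop :=
  ∃ (M : Transducer α β) (C : ℕ), ∀ x : List α,
    M.HaltsWith x (f x) ∧ M.UsesSpaceAtMost x (C * (Nat.log 2 x.length + 1))

/-- Logspace many-one reducibility of languages. -/
def ManyOneReducible {α β : Type} (A : Language α) (B : Language β) : Prop :=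
  ∃ f : List α → List β, Computable f ∧ ∀ x, x ∈ A ↔ f x ∈ B

end Logspace

/-! ### Exact Perfect Matching -/

namespace ExactMatching

/-- An instance: a graph on the vertices `0, …, n - 1`, a set of red edges, and a number `k`. -/
structure Instance where
  n : ℕ
  G : SimpleGraph (Fin n)
  red : Set (Sym2 (Fin n))
  red_subset : red ⊆ G.edgeSet
  k : ℕ

/-- There is a perfect matching with exactly `k` red edges. -/
def Instance.IsYes (I : Instance) : Prop :=
  ∃ M : I.G.Subgraph, M.IsPerfectMatching ∧ (M.edgeSet ∩ I.red).ncard = I.k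

/-- The alphabet of the encoding. -/
inductive Letter
  | noEdge
  | nonredEdge
  | redEdge
  | rowEnd
  | bit (b : Bool)

open Classical in
/-- The entry of the (colored) adjacency matrix at `(i, j)`. -/
noncomputable def Instance.entry (I : Instance) (i j : Fin I.n) : Letter :=
  if s(i, j) ∈ I.red then .redEdge else if I.G.Adj i j then .nonredEdge else .noEdge

/-- The encoding: the part of the adjacency matrix below the diagonal, row by row, every row being
followed by an end mark, and then `k` in binary (least significant bit first). -/
noncomputable def Instance.encode (I : Instance) : List Letter :=
  ((List.finRange I.n).flatMap fun i =>
    ((List.finRange I.n).filter (· < i)).map (I.entry i) ++ [Letter.rowEnd]) ++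
  (Nat.bits I.k).map Letter.bit

end ExactMatching

/-- The language of Exact Perfect Matching. -/
def ExactPerfectMatching : Language ExactMatching.Letter :=
  {x | ∃ I : ExactMatching.Instance, I.IsYes ∧ I.encode = x}

/-! ### Elections and exact constructive control by replacing voters -/

namespace Voting

/-- A total-order vote over the candidates `0, …, m - 1`: `v i` is the candidate in the `i`-th
position of `v` (position `0` is the top). -/
abbrev Vote (m : ℕ) : Type := Equiv.Perm (Fin m)

/-- A voting rule maps an election (a number of candidates and the votes of the voters; several
voters may cast the same vote) to the set of winners. -/
abbrev VotingRule : Type := (m : ℕ) → Multiset (Vote m) → Set (Fin m)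

/-- The score of a candidate under the scoring vector `α`. -/
def score {m : ℕ} (α : Fin m → ℤ) (V : Multiset (Vote m)) (c : Fin m) : ℤ :=
  (V.map fun v => α (v.symm c)).sum

/-- The scoring rule given by a family of scoring vectors: the winners are the candidates of highest
score. -/
def scoringRule (α : (m : ℕ) → Fin m → ℤ) : VotingRule :=
  fun m V => {c | ∀ d, score (α m) V d ≤ score (α m) V c}

/-- 2-Approval, the scoring rule with the vectors `⟨1, 1, 0, …, 0⟩`. -/
def twoApproval : VotingRule :=
  scoringRule fun _ i => if (i : ℕ) < 2 then 1 else 0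

/-- An instance of control by replacing voters: the candidates `0, …, m - 1`, the votes of the
registered and of the unregistered voters, a number `k`, and a preferred candidate `p`. -/
structure Instance where
  m : ℕ
  registered : List (Vote m)
  unregistered : List (Vote m)
  k : ℕ
  p : Fin m

/-- Replacing exactly `k` registered voters by exactly `k` unregistered ones can make `p` a winner. -/
def Instance.IsYesExact (E : VotingRule) (I : Instance) : Prop :=
  ∃ V' W' : Multiset (Vote I.m), V' ≤ (I.registered : Multiset (Vote I.m)) ∧
    W' ≤ (I.unregistered : Multiset (Vote I.m)) ∧ V'.card = I.k ∧ W'.card = I.k ∧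
    I.p ∈ E I.m ((I.registered : Multiset (Vote I.m)) - V' + W')

/-- The alphabet of the encoding. -/
inductive Letter
  | bit (b : Bool)
  | comma
  | semicolon
  | bar

/-- A number in binary (least significant bit first), followed by a comma. -/
def encodeNat (n : ℕ) : List Letter :=
  (Nat.bits n).map Letter.bit ++ [Letter.comma]

/-- A vote is encoded by listing all candidates from the top to the bottom. -/
def encodeVote {m : ℕ} (v : Vote m) : List Letter :=
  ((List.finRange m).flatMap fun i => encodeNat (v i)) ++ [Letter.semicolon]

/-- The encoding: the list `0, …, m - 1` of all candidates, the preferred candidate, the number `k`,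
the registered votes, and, after a bar, the unregistered votes. -/
def Instance.encode (I : Instance) : List Letter :=
  encodeVote (Equiv.refl (Fin I.m)) ++ encodeNat I.p ++ encodeNat I.k ++
    I.registered.flatMap encodeVote ++ [Letter.bar] ++ I.unregistered.flatMap encodeVote

/-- The language of exact constructive control by replacing voters for the voting rule `E`. -/
def CCRVExact (E : VotingRule) : Language Letter :=
  {x | ∃ I : Instance, I.IsYesExact E ∧ I.encode = x}

end Voting

/-! ### Machine fragments

A fragment is a piece of a transducer with one entry and several exits; fragments are composed by
`bind` (continue at the chosen exit with another fragment) and `iter` (loops). -/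

/-! Only the two top candidates of a vote matter, so a 2-Approval election is a multigraph on the
candidates in which scores are degrees. Let `n` be the number of vertices and `N = n(n-1)/2` the
number of pairs of vertices. The candidates are the preferred one `0`, two auxiliary ones `1` and
`2`, the vertices (shifted by `3`) and `2N` padding candidates. The registered voters are one pair
`(0, 1)`, the nonred edges, and so many copies of `(1, 2)` that there are `N + ⌈n/2⌉` voters besides
the first. The unregistered voters are `N` disjoint padding pairs and the red edges. Exactly `N + k`
voters are to be replaced.

The final election is nonempty and only `(0, 1)` supports `0`, so if `0` wins, then `(0, 1)` is
kept, `0` has score one, and all degrees are at most one. This rules out `(1, 2)`, so the other kept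
voters are `⌈n/2⌉ - k` nonred edges. At most `N` of the new voters are padding, so at least `k` of
them are red edges. Altogether at least `⌈n/2⌉` edges on `n` vertices have degrees at most one, and
the handshake lemma forces a perfect matching with exactly `k` red edges. Conversely, a perfect
matching says which edges to keep and to add, together with all padding pairs. This is
`exists_replacement_iff`; `isYesExact_iff` and `isYes_iff_hasMatching` connect it with votes and
with subgraphs.

The padding also makes the map easy to compute. Every matrix entry yields one registered vote and
one padding pair whatever its color, so `N` and the number of candidates are found by counting
letters, and the votes are printed in two further passes with a fixed number of binary counters. The
number `k` may be exponential in the length of the input, but `2k ≤ n` in every yes-instance, so the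
machine rejects at a bit of weight above `n + 3`. Rejected strings are sent to the empty string,
which encodes no election.

The machine is assembled from fragments. Each carries a contract (`Does`) on registers, output and
space, and contracts compose along `bind` and `iter`. `does_program` and `computable_reduction` give
the logspace bound, `mem_iff_reduction_mem` the correctness. -/

namespace Logspace

/-- Change the next state of an action. -/
def Action.mapState {Q Q' Γ T β : Type} (g : Q → Q') (a : Action Q Γ T β) : Action Q' Γ T β where
  state := g a.state
  inputMove := a.inputMove
  write := a.write
  workMove := a.workMove
  emit := a.emit

/-- A configuration without its state. -/
@[ext]
structure Mem (β T Γ : Type) where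
  inputPos : ℕ
  work : T → ℤ → Γ
  workPos : T → ℤ
  out : List β

namespace Mem

variable {Q β T Γ : Type}

/-- Every work head is within distance `s` of its initial cell. -/
def Within (s : ℕ) (m : Mem β T Γ) : Prop := ∀ t, |m.workPos t| ≤ (s : ℤ)

/-- The effect of an action on an input of length `len`. -/
def apply (len : ℕ) (m : Mem β T Γ) (a : Action Q Γ T β) : Mem β T Γ where
  inputPos := moveInput len a.inputMove m.inputPos
  work := fun t => Function.update (m.work t) (m.workPos t) (a.write t)
  workPos := fun t => moveWork (a.workMove t) (m.workPos t)
  out := m.out ++ a.emit.toList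

@[simp]
theorem apply_mapState {Q' : Type} (len : ℕ) (m : Mem β T Γ) (g : Q → Q') (a : Action Q Γ T β) :
    m.apply len (a.mapState g) = m.apply len a := rfl

end Mem

/-- A machine fragment with exits in `E`. -/
structure Frag (α β T Γ E : Type) where
  Q : Type
  finite_Q : Finite Q
  start : Q
  δ : Q → InputSymbol α → (T → Γ) → Action (Q ⊕ E) Γ T β

namespace Frag

variable {α β T Γ E E' S : Type}

/-- The action performed in state `q`. -/
def action (F : Frag α β T Γ E) (x : List α) (q : F.Q) (m : Mem β T Γ) :
    Action (F.Q ⊕ E) Γ T β :=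
  F.δ q (inputCell x m.inputPos) fun t => m.work t (m.workPos t)

/-- From state `q` and memory `m`, the fragment reaches exit `e` with memory `m'`, and the work heads
stay within distance `s` of their initial cells. -/
inductive Path (F : Frag α β T Γ E) (x : List α) (s : ℕ) (e : E) (m' : Mem β T Γ) :
    F.Q → Mem β T Γ → Prop
  | exit {q : F.Q} {m : Mem β T Γ} (hm : m.Within s) (hs : (F.action x q m).state = .inr e)
      (ha : m.apply x.length (F.action x q m) = m') (hm' : m'.Within s) : Path F x s e m' q m
  | step {q q' : F.Q} {m : Mem β T Γ} (hm : m.Within s) (hs : (F.action x q m).state = .inl q')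
      (h : Path F x s e m' q' (m.apply x.length (F.action x q m))) : Path F x s e m' q m

/-- `Path` from the entry. -/
def Runs (F : Frag α β T Γ E) (x : List α) (s : ℕ) (m : Mem β T Γ) (e : E) (m' : Mem β T Γ) : Prop :=
  F.Path x s e m' F.start m

/-- A single action. -/
def act (f : InputSymbol α → (T → Γ) → Action E Γ T β) : Frag α β T Γ E where
  Q := Unit
  finite_Q := inferInstance
  start := ()
  δ _ i w := (f i w).mapState .inr

theorem runs_act {f : InputSymbol α → (T → Γ) → Action E Γ T β} {x : List α} {s : ℕ}
    {m m' : Mem β T Γ} {e : E} (hm : m.Within s)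
    (he : (f (inputCell x m.inputPos) fun t => m.work t (m.workPos t)).state = e)
    (ha : m.apply x.length (f (inputCell x m.inputPos) fun t => m.work t (m.workPos t)) = m')
    (hm' : m'.Within s) : (act f).Runs x s m e m' := by
  refine Path.exit hm ?_ ?_ hm'
  · exact congrArg Sum.inr he
  · exact ha

/-- A simulation: `φ` embeds the states, and `F'` performs the actions of `F` with exits rewired by
`g`. Here the exit `e` stays an exit; in `Path.lift_trans` it becomes a state from which a second
path continues. The rules for `bind` and `iter` are instances of the two. -/
theorem Path.lift_exit {F : Frag α β T Γ E} {F' : Frag α β T Γ E'} {x : List α} {s : ℕ} {e : E}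
    {e' : E'} {m m' : Mem β T Γ} {q : F.Q} (φ : F.Q → F'.Q) (g : E → F'.Q ⊕ E')
    (hφ : ∀ q m, F'.action x (φ q) m = (F.action x q m).mapState (Sum.elim (fun q => .inl (φ q)) g))
    (hg : g e = .inr e') (h : F.Path x s e m' q m) : F'.Path x s e' m' (φ q) m := by
  induction h with
  | exit hm hs ha hm' =>
    refine Path.exit hm ?_ ?_ hm'
    · rw [hφ, Action.mapState, hs, Sum.elim_inr, hg]
    · rw [hφ, Mem.apply_mapState, ha]
  | @step q q' m hm hs h ih =>
    refine Path.step hm ?_ ?_ (q' := φ q')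
    · rw [hφ, Action.mapState, hs, Sum.elim_inl]
    · rwa [hφ, Mem.apply_mapState]

theorem Path.lift_trans {F : Frag α β T Γ E} {F' : Frag α β T Γ E'} {x : List α} {s : ℕ} {e : E}
    {e' : E'} {m m' m'' : Mem β T Γ} {q : F.Q} {q' : F'.Q} (φ : F.Q → F'.Q) (g : E → F'.Q ⊕ E')
    (hφ : ∀ q m, F'.action x (φ q) m = (F.action x q m).mapState (Sum.elim (fun q => .inl (φ q)) g))
    (hg : g e = .inl q') (h : F.Path x s e m' q m) (h' : F'.Path x s e' m'' q' m') :
    F'.Path x s e' m'' (φ q) m := by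
  induction h with
  | exit hm hs ha hm' =>
    refine Path.step hm ?_ ?_ (q' := q')
    · rw [hφ, Action.mapState, hs, Sum.elim_inr, hg]
    · rwa [hφ, Mem.apply_mapState, ha]
  | @step q q' m hm hs h ih =>
    refine Path.step hm ?_ ?_ (q' := φ q')
    · rw [hφ, Action.mapState, hs, Sum.elim_inl]
    · rwa [hφ, Mem.apply_mapState]

/-- Run `F` and continue at its exit `e` with `G e`. -/
def bind [Finite E] (F : Frag α β T Γ E) (G : E → Frag α β T Γ E') : Frag α β T Γ E' where
  Q := F.Q ⊕ Σ e, (G e).Q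
  finite_Q := by
    have := F.finite_Q
    have := fun e => (G e).finite_Q
    infer_instance
  start := .inl F.start
  δ
    | .inl q, i, w => (F.δ q i w).mapState
      (Sum.elim (fun q' => .inl (.inl q')) fun e => .inl (.inr ⟨e, (G e).start⟩))
    | .inr ⟨e, q⟩, i, w => ((G e).δ q i w).mapState
      (Sum.elim (fun q' => .inl (.inr ⟨e, q'⟩)) .inr)

theorem Runs.bind [Finite E] {F : Frag α β T Γ E} {G : E → Frag α β T Γ E'} {x : List α} {s : ℕ}
    {m m' m'' : Mem β T Γ} {e : E} {e' : E'} (hF : F.Runs x s m e m')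
    (hG : (G e).Runs x s m' e' m'') : (F.bind G).Runs x s m e' m'' :=
  Path.lift_trans (F' := F.bind G) Sum.inl (fun e => .inl (.inr ⟨e, (G e).start⟩))
    (fun _ _ => rfl) rfl hF
    (Path.lift_exit (F' := F.bind G) (fun q => .inr ⟨e, q⟩) .inr (fun _ _ => rfl) rfl hG)

/-- Run `F s`; an exit `inl s'` continues with `F s'`, an exit `inr e` leaves the loop. -/
def iter [Finite S] (F : S → Frag α β T Γ (S ⊕ E)) (s : S) : Frag α β T Γ E where
  Q := Σ s, (F s).Q
  finite_Q := by
    have := fun s => (F s).finite_Q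
    infer_instance
  start := ⟨s, (F s).start⟩
  δ | ⟨s, q⟩, i, w => ((F s).δ q i w).mapState
      (Sum.elim (fun q' => .inl ⟨s, q'⟩) (Sum.map (fun s' => ⟨s', (F s').start⟩) id))

theorem Runs.iter_exit [Finite S] {F : S → Frag α β T Γ (S ⊕ E)} {a : S} {x : List α} {s : ℕ}
    {m m' : Mem β T Γ} {e : E} (h : (F a).Runs x s m (.inr e) m') : (iter F a).Runs x s m e m' :=
  Path.lift_exit (F' := iter F a) (fun q => ⟨a, q⟩) (Sum.map (fun s' => ⟨s', (F s').start⟩) id)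
    (fun _ _ => rfl) rfl h

theorem Runs.iter_step [Finite S] {F : S → Frag α β T Γ (S ⊕ E)} {a b : S} {x : List α} {s : ℕ}
    {m m' m'' : Mem β T Γ} {e : E} (h : (F a).Runs x s m (.inl b) m')
    (h' : (iter F b).Runs x s m' e m'') : (iter F a).Runs x s m e m'' :=
  Path.lift_trans (F' := iter F a) (fun q => ⟨a, q⟩) (Sum.map (fun s' => ⟨s', (F s').start⟩) id)
    (fun _ _ => rfl) rfl h
    -- `iter F a` and `iter F b` differ only in their entry, so the rest of the run is transferred
    -- by the identity on states.
    (Path.lift_exit (F := iter F b) (F' := iter F a) id .inr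
      (fun q m => by
        change _ = Action.mapState (Sum.elim Sum.inl Sum.inr) _
        rw [Sum.elim_inl_inr]
        rfl) rfl h')

/-- The fragment as a transducer, which halts at the exits. -/
def toTransducer [Finite Γ] [Finite T] [Finite E] (F : Frag α β T Γ E) (blank : Γ) :
    Transducer α β where
  Q := F.Q ⊕ E
  Γ := Γ
  T := T
  finite_Q := by
    have := F.finite_Q
    infer_instance
  finite_Γ := inferInstance
  finite_T := inferInstance
  start := .inl F.start
  blank := blank
  δ
    | .inl q, i, w => some (F.δ q i w)
    | .inr _, _, _ => none

/-- A memory together with a state as a configuration. -/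
def config [Finite Γ] [Finite T] [Finite E] (F : Frag α β T Γ E) (blank : Γ) (q : F.Q ⊕ E)
    (m : Mem β T Γ) : (F.toTransducer blank).Config where
  state := q
  inputPos := m.inputPos
  work := m.work
  workPos := m.workPos
  out := m.out

theorem step_config [Finite Γ] [Finite T] [Finite E] (F : Frag α β T Γ E) (blank : Γ) (x : List α)
    (q : F.Q) (m : Mem β T Γ) : (F.toTransducer blank).step x (F.config blank (.inl q) m) =
      some (F.config blank (F.action x q m).state (m.apply x.length (F.action x q m))) := rfl

theorem Path.reaches [Finite Γ] [Finite T] [Finite E] {F : Frag α β T Γ E} {blank : Γ} {x : List α}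
    {s : ℕ} {e : E} {m' m : Mem β T Γ} {q : F.Q} (h : F.Path x s e m' q m) :
    StateTransition.Reaches ((F.toTransducer blank).step x) (F.config blank (.inl q) m)
      (F.config blank (.inr e) m') := by
  induction h with
  | exit hm hs ha hm' =>
    refine Relation.ReflTransGen.single ?_
    rw [step_config, hs, ha]
    rfl
  | step hm hs h ih =>
    refine Relation.ReflTransGen.head ?_ ih
    rw [step_config, hs]
    rfl

/-- The machine is deterministic, so every reachable configuration lies on the path, and the path
records the space bound at each of its memories. -/
theorem Path.space [Finite Γ] [Finite T] [Finite E] {F : Frag α β T Γ E} {blank : Γ} {x : List α}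
    {s : ℕ} {e : E} {m' m : Mem β T Γ} {q : F.Q} (h : F.Path x s e m' q m)
    (c : (F.toTransducer blank).Config) (hc : StateTransition.Reaches
      ((F.toTransducer blank).step x) (F.config blank (.inl q) m) c) (t : T) :
    |c.workPos t| ≤ (s : ℤ) := by
  induction h with
  | exit hm hs ha hm' =>
    rcases Relation.ReflTransGen.cases_head hc with rfl | ⟨d, hd, hc⟩
    · exact hm t
    · rw [step_config, hs, ha, Option.mem_some_iff] at hd
      subst hd
      rcases Relation.ReflTransGen.cases_head hc with rfl | ⟨d, hd, -⟩
      · exact hm' t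
      · cases hd
  | step hm hs h ih =>
    rcases Relation.ReflTransGen.cases_head hc with rfl | ⟨d, hd, hc⟩
    · exact hm t
    · rw [step_config, hs, Option.mem_some_iff] at hd
      subst hd
      exact ih hc

end Frag

/-- The initial memory. -/
def Mem.init (β T : Type) {Γ : Type} (blank : Γ) : Mem β T Γ where
  inputPos := 0
  work := fun _ _ => blank
  workPos := fun _ => 0
  out := []

/-- A fragment that runs in logarithmic space on every input yields a computable function. -/
theorem computable_of_runs {α β T Γ E : Type} [Finite Γ] [Finite T] [Finite E]
    (F : Frag α β T Γ E) (blank : Γ) (f : List α → List β) (C : ℕ)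
    (h : ∀ x, ∃ e m, F.Runs x (C * (Nat.log 2 x.length + 1)) (Mem.init β T blank) e m ∧
      m.out = f x) : Computable f := by
  refine ⟨F.toTransducer blank, C, fun x => ?_⟩
  obtain ⟨e, m, hr, hm⟩ := h x
  exact ⟨⟨F.config blank (.inr e) m, hr.reaches, rfl, hm⟩, fun c hc t => hr.space c hc t⟩

end Logspace

/-! ### Binary counters on work tapes -/

namespace Logspace

/-- The tape with the string `l` written from cell `0` on. -/
def tape (l : List Bool) (z : ℤ) : Option Bool := if z < 0 then none else l[z.toNat]?

theorem tape_natCast (l : List Bool) (n : ℕ) : tape l n = l[n]? := by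
  simp [tape]

theorem tape_of_neg (l : List Bool) {z : ℤ} (hz : z < 0) : tape l z = none := if_pos hz

theorem tape_eq_some (l : List Bool) {z : ℤ} (h0 : 0 ≤ z) (hz : z < l.length) :
    ∃ b, tape l z = some b := by
  lift z to ℕ using h0
  exact ⟨l[z]'(by exact_mod_cast hz), by rw [tape_natCast, List.getElem?_eq_getElem]⟩

theorem tape_nil (z : ℤ) : tape [] z = none := by
  simp [tape]

theorem tape_append_length (l l' : List Bool) : tape (l ++ l') l.length = l'[0]? := by
  rw [tape_natCast, List.getElem?_append_right le_rfl, Nat.sub_self]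

/-- Covers overwriting a bit, appending one, and deleting the last one by a blank. -/
theorem update_tape (l l' : List Bool) (n : ℕ) (w : Option Bool)
    (h : ∀ k, l'[k]? = if k = n then w else l[k]?) :
    Function.update (tape l) n w = tape l' := by
  funext z
  rcases lt_or_ge z 0 with hz | hz
  · rw [Function.update_of_ne (by omega), tape_of_neg _ hz, tape_of_neg _ hz]
  · lift z to ℕ using hz
    rw [tape_natCast, h, Function.update_apply, tape_natCast]
    simp

namespace Frag

variable {α β T E : Type} [DecidableEq T]

/-- The memory with the strings `L` on the tapes and the heads at `P`. -/
def mem (i : ℕ) (L : T → List Bool) (P : T → ℤ) (o : List β) : Mem β T (Option Bool) where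
  inputPos := i
  work t := tape (L t)
  workPos := P
  out := o

/-- An action on the work tape `t` only. -/
def actOn (t : T) (f : Option Bool → Option Bool × Move × Option β × E) :
    Frag α β T (Option Bool) E :=
  act fun _ w =>
    { state := (f (w t)).2.2.2
      inputMove := .stay
      write := Function.update w t (f (w t)).1
      workMove := Function.update (fun _ => .stay) t (f (w t)).2.1
      emit := (f (w t)).2.2.1 }

variable {x : List α} {s : ℕ} {i : ℕ} {L : T → List Bool} {P : T → ℤ} {o : List β}

theorem abs_update_le {t : T} {p : ℤ} (hP : ∀ u, |P u| ≤ (s : ℤ)) (hp : |p| ≤ (s : ℤ)) (u : T) :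
    |Function.update P t p u| ≤ (s : ℤ) := by
  by_cases h : u = t
  · subst h
    rwa [Function.update_self]
  · rw [Function.update_of_ne h]
    exact hP u

/-- The hypothesis `hl` demands that the tape after writing is again a gapless string from cell `0`
on. -/
theorem runs_actOn {t : T} {f : Option Bool → Option Bool × Move × Option β × E} {w : Option Bool}
    {mv : Move} {em : Option β} {e : E} {l : List Bool}
    (hP : ∀ u, |P u| ≤ (s : ℤ)) (hp : |moveWork mv (P t)| ≤ (s : ℤ))
    (hf : f (tape (L t) (P t)) = (w, mv, em, e))
    (hl : Function.update (tape (L t)) (P t) w = tape l) :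
    (actOn (α := α) t f).Runs x s (mem i L P o) e
      (mem i (Function.update L t l) (Function.update P t (moveWork mv (P t)))
        (o ++ em.toList)) := by
  refine runs_act hP ?_ ?_ (abs_update_le hP hp)
  · simp only [mem, hf]
  · simp only [mem, hf, Mem.apply, moveInput, Mem.mk.injEq, true_and, and_true]
    constructor
    · funext u
      by_cases h : u = t
      · subst h
        simp only [Function.update_self, hl]
      · simp only [Function.update_of_ne h, Function.update_eq_self]
    · funext u
      by_cases h : u = t
      · subst h
        simp only [Function.update_self]
      · simp only [Function.update_of_ne h, moveWork]

theorem runs_actOn_read {t : T} {f : Option Bool → Option Bool × Move × Option β × E}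
    {mv : Move} {em : Option β} {e : E} {c : Option Bool} {p : ℤ}
    (hP : ∀ u, |P u| ≤ (s : ℤ)) (hc : tape (L t) (P t) = c) (hf : f c = (c, mv, em, e))
    (hmv : moveWork mv (P t) = p) (hp : |p| ≤ (s : ℤ)) :
    (actOn (α := α) t f).Runs x s (mem i L P o) e
      (mem i L (Function.update P t p) (o ++ em.toList)) := by
  subst hc hmv
  have := runs_actOn (α := α) (x := x) (i := i) (o := o) hP hp hf (Function.update_eq_self _ _)
  rwa [Function.update_eq_self] at this

/-- Repeat an action on the work tape `t`. -/
def scan (t : T) (f : Option Bool → Option Bool × Move × Option β × (Unit ⊕ E)) :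
    Frag α β T (Option Bool) E :=
  iter (fun _ : Unit => actOn t f) ()

theorem runs_scan_exit {t : T} {f : Option Bool → Option Bool × Move × Option β × (Unit ⊕ E)}
    {w : Option Bool} {mv : Move} {em : Option β} {e : E} (l : List Bool) (p : ℤ)
    (hP : ∀ u, |P u| ≤ (s : ℤ)) (hf : f (tape (L t) (P t)) = (w, mv, em, .inr e))
    (hl : Function.update (tape (L t)) (P t) w = tape l) (hmv : moveWork mv (P t) = p)
    (hp : |p| ≤ (s : ℤ)) :
    (scan (α := α) t f).Runs x s (mem i L P o) e
      (mem i (Function.update L t l) (Function.update P t p) (o ++ em.toList)) := by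
  subst hmv
  exact Runs.iter_exit (runs_actOn hP hp hf hl)

theorem runs_scan_step {t : T} {f : Option Bool → Option Bool × Move × Option β × (Unit ⊕ E)}
    {w : Option Bool} {mv : Move} {em : Option β} {e : E} {m : Mem β T (Option Bool)}
    (l : List Bool) (p : ℤ)
    (hP : ∀ u, |P u| ≤ (s : ℤ)) (hf : f (tape (L t) (P t)) = (w, mv, em, .inl ()))
    (hl : Function.update (tape (L t)) (P t) w = tape l) (hmv : moveWork mv (P t) = p)
    (hp : |p| ≤ (s : ℤ))
    (h : (scan (α := α) t f).Runs x s
      (mem i (Function.update L t l) (Function.update P t p) (o ++ em.toList)) e m) :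
    (scan (α := α) t f).Runs x s (mem i L P o) e m := by
  subst hmv
  exact Runs.iter_step (runs_actOn hP hp hf hl) h

theorem update_tape_self {z : ℤ} {w : Option Bool} {l : List Bool} (h : tape l z = w) :
    Function.update (tape l) z w = tape l := by
  rw [← h, Function.update_eq_self]

/-- Return to cell `0` from a nonblank cell or from the cell `-1`, and exit with `e`. -/
def goHome (t : T) (e : E) : Frag α β T (Option Bool) E :=
  scan t fun
    | some b => (some b, .left, none, .inl ())
    | none => (none, .right, none, .inr e)

theorem runs_goHome {t : T} (e : E) (hs : 1 ≤ s) (hP : ∀ u, |P u| ≤ (s : ℤ))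
    (h1 : -1 ≤ P t) (h2 : P t < (L t).length) :
    (goHome (α := α) t e).Runs x s (mem i L P o) e (mem i L (Function.update P t 0) o) := by
  -- `n` is the number of moves to the left until the blank cell `-1`; the final action moves back
  -- to cell `0`.
  obtain ⟨n, hn⟩ : ∃ n : ℕ, P t = (n : ℤ) - 1 := ⟨(P t + 1).toNat, by omega⟩
  induction n generalizing P with
  | zero =>
    have hb : tape (L t) (P t) = none := tape_of_neg _ (by omega)
    simpa [goHome] using
      runs_scan_exit (α := α) (x := x) (i := i) (o := o) (e := e) (em := none) (L t) 0 hP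
      (by rw [hb]) (update_tape_self hb) (by simp [moveWork, hn]) (by simp)
  | succ n ih =>
    obtain ⟨b, hb⟩ := tape_eq_some (L t) (z := P t) (by omega) h2
    have hl : |P t - 1| ≤ (s : ℤ) := by
      have hps := hP t
      rw [abs_le] at hps ⊢
      omega
    refine runs_scan_step (em := none) (L t) (P t - 1) hP (by rw [hb]) (update_tape_self hb) rfl
      hl ?_
    have := ih (P := Function.update P t (P t - 1)) (abs_update_le hP hl)
      (by simp; omega) (by simp; omega) (by simp; omega)
    simpa [goHome] using this

/-- Go to the last nonblank cell (to the cell `-1` if there is none), emitting the cells passed and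
finally a terminator. -/
def goEnd (t : T) (bit : Bool → Option β) (last : Option β) : Frag α β T (Option Bool) Unit :=
  scan t fun
    | some b => (some b, .right, bit b, .inl ())
    | none => (none, .left, last, .inr ())

/-- The string is split at the head, and the induction runs over the part `l` still to be passed. -/
theorem runs_goEnd {t : T} (bit : Bool → Option β) (last : Option β) (pre l : List Bool)
    (hL : L t = pre ++ l) (hPt : P t = pre.length) (hP : ∀ u, |P u| ≤ (s : ℤ)) (hs : 1 ≤ s)
    (hls : (L t).length ≤ s) :
    (goEnd (α := α) t bit last).Runs x s (mem i L P o) ()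
      (mem i L (Function.update P t ((L t).length - 1))
        (o ++ l.flatMap (fun b => (bit b).toList) ++ last.toList)) := by
  induction l generalizing pre P o with
  | nil =>
    have hb : tape (L t) (P t) = none := by
      rw [hL, hPt, tape_append_length]; rfl
    have hlen : (L t).length = pre.length := by simp [hL]
    simpa [goEnd] using runs_scan_exit (α := α) (x := x) (i := i) (o := o) (e := ()) (em := last) (L t)
      ((L t).length - 1) hP (by rw [hb]) (update_tape_self hb) (by simp [moveWork, hPt, hlen])
      (by rw [abs_le]; omega)
  | cons b l ih =>
    have hb : tape (L t) (P t) = some b := by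
      rw [hL, hPt, tape_append_length]; rfl
    have hlen : (L t).length = pre.length + l.length + 1 := by simp [hL]; omega
    have hl : |(pre.length : ℤ) + 1| ≤ (s : ℤ) := by
      rw [abs_le]
      omega
    refine runs_scan_step (em := bit b) (L t) (pre.length + 1) hP (by rw [hb]) (update_tape_self hb)
      (by rw [hPt]; rfl) hl ?_
    have := ih (P := Function.update P t (pre.length + 1)) (o := o ++ (bit b).toList) (pre ++ [b])
      (by simp [hL]) (by simp) (abs_update_le hP hl)
    simpa [goEnd] using this

/-- Emit the counter on tape `t`. -/
def emitBits (t : T) (bit : Bool → β) (last : β) : Frag α β T (Option Bool) Unit :=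
  (goEnd t (fun b => some (bit b)) (some last)).bind fun _ => goHome t ()

theorem runs_emitBits {t : T} (bit : Bool → β) (last : β) (hs : 1 ≤ s) (hls : (L t).length ≤ s) :
    (emitBits (α := α) t bit last).Runs x s (mem i L (fun _ => 0) o) ()
      (mem i L (fun _ => 0) (o ++ ((L t).map bit ++ [last]))) := by
  have hP : ∀ u : T, |(fun _ => 0 : T → ℤ) u| ≤ (s : ℤ) := by simp
  have h1 := runs_goEnd (α := α) (x := x) (i := i) (o := o) (t := t) (P := fun _ => 0)
    (fun b => some (bit b)) (some last) [] (L t) rfl rfl hP hs hls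
  refine h1.bind ?_
  have h2 := runs_goHome (α := α) (x := x) (i := i) (t := t) (s := s) (L := L)
    (o := o ++ (L t).flatMap (fun b => (some (bit b)).toList) ++ (some last).toList)
    (P := Function.update (fun _ => 0) t (((L t).length : ℤ) - 1)) () hs
    (abs_update_le hP (by rw [abs_le]; omega)) (by simp; omega) (by simp)
  have hmap : ∀ l : List Bool, l.flatMap (fun b => [bit b]) = l.map bit := fun l => by
    induction l <;> simp_all
  simpa [hmap] using h2

/-- Erase the tape `t`. -/
def clear (t : T) : Frag α β T (Option Bool) Unit :=
  (goEnd t (fun _ => none) none).bind fun _ => scan t fun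
    | some _ => (none, .left, none, .inl ())
    | none => (none, .right, none, .inr ())

/-- Erasing from right to left keeps the tape a string from cell `0` on after every step, hence the
induction from the right end. -/
theorem runs_erase {t : T} (hs : 1 ≤ s) (hP : ∀ u, |P u| ≤ (s : ℤ)) (hPt : P t = (L t).length - 1) :
    (scan (α := α) t fun
      | some _ => (none, .left, none, .inl ())
      | none => (none, .right, none, .inr ())).Runs x s (mem i L P o) ()
      (mem i (Function.update L t []) (Function.update P t 0) o) := by
  induction h : (L t) using List.reverseRecOn generalizing L P with
  | nil =>
    rw [h] at hPt
    have hb : tape (L t) (P t) = none := by rw [h, tape_nil]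
    simpa using runs_scan_exit (α := α) (x := x) (i := i) (o := o) (e := ()) (em := none) [] 0 hP
      (by rw [hb]) (by rw [h]; exact update_tape_self (tape_nil _)) (by simp [moveWork, hPt])
      (by simp)
  | append_singleton l b ih =>
    have hPt' : P t = l.length := by simp [hPt, h]
    have hb : tape (L t) (P t) = some b := by rw [h, hPt', tape_append_length]; rfl
    have hl : |P t - 1| ≤ (s : ℤ) := by
      have hps := hP t
      rw [abs_le] at hps ⊢
      omega
    refine runs_scan_step (em := none) l (P t - 1) hP (by rw [hb]) ?_ rfl hl ?_
    · rw [h, hPt']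
      refine update_tape _ _ _ _ fun k => ?_
      grind
    · have := ih (L := Function.update L t l) (P := Function.update P t (P t - 1))
        (abs_update_le hP hl) (by simp [hPt']) (by simp)
      simpa using this

theorem runs_clear {t : T} (hs : 1 ≤ s) (hls : (L t).length ≤ s) :
    (clear (α := α) t).Runs x s (mem i L (fun _ => 0) o) ()
      (mem i (Function.update L t []) (fun _ => 0) o) := by
  have hP : ∀ u : T, |(fun _ => 0 : T → ℤ) u| ≤ (s : ℤ) := by simp
  have h1 := runs_goEnd (α := α) (x := x) (i := i) (o := o) (t := t) (P := fun _ => 0)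
    (fun _ => none) none [] (L t) rfl rfl hP hs hls
  have h2 := runs_erase (α := α) (x := x) (i := i) (t := t) (s := s) (L := L) (o := o)
    (P := Function.update (fun _ => 0) t (((L t).length : ℤ) - 1)) hs
    (abs_update_le hP (by rw [abs_le]; omega)) (by simp)
  refine h1.bind ?_
  have hnil : ∀ l : List Bool, l.flatMap (fun _ => ([] : List β)) = [] := fun l => by simp
  simpa [hnil] using h2

/-- Binary increment, least significant bit first. -/
def incBits : List Bool → List Bool
  | [] => [true]
  | false :: l => true :: l
  | true :: l => false :: incBits l

/-- The tapes always hold numerals without superfluous zeros: `Nat.binaryRec'` provides the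
condition on the leading bit that `Nat.bits_append_bit` needs. Hence registers can be compared as
strings. -/
theorem incBits_bits (n : ℕ) : incBits n.bits = (n + 1).bits := by
  induction n using Nat.binaryRec' with
  | zero => simp [incBits]
  | bit b n h ih =>
    rw [Nat.bits_append_bit _ _ h]
    cases b with
    | false =>
      rw [incBits, show Nat.bit false n + 1 = Nat.bit true n by simp [Nat.bit_val],
        Nat.bits_append_bit _ _ (by simp)]
    | true =>
      rw [incBits, ih, show Nat.bit true n + 1 = Nat.bit false (n + 1) by simp [Nat.bit_val]; ring,
        Nat.bits_append_bit _ _ (by simp)]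

theorem length_incBits_pos (l : List Bool) : 1 ≤ (incBits l).length := by
  cases l with
  | nil => simp [incBits]
  | cons b l => cases b <;> simp [incBits]

/-- Increment the counter on tape `t`. -/
def inc (t : T) : Frag α β T (Option Bool) Unit :=
  (scan t fun
    | some true => (some false, .right, none, .inl ())
    | _ => (some true, .stay, none, .inr ())).bind fun _ => goHome t ()

/-- The cell `p` at which the carry stops need not be known. It lies within the new string, which is
what `goHome` requires. -/
theorem runs_carry {t : T} (hP : ∀ u, |P u| ≤ (s : ℤ)) (pre l : List Bool)
    (hL : L t = pre ++ l) (hPt : P t = pre.length) (hs : pre.length + (incBits l).length ≤ s) :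
    ∃ p : ℕ, p < pre.length + (incBits l).length ∧ (scan (α := α) t fun
      | some true => (some false, .right, none, .inl ())
      | _ => (some true, .stay, none, .inr ())).Runs x s (mem i L P o) ()
      (mem i (Function.update L t (pre ++ incBits l)) (Function.update P t p) o) := by
  induction l generalizing pre L P with
  | nil =>
    have hb : tape (L t) (P t) = none := by
      rw [hL, hPt, tape_append_length]; rfl
    refine ⟨pre.length, by simp [incBits], ?_⟩
    simpa [incBits] using runs_scan_exit (α := α) (x := x) (i := i) (o := o) (e := ()) (em := none)
      (pre ++ [true]) pre.length hP (by rw [hb]) (by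
        rw [hL, hPt]
        refine update_tape _ _ _ _ fun k => ?_
        grind) (by rw [hPt]; rfl) (hPt ▸ hP t)
  | cons b l ih =>
    have hb : tape (L t) (P t) = some b := by
      rw [hL, hPt, tape_append_length]; rfl
    cases b with
    | false =>
      refine ⟨pre.length, by simp [incBits], ?_⟩
      simpa [incBits] using runs_scan_exit (α := α) (x := x) (i := i) (o := o) (e := ())
        (em := none) (pre ++ true :: l) pre.length hP (by rw [hb]) (by
          rw [hL, hPt]
          refine update_tape _ _ _ _ fun k => ?_
          grind) (by rw [hPt]; rfl) (hPt ▸ hP t)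
    | true =>
      simp only [incBits, List.length_cons] at hs
      have hl : |(pre.length : ℤ) + 1| ≤ (s : ℤ) := by
        have := length_incBits_pos l
        rw [abs_le]
        omega
      obtain ⟨p, hp, hr⟩ := ih (P := Function.update P t (pre.length + 1))
        (L := Function.update L t (pre ++ false :: l)) (abs_update_le hP hl) (pre ++ [false])
        (by simp) (by simp) (by simp; omega)
      refine ⟨p, by simpa [incBits, Nat.add_assoc, Nat.add_comm] using hp,
          runs_scan_step (em := none) (pre ++ false :: l)
        (pre.length + 1) hP (by rw [hb]) ?_ (by rw [hPt]; rfl) hl ?_⟩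
      · rw [hL, hPt]
        refine update_tape _ _ _ _ fun k => ?_
        grind
      · simpa [incBits] using hr

theorem runs_inc {t : T} (hs : (incBits (L t)).length ≤ s) :
    (inc (α := α) t).Runs x s (mem i L (fun _ => 0) o) ()
      (mem i (Function.update L t (incBits (L t))) (fun _ => 0) o) := by
  obtain ⟨p, hp, hr⟩ := runs_carry (α := α) (x := x) (i := i) (L := L) (P := fun _ => 0) (o := o)
    (t := t) (s := s) (by simp) [] (L t) rfl rfl (by simpa using hs)
  refine hr.bind ?_
  simp only [List.length_nil, zero_add] at hp
  have := runs_goHome (α := α) (x := x) (i := i) (o := o) (t := t) (s := s)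
    (L := Function.update L t (incBits (L t))) (P := Function.update (fun _ => 0) t (p : ℤ)) ()
    (le_trans (length_incBits_pos _) hs) (abs_update_le (by simp) (by rw [abs_le]; omega)) (by simp)
    (by simpa using hp)
  simpa using this

/-- Compare the scanned cells of the tapes `t` and `u`. -/
def eqCell (t u : T) : Frag α β T (Option Bool) (Unit ⊕ Bool) :=
  (actOn t fun c => (c, .stay, none, c)).bind fun c =>
  (actOn u fun d => if c = d ∧ c ≠ none then (d, .right, none, none)
    else (d, .left, none, some (decide (c = d)))).bind fun r =>
  actOn t fun c => match r with
    | none => (c, .right, none, .inl ())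
    | some b => (c, .left, none, .inr b)

/-- If the cells agree and are not blank, both heads go right and the comparison continues (`r =
none`). Otherwise the verdict is whether `c = d`, and both heads step left, so that they stand on a
nonblank cell or on the cell `-1`, as `goHome` requires. -/
theorem runs_eqCell {t u : T} (htu : t ≠ u) {c d : Option Bool} {mv : Move} {r : Option Bool}
    {n p : ℤ} (hP : ∀ u, |P u| ≤ (s : ℤ)) (hc : tape (L t) (P t) = c) (hd : tape (L u) (P u) = d)
    (hPt : P t = n) (hPu : P u = n) (hp : |p| ≤ (s : ℤ)) (hmv : moveWork mv n = p)
    (h : (c = d ∧ c ≠ none ∧ mv = .right ∧ r = none) ∨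
      (¬ (c = d ∧ c ≠ none) ∧ mv = .left ∧ r = some (decide (c = d)))) :
    (eqCell (α := α) t u).Runs x s (mem i L P o) (r.elim (.inl ()) .inr)
      (mem i L (Function.update (Function.update P u p) t p) o) := by
  have h1 := runs_actOn_read (α := α) (x := x) (i := i) (L := L) (o := o) (t := t) (em := none)
    (f := fun c => (c, .stay, none, c)) (mv := .stay) (p := P t) hP hc rfl rfl (hP t)
  simp only [Function.update_eq_self, Option.toList_none, List.append_nil] at h1
  refine h1.bind ((runs_actOn_read (mv := mv) (em := none) (e := r) hP hd ?_ (by rw [hPu, hmv])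
    hp).bind ?_)
  · rcases h with ⟨h1, h2, rfl, rfl⟩ | ⟨h, rfl, rfl⟩
    · rw [if_pos ⟨h1, h2⟩]
    · rw [if_neg h]
  · have := runs_actOn_read (α := α) (x := x) (i := i) (L := L) (o := o) (t := t) (c := c) (mv := mv)
      (em := none) (p := p) (P := Function.update P u p) (e := r.elim (Sum.inl ()) Sum.inr)
      (f := fun c => match r with
        | none => (c, .right, none, .inl ())
        | some b => (c, .left, none, .inr b)) (abs_update_le hP hp) (by simpa [htu] using hc)
      (by rcases h with ⟨h1, h2, rfl, rfl⟩ | ⟨h, rfl, rfl⟩ <;> rfl)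
      (by simp [htu, hPt, hmv]) hp
    simpa using this

/-- Compare the strings on the tapes `t` and `u`. -/
def eq (t u : T) : Frag α β T (Option Bool) Bool :=
  (iter (fun _ : Unit => eqCell t u) ()).bind fun b => (goHome t ()).bind fun _ => goHome u b

theorem update_update_update_update {t u : T} (htu : t ≠ u) (P : T → ℤ) (a b c d : ℤ) :
    Function.update (Function.update (Function.update (Function.update P u a) t b) u c) t d =
      Function.update (Function.update P u c) t d := by
  rw [Function.update_comm htu, Function.update_idem, Function.update_idem]

theorem runs_eqCells {t u : T} (htu : t ≠ u) (pre l l' : List Bool) (hL : L t = pre ++ l)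
    (hL' : L u = pre ++ l') (hPt : P t = pre.length) (hPu : P u = pre.length) (hs : 1 ≤ s)
    (hls : (L t).length ≤ s) (hP : ∀ u, |P u| ≤ (s : ℤ)) :
    ∃ p : ℤ, -1 ≤ p ∧ p < (L t).length ∧ p < (L u).length ∧ |p| ≤ (s : ℤ) ∧
    (iter (fun _ : Unit => eqCell (α := α) t u) ()).Runs x s (mem i L P o) (decide (L t = L u))
      (mem i L (Function.update (Function.update P u p) t p) o) := by
  induction l generalizing pre l' P with
  | nil =>
    have hc : tape (L t) (P t) = none := by rw [hL, hPt, tape_append_length]; rfl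
    have hd : tape (L u) (P u) = l'[0]? := by rw [hL', hPu, tape_append_length]
    have hlen : pre.length ≤ s := by simpa [hL] using hls
    have hp : |(pre.length : ℤ) - 1| ≤ s := by rw [abs_le]; omega
    refine ⟨pre.length - 1, by omega, by simp [hL], by simp [hL'], hp, Runs.iter_exit ?_⟩
    have := runs_eqCell (α := α) (x := x) (i := i) (o := o) htu (mv := .left)
      (r := some (decide (none = l'[0]?))) hP hc hd hPt hPu hp rfl
      (.inr ⟨by simp, rfl, rfl⟩)
    -- The string on `t` ends at this cell, so equality means that the string on `u` ends here too.
    have hiff : none = l'[0]? ↔ L t = L u := by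
      rw [hL, hL', List.append_cancel_left_eq]
      cases l' <;> simp
    rwa [decide_eq_decide.mpr hiff] at this
  | cons b l ih =>
    have hc : tape (L t) (P t) = some b := by rw [hL, hPt, tape_append_length]; rfl
    have hd : tape (L u) (P u) = l'[0]? := by rw [hL', hPu, tape_append_length]
    have hlen : pre.length + l.length + 1 ≤ s := by simp [hL] at hls; omega
    by_cases hb : some b = l'[0]?
    · obtain ⟨l', rfl⟩ : ∃ l'', l' = b :: l'' := by cases l' <;> simp_all
      have hp : |(pre.length : ℤ) + 1| ≤ s := by rw [abs_le]; omega
      have h1 := runs_eqCell (α := α) (x := x) (i := i) (o := o) htu (mv := .right)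
        (r := none) hP hc hd hPt hPu hp rfl (.inl ⟨rfl, by simp, rfl, rfl⟩)
      obtain ⟨p, hp1, hp2, hp3, hp4, hr⟩ := ih
        (P := Function.update (Function.update P u (pre.length + 1)) t (pre.length + 1))
        (pre ++ [b]) l' (by simp [hL]) (by simp [hL']) (by simp)
        (by simp [htu.symm]) (abs_update_le (abs_update_le hP hp) hp)
      refine ⟨p, hp1, hp2, hp3, hp4, Runs.iter_step h1 ?_⟩
      rwa [update_update_update_update htu] at hr
    · have hp : |(pre.length : ℤ) - 1| ≤ s := by rw [abs_le]; omega
      refine ⟨pre.length - 1, by omega, by simp [hL]; omega, by simp [hL'], hp,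
        Runs.iter_exit ?_⟩
      have := runs_eqCell (α := α) (x := x) (i := i) (o := o) htu (mv := .left)
        (r := some (decide (some b = l'[0]?))) hP hc hd hPt hPu hp rfl
        (.inr ⟨fun h => hb h.1, rfl, rfl⟩)
      have hiff : some b = l'[0]? ↔ L t = L u := by
        rw [hL, hL', List.append_cancel_left_eq]
        refine iff_of_false hb ?_
        rintro rfl
        simp at hb
      rwa [decide_eq_decide.mpr hiff] at this

theorem runs_eq {t u : T} (htu : t ≠ u) (hs : 1 ≤ s) (hls : (L t).length ≤ s) :
    (eq (α := α) t u).Runs x s (mem i L (fun _ => 0) o) (decide (L t = L u))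
      (mem i L (fun _ => 0) o) := by
  have hP : ∀ u : T, |(fun _ => 0 : T → ℤ) u| ≤ (s : ℤ) := by simp
  obtain ⟨p, hp1, hp2, hp3, hp, hr⟩ := runs_eqCells (α := α) (x := x) (i := i) (o := o) htu [] (L t)
    (L u) rfl rfl rfl rfl hs hls hP
  have h1 := runs_goHome (α := α) (x := x) (i := i) (o := o) (L := L) (t := t)
    (P := Function.update (Function.update (fun _ => 0) u p) t p) () hs
    (abs_update_le (abs_update_le hP hp) hp) (by simpa) (by simpa)
  have h0 : Function.update (Function.update (fun _ : T => (0 : ℤ)) u p) t 0 =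
      Function.update (fun _ => 0) u p := Function.update_eq_self_iff.mpr (by simp [htu])
  rw [Function.update_idem, h0] at h1
  have h2 := runs_goHome (α := α) (x := x) (i := i) (o := o) (L := L) (t := u)
    (P := Function.update (fun _ => 0) u p) (decide (L t = L u)) hs
    (abs_update_le hP hp) (by simpa) (by simpa)
  rw [Function.update_idem, Function.update_eq_self] at h2
  exact hr.bind (h1.bind h2)

end Frag
end Logspace

/-! ### Programs on registers -/

namespace Logspace

/-- The names of the registers. -/
inductive Reg
  | i | j | k | m | c | d | e | pow | tmp | cnt | zero | one | two | three
  deriving DecidableEq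

instance : Finite Reg :=
  .of_surjective (fun n : Fin 14 => [Reg.i, .j, .k, .m, .c, .d, .e, .pow, .tmp, .cnt, .zero, .one,
    .two, .three].get n) fun t => by cases t <;> decide

/-- The contents of the registers. -/
structure Regs where
  i : ℕ
  j : ℕ
  k : ℕ
  m : ℕ
  c : ℕ
  d : ℕ
  e : ℕ
  pow : ℕ
  tmp : ℕ
  cnt : ℕ
  zero : ℕ
  one : ℕ
  two : ℕ
  three : ℕ

namespace Regs

def get (r : Regs) : Reg → ℕ
  | .i => r.i
  | .j => r.j
  | .k => r.k
  | .m => r.m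
  | .c => r.c
  | .d => r.d
  | .e => r.e
  | .pow => r.pow
  | .tmp => r.tmp
  | .cnt => r.cnt
  | .zero => r.zero
  | .one => r.one
  | .two => r.two
  | .three => r.three

def set (r : Regs) (t : Reg) (v : ℕ) : Regs :=
  match t with
  | .i => { r with i := v }
  | .j => { r with j := v }
  | .k => { r with k := v }
  | .m => { r with m := v }
  | .c => { r with c := v }
  | .d => { r with d := v }
  | .e => { r with e := v }
  | .pow => { r with pow := v }
  | .tmp => { r with tmp := v }
  | .cnt => { r with cnt := v }
  | .zero => { r with zero := v }
  | .one => { r with one := v }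
  | .two => { r with two := v }
  | .three => { r with three := v }

theorem get_set (r : Regs) (t : Reg) (v : ℕ) : (r.set t v).get = Function.update r.get t v := by
  funext u
  cases t <;> cases u <;> rfl

theorem set_set (r : Regs) (t : Reg) (v v' : ℕ) : (r.set t v).set t v' = r.set t v' := by
  cases t <;> rfl

@[simp]
theorem get_set_self (r : Regs) (t : Reg) (v : ℕ) : (r.set t v).get t = v := by
  rw [get_set, Function.update_self]

theorem get_set_of_ne (r : Regs) {t u : Reg} (v : ℕ) (h : u ≠ t) : (r.set t v).get u = r.get u := by
  rw [get_set, Function.update_of_ne h]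

/-- The tape contents. -/
def bits (r : Regs) (t : Reg) : List Bool := (r.get t).bits

theorem bits_set (r : Regs) (t : Reg) (v : ℕ) :
    (r.set t v).bits = Function.update r.bits t v.bits := by
  funext u
  rw [bits, get_set, Function.update_apply, Function.update_apply]
  split_ifs <;> rfl

end Regs

namespace Frag

variable {α β E E' S : Type} {x : List α} {s : ℕ} {i i' i'' : ℕ} {r r' r'' : Regs}
  {o o' o'' : List β} {e : E} {e' : E'}

/-- Fragments with one register per work tape. -/
abbrev RegFrag (α β E : Type) : Type 1 := Frag α β Reg (Option Bool) E

/-- With registers below `2 ^ s`, the fragment runs from the first to the second state. -/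
def Does (F : RegFrag α β E) (x : List α) (s i : ℕ) (r : Regs) (o : List β) (e : E) (i' : ℕ)
    (r' : Regs) (o' : List β) : Prop :=
  3 ≤ s → (∀ t, r.get t < 2 ^ s) →
    F.Runs x s (mem i r.bits (fun _ => 0) o) e (mem i' r'.bits (fun _ => 0) o') ∧
      ∀ t, r'.get t < 2 ^ s

theorem Does.bind [Finite E] {F : RegFrag α β E} {G : E → RegFrag α β E'}
    (hF : F.Does x s i r o e i' r' o') (hG : (G e).Does x s i' r' o' e' i'' r'' o'') :
    (F.bind G).Does x s i r o e' i'' r'' o'' := fun hs h =>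
  have h1 := hF hs h
  have h2 := hG hs h1.2
  ⟨h1.1.bind h2.1, h2.2⟩

theorem Does.iter_exit [Finite S] {F : S → RegFrag α β (S ⊕ E)} {a : S}
    (h : (F a).Does x s i r o (.inr e) i' r' o') :
    Does (iter F a) x s i r o e i' r' o' := fun hs hr =>
  have h1 := h hs hr
  ⟨h1.1.iter_exit, h1.2⟩

theorem Does.iter_step [Finite S] {F : S → RegFrag α β (S ⊕ E)} {a b : S}
    (h : (F a).Does x s i r o (.inl b) i' r' o')
    (h' : Does (iter F b) x s i' r' o' e i'' r'' o'') :
    Does (iter F a) x s i r o e i'' r'' o'' := fun hs hr =>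
  have h1 := h hs hr
  have h2 := h' hs h1.2
  ⟨h1.1.iter_step h2.1, h2.2⟩

/-- Run `F` and then `G`. -/
def seq (F : RegFrag α β Unit) (G : RegFrag α β E) : RegFrag α β E := F.bind fun _ => G

theorem Does.seq {F : RegFrag α β Unit} {G : RegFrag α β E} (hF : F.Does x s i r o () i' r' o')
    (hG : G.Does x s i' r' o' e i'' r'' o'') : (F.seq G).Does x s i r o e i'' r'' o'' :=
  Does.bind hF hG

/-- Act on the input head and the output only. -/
def actInput (f : InputSymbol α → Move × Option β × E) : RegFrag α β E :=
  act fun a w =>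
    { state := (f a).2.2
      inputMove := (f a).1
      write := w
      workMove := fun _ => .stay
      emit := (f a).2.1 }

theorem does_actInput {f : InputSymbol α → Move × Option β × E} {mv : Move} {em : Option β}
    (hf : f (inputCell x i) = (mv, em, e)) (hi : moveInput x.length mv i = i')
    (ho : o ++ em.toList = o') : (actInput f).Does x s i r o e i' r o' := by
  subst hi ho
  refine fun _ hr => ⟨runs_act (by simp [Mem.Within, mem]) ?_ ?_ (by simp [Mem.Within, mem]), hr⟩
  · simp only [mem, hf]
  · simp only [mem, hf, Mem.apply, moveWork, Function.update_eq_self]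

/-- Exit with `e`. -/
def ret (e : E) : RegFrag α β E := actInput fun _ => (.stay, none, e)

theorem does_ret : (ret e).Does x s i r o e i r o :=
  does_actInput rfl rfl (by simp)

/-- Write a letter. -/
def emit (b : β) : RegFrag α β Unit := actInput fun _ => (.stay, some b, ())

theorem does_emit {b : β} : (emit b).Does x s i r o () i r (o ++ [b]) :=
  does_actInput rfl rfl (by simp)

/-- Move the input head to the right. -/
def advance : RegFrag α β Unit := actInput fun _ => (.right, none, ())

theorem does_advance (hi : i ≤ x.length) :
    (advance : RegFrag α β Unit).Does x s i r o () (i + 1) r o :=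
  does_actInput rfl (by simp [moveInput, hi]) (by simp)

/-- Read the scanned letter, which is `none` at the end of the input. -/
def look : RegFrag α β (Option α) := actInput fun
  | .letter a => (.stay, none, some a)
  | _ => (.stay, none, none)

theorem does_look {pre l : List α} (hx : x = pre ++ l) (hi : i = pre.length + 1) :
    (look : RegFrag α β (Option α)).Does x s i r o l[0]? i r o := by
  have : x[pre.length]? = l[0]? := by rw [hx, List.getElem?_append_right le_rfl, Nat.sub_self]
  refine does_actInput (mv := .stay) (em := none) ?_ rfl (by simp)
  rw [hi, inputCell, this]
  cases l[0]? <;> rfl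

/-- Move the input head to the first letter. -/
def rewind : RegFrag α β Unit := iter (fun _ : Unit => actInput fun
  | .leftEnd => (.right, none, .inr ())
  | _ => (.left, none, .inl ())) ()

theorem does_rewind : (rewind : RegFrag α β Unit).Does x s i r o () 1 r o := by
  induction i with
  | zero =>
    exact Does.iter_exit (does_actInput (mv := .right) (em := none) rfl (by simp [moveInput])
      (by simp))
  | succ i ih =>
    refine Does.iter_step (b := ()) (does_actInput (mv := .left) (em := none) ?_ rfl (by simp)) ih
    simp only [inputCell]
    cases x[i]? <;> rfl

/-! ### Contracts of the register operations -/

theorem length_bits_le {n : ℕ} (h : n < 2 ^ s) : n.bits.length ≤ s := by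
  rw [Nat.size_eq_bits_len]
  exact Nat.size_le.mpr h

theorem does_inc {t : Reg} (ht : r.get t + 1 < 2 ^ s) :
    Does (α := α) (inc t) x s i r o () i (r.set t (r.get t + 1)) o := by
  refine fun _ hr => ⟨?_, fun u => ?_⟩
  · rw [Regs.bits_set, ← incBits_bits]
    exact runs_inc (by rw [Regs.bits, incBits_bits]; exact length_bits_le ht)
  · rw [Regs.get_set, Function.update_apply]
    split_ifs
    exacts [ht, hr u]

theorem does_clear {t : Reg} : Does (α := α) (clear t) x s i r o () i (r.set t 0) o := by
  refine fun hs hr => ⟨?_, fun u => ?_⟩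
  · rw [Regs.bits_set, Nat.zero_bits]
    exact runs_clear (by omega) (length_bits_le (hr t))
  · rw [Regs.get_set, Function.update_apply]
    split_ifs
    exacts [by positivity, hr u]

theorem bits_injective : Function.Injective Nat.bits := fun m n h =>
  Nat.eq_of_testBit_eq fun a => by rw [Nat.testBit_eq_inth, h, Nat.testBit_eq_inth]

theorem does_eq {t u : Reg} (htu : t ≠ u) :
    Does (α := α) (eq t u) x s i r o (decide (r.get t = r.get u)) i r o := by
  refine fun hs hr => ⟨?_, hr⟩
  rw [← decide_eq_decide.mpr bits_injective.eq_iff]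
  exact runs_eq htu (by omega) (length_bits_le (hr t))

theorem does_emitBits {t : Reg} (bit : Bool → β) (last : β) :
    Does (α := α) (emitBits t bit last) x s i r o () i r
      (o ++ ((r.get t).bits.map bit ++ [last])) :=
  fun hs hr => ⟨runs_emitBits bit last (by omega) (length_bits_le (hr t)), hr⟩

/-- Run `F` as long as the registers `t` and `u` differ. -/
def whileNe (t u : Reg) (F : RegFrag α β Unit) : RegFrag α β Unit :=
  iter (fun _ : Unit => (eq t u).bind fun b =>
    if b then ret (.inr ()) else F.seq (ret (.inl ()))) ()

/-- `R a` and `O a` are the registers and the output after `a` rounds. The induction removes the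
first round by shifting both families. -/
theorem does_whileNe {t u : Reg} (htu : t ≠ u) {F : RegFrag α β Unit} (R : ℕ → Regs)
    (O : ℕ → List β) (n : ℕ) (hn : (R n).get t = (R n).get u)
    (h : ∀ a < n, (R a).get t ≠ (R a).get u ∧ F.Does x s i (R a) (O a) () i (R (a + 1)) (O (a + 1)))
    (hr : r = R 0) (ho : o = O 0) (hr' : r' = R n) (ho' : o' = O n) :
    (whileNe t u F).Does x s i r o () i r' o' := by
  subst hr ho hr' ho'
  induction n generalizing R O with
  | zero =>
    refine Does.iter_exit ((does_eq htu).bind ?_)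
    rw [decide_eq_true hn]
    exact does_ret
  | succ n ih =>
    have h0 := h 0 (by omega)
    refine Does.iter_step (b := ()) ((does_eq htu).bind ?_)
      (ih (fun a => R (a + 1)) (fun a => O (a + 1)) hn fun a ha => h (a + 1) (by omega))
    rw [decide_eq_false h0.1]
    exact h0.2.seq does_ret

/-- Set the register `t` to `3`. -/
def setThree (t : Reg) : RegFrag α β Unit :=
  (clear t).seq ((inc t).seq ((inc t).seq (inc t)))

theorem does_setThree {t : Reg} (hs : 3 ≤ s) :
    Does (α := α) (setThree t) x s i r o () i (r.set t 3) o := by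
  have hs' : 2 ^ 3 ≤ 2 ^ s := Nat.pow_le_pow_right (by omega) hs
  have h0 := does_clear (α := α) (x := x) (s := s) (i := i) (r := r) (o := o) (t := t)
  have h := fun v (hv : v < 3) => does_inc (α := α) (x := x) (s := s) (i := i) (r := r.set t v)
    (o := o) (t := t) (by rw [Regs.get_set_self]; omega)
  simp only [Regs.get_set_self, Regs.set_set] at h
  exact h0.seq ((h 0 (by omega)).seq ((h 1 (by omega)).seq (h 2 (by omega))))

/-- Copy the register `u` to the register `t`. -/
def copy (t u : Reg) : RegFrag α β Unit := (clear t).seq (whileNe t u (inc t))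

theorem does_copy {t u : Reg} (htu : t ≠ u) (hu : r.get u < 2 ^ s) :
    Does (α := α) (copy t u) x s i r o () i (r.set t (r.get u)) o := by
  refine does_clear.seq (does_whileNe htu (fun a => r.set t a) (fun _ => o) (r.get u) ?_
    (fun a ha => ⟨?_, ?_⟩) rfl rfl rfl rfl)
  · rw [Regs.get_set_self, Regs.get_set_of_ne _ _ htu.symm]
  · rw [Regs.get_set_self, Regs.get_set_of_ne _ _ htu.symm]
    exact ha.ne
  · have := does_inc (α := α) (x := x) (s := s) (i := i) (r := r.set t a)
      (o := o) (t := t) (by rw [Regs.get_set_self]; omega)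
    rwa [Regs.get_set_self, Regs.set_set] at this

end Frag
end Logspace

/-! ### The reduction as a function on strings -/

namespace ExactMatching

instance : Finite Letter :=
  .of_surjective (fun n : Fin 6 => [Letter.noEdge, .nonredEdge, .redEdge, .rowEnd, .bit true,
    .bit false].get n) fun
    | .noEdge => ⟨0, rfl⟩
    | .nonredEdge => ⟨1, rfl⟩
    | .redEdge => ⟨2, rfl⟩
    | .rowEnd => ⟨3, rfl⟩
    | .bit true => ⟨4, rfl⟩
    | .bit false => ⟨5, rfl⟩

noncomputable instance : DecidableEq Letter := Classical.decEq Letter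

end ExactMatching

namespace Reduction

open ExactMatching Logspace

/-- The vote with the candidates `a` and `b` on top, followed by the other candidates in order. -/
def voteString (m a b : ℕ) : List Voting.Letter :=
  Voting.encodeNat a ++ Voting.encodeNat b ++
    ((List.range m).filter fun c => c ≠ a ∧ c ≠ b).flatMap Voting.encodeNat ++ [.semicolon]

/-- Read the adjacency matrix from row `i` and column `j` on (both shifted by `3`). Every entry
contributes `1` to `k` and `2` to `m`, and every row contributes `1` to `m`. The result is the number
of rows (shifted by `3`), the final values of `k` and `m`, and the rest of the string. -/
def scanRows (i j k m : ℕ) : List Letter → Option (ℕ × ℕ × ℕ × List Letter)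
  | [] => if j = 3 then some (i, k, m, []) else none
  | .bit b :: l => if j = 3 then some (i, k, m, .bit b :: l) else none
  | .rowEnd :: l => if j = i then scanRows (i + 1) 3 k (m + 1) l else none
  | _ :: l => if j = i then none else scanRows i (j + 1) (k + 1) (m + 2) l

/-- Add the binary number `l` to `k`, where the least significant bit has weight `pow`. Fail if a bit
of weight greater than `i` is reached, or if the last bit is zero. -/
def scanBits (i pow k : ℕ) (last : Bool) : List Letter → Option ℕ
  | [] => if last then some k else none
  | .bit b :: l => if pow ≤ i then scanBits i (pow + pow) (k + if b then pow else 0) b l else none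
  | _ => none

/-- The registered votes other than the first one. -/
def registeredString (m : ℕ) (even : Bool) (i j : ℕ) : List Letter → List Voting.Letter
  | .rowEnd :: l => (if even then voteString m 1 2 else []) ++ registeredString m (!even) (i + 1) 3 l
  | .nonredEdge :: l => voteString m i j ++ registeredString m even i (j + 1) l
  | .redEdge :: l => voteString m 1 2 ++ registeredString m even i (j + 1) l
  | .noEdge :: l => voteString m 1 2 ++ registeredString m even i (j + 1) l
  | _ => []

/-- The unregistered votes. -/
def unregisteredString (m d i j : ℕ) : List Letter → List Voting.Letter
  | .rowEnd :: l => unregisteredString m d (i + 1) 3 l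
  | .redEdge :: l =>
    voteString m d (d + 1) ++ voteString m i j ++ unregisteredString m (d + 2) i (j + 1) l
  | .nonredEdge :: l => voteString m d (d + 1) ++ unregisteredString m (d + 2) i (j + 1) l
  | .noEdge :: l => voteString m d (d + 1) ++ unregisteredString m (d + 2) i (j + 1) l
  | _ => []

/-- The output for a valid input. -/
def outputString (x : List Letter) (i k m : ℕ) : List Voting.Letter :=
  (List.range m).flatMap Voting.encodeNat ++ [.semicolon] ++ Voting.encodeNat 0 ++
    Voting.encodeNat k ++ voteString m 0 1 ++ registeredString m true 3 3 x ++ [.bar] ++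
    unregisteredString m i 3 3 x

/-- The reduction. -/
def reduction (x : List Letter) : List Voting.Letter :=
  match scanRows 3 3 0 3 x with
  | none => []
  | some (i, k, m, l) =>
    match scanBits i 1 k true l with
    | none => []
    | some k => outputString x i k m

/-! ### The program -/

open Frag

abbrev Prog (E : Type) : Type 1 := RegFrag Letter Voting.Letter E

/-- Emit a register as a number. -/
def emitNat (t : Reg) : Prog Unit := emitBits t Voting.Letter.bit .comma

/-- Emit the vote with the candidates in the registers `a` and `b` on top. -/
def vote (a b : Reg) : Prog Unit :=
  (emitNat a).seq ((emitNat b).seq ((clear .c).seq ((whileNe .c .m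
    ((eq .c a).bind fun y => (eq .c b).bind fun z =>
      if y || z then inc .c else (emitNat .c).seq (inc .c))).seq (emit .semicolon))))

/-- Emit the list of all candidates. -/
def candidates : Prog Unit :=
  (clear .c).seq ((whileNe .c .m ((emitNat .c).seq (inc .c))).seq (emit .semicolon))

def rowsBody : Prog (Unit ⊕ Bool) :=
  look.bind fun
    | none => (eq .j .three).bind fun b => ret (.inr b)
    | some (.bit _) => (eq .j .three).bind fun b => ret (.inr b)
    | some .rowEnd => (eq .j .i).bind fun b =>
      if b then (inc .i).seq ((setThree .j).seq ((inc .m).seq (advance.seq (ret (.inl ())))))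
      else ret (.inr false)
    | some _ => (eq .j .i).bind fun b =>
      if b then ret (.inr false)
      else (inc .j).seq ((inc .k).seq ((inc .m).seq ((inc .m).seq (advance.seq (ret (.inl ()))))))

def rows : Prog Bool := iter (fun _ => rowsBody) ()

def addPowBody (b : Bool) : Prog (Unit ⊕ Bool) :=
  (eq .tmp .pow).bind fun y => if y then ret (.inr true) else (eq .tmp .i).bind fun z =>
    if z then ret (.inr false) else
    (inc .tmp).seq (if b then (inc .k).seq (ret (.inl ())) else ret (.inl ()))

/-- If `pow ≤ i`, exit with `true`, having added `pow` to `k` if `b` is set. -/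
def addPow (b : Bool) : Prog Bool := (clear .tmp).seq (iter (fun _ => addPowBody b) ())

/-- Double `pow`, if `tmp` is a copy of it. -/
def doublePow : Prog Unit :=
  (clear .cnt).seq (whileNe .cnt .tmp ((inc .cnt).seq (inc .pow)))

def bitsBody (last : Bool) : Prog (Bool ⊕ Bool) :=
  look.bind fun
    | none => ret (.inr last)
    | some (.bit b) => (addPow b).bind fun y =>
      if y then doublePow.seq (advance.seq (ret (.inl b))) else ret (.inr false)
    | some _ => ret (.inr false)

def bits : Prog Bool := iter bitsBody true

def registeredVotesBody (even : Bool) : Prog (Bool ⊕ Unit) :=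
  look.bind fun
    | none => ret (.inr ())
    | some (.bit _) => ret (.inr ())
    | some .rowEnd => (if even then vote .one .two else ret ()).seq
      ((inc .i).seq ((setThree .j).seq (advance.seq (ret (.inl (!even))))))
    | some .nonredEdge => (vote .i .j).seq ((inc .j).seq (advance.seq (ret (.inl even))))
    | some _ => (vote .one .two).seq ((inc .j).seq (advance.seq (ret (.inl even))))

def registeredVotes : Prog Unit := iter registeredVotesBody true

/-- Move on to the next pair of vertices and the next pair of padding candidates. -/
def nextPad : Prog (Unit ⊕ Unit) :=
  (inc .d).seq ((inc .d).seq ((inc .e).seq ((inc .e).seq ((inc .j).seq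
    (advance.seq (ret (.inl ())))))))

def unregisteredVotesBody : Prog (Unit ⊕ Unit) :=
  look.bind fun
    | none => ret (.inr ())
    | some (.bit _) => ret (.inr ())
    | some .rowEnd => (inc .i).seq ((setThree .j).seq (advance.seq (ret (.inl ()))))
    | some .redEdge => (vote .d .e).seq ((vote .i .j).seq nextPad)
    | some _ => (vote .d .e).seq nextPad

def unregisteredVotes : Prog Unit := iter (fun _ => unregisteredVotesBody) ()

def startPass : Prog Unit := rewind.seq ((setThree .i).seq (setThree .j))

def output : Prog Unit :=
  (copy .d .i).seq ((copy .e .i).seq ((inc .e).seq (candidates.seq ((emitNat .zero).seq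
  ((emitNat .k).seq ((vote .zero .one).seq (startPass.seq (registeredVotes.seq ((emit .bar).seq
  (startPass.seq unregisteredVotes))))))))))

def init : Prog Unit :=
  (inc .one).seq ((inc .two).seq ((inc .two).seq ((inc .pow).seq ((setThree .three).seq
  ((setThree .m).seq startPass)))))

def program : Prog Unit :=
  init.seq (rows.bind fun y => if y then bits.bind fun z => if z then output else ret () else ret ())

/-! ### Correctness of the printing subroutines -/

variable {x : List Letter} {s i : ℕ} {r : Regs} {o : List Voting.Letter}

theorem does_emitNat {t : Reg} :
    (emitNat t).Does x s i r o () i r (o ++ Voting.encodeNat (r.get t)) := does_emitBits _ _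

theorem does_vote {a b : Reg} (ha : a ≠ .c) (hb : b ≠ .c) (hm : r.m < 2 ^ s) :
    (vote a b).Does x s i r o () i { r with c := r.m }
      (o ++ voteString r.m (r.get a) (r.get b)) := by
  have hget : ∀ v t, t ≠ .c → ({ r with c := v } : Regs).get t = r.get t := fun v t ht =>
    Regs.get_set_of_ne r v ht
  -- Invariant: the two top candidates and then all other candidates below `v` have been printed.
  have hloop := does_whileNe (α := Letter) (x := x) (s := s) (i := i) (t := .c) (u := .m) (by decide)
    (F := (eq .c a).bind fun y => (eq .c b).bind fun z =>
      if y || z then inc .c else (emitNat .c).seq (inc .c))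
    (fun v => { r with c := v })
    (fun v => o ++ Voting.encodeNat (r.get a) ++ Voting.encodeNat (r.get b) ++
      ((List.range v).filter fun c => c ≠ r.get a ∧ c ≠ r.get b).flatMap Voting.encodeNat) r.m rfl
    (fun v hv => ⟨hv.ne, ?_⟩) rfl rfl rfl rfl
  · refine does_emitNat.seq (does_emitNat.seq (does_clear.seq ?_))
    have := hloop.seq (does_emit (b := Voting.Letter.semicolon))
    simpa [voteString, Regs.set] using this
  · refine (does_eq ha.symm).bind ((does_eq hb.symm).bind ?_)
    rw [hget v a ha, hget v b hb]
    change Does (if decide (v = r.get a) || decide (v = r.get b) then _ else _) _ _ _ _ _ _ _ _ _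
    have hinc := fun o : List Voting.Letter => does_inc (α := Letter) (x := x) (s := s) (i := i)
      (r := { r with c := v }) (o := o) (t := .c) (show v + 1 < 2 ^ s by omega)
    rw [List.range_succ, List.filter_append, List.flatMap_append]
    by_cases h : v = r.get a ∨ v = r.get b
    · rw [if_pos (by simpa using h)]
      have : ([v].filter fun c => decide (c ≠ r.get a ∧ c ≠ r.get b)) = [] := by
        simp; tauto
      rw [this, List.flatMap_nil, List.append_nil]
      exact hinc _
    · rw [if_neg (by simpa using h)]
      have : ([v].filter fun c => decide (c ≠ r.get a ∧ c ≠ r.get b)) = [v] := by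
        simp; tauto
      rw [this, List.flatMap_singleton, ← List.append_assoc]
      exact does_emitNat.seq (hinc _)

theorem does_candidates (hm : r.m < 2 ^ s) :
    candidates.Does x s i r o () i { r with c := r.m }
      (o ++ ((List.range r.m).flatMap Voting.encodeNat ++ [.semicolon])) := by
  have hloop := does_whileNe (α := Letter) (x := x) (s := s) (i := i) (t := .c) (u := .m) (by decide)
    (F := (emitNat .c).seq (inc .c)) (fun v => { r with c := v })
    (fun v => o ++ (List.range v).flatMap Voting.encodeNat) r.m rfl
    (fun v hv => ⟨hv.ne, ?_⟩) rfl rfl rfl rfl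
  · have := (does_clear (t := .c) (r := r)).seq
      (hloop.seq (does_emit (b := Voting.Letter.semicolon)))
    simpa [candidates] using this
  · rw [List.range_succ, List.flatMap_append, List.flatMap_singleton, ← List.append_assoc]
    exact does_emitNat.seq (does_inc (t := .c) (r := { r with c := v })
      (show v + 1 < 2 ^ s by omega))

theorem does_startPass (hs : 3 ≤ s) :
    startPass.Does x s i r o () 1 { r with i := 3, j := 3 } o :=
  does_rewind.seq ((does_setThree (t := .i) hs).seq (does_setThree (t := .j) hs))

/-- The letter is an entry of the adjacency matrix. -/
def IsEntry (a : Letter) : Prop := a = .noEdge ∨ a = .nonredEdge ∨ a = .redEdge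

/-- The string does not start with a letter of the adjacency matrix. -/
def AtEnd (l : List Letter) : Prop := l[0]? = none ∨ ∃ b, l[0]? = some (.bit b)

theorem atEnd_nil : AtEnd [] := .inl rfl

theorem atEnd_bit (b : Bool) (l : List Letter) : AtEnd (.bit b :: l) := .inr ⟨b, rfl⟩

theorem scanRows_of_atEnd {i j k m : ℕ} {l : List Letter} (hl : AtEnd l) :
    scanRows i j k m l = if j = 3 then some (i, k, m, l) else none := by
  match l, hl with
  | [], _ => rw [scanRows]
  | .bit b :: l, _ => rw [scanRows]
  | .noEdge :: l, h => simp [AtEnd] at h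
  | .nonredEdge :: l, h => simp [AtEnd] at h
  | .redEdge :: l, h => simp [AtEnd] at h
  | .rowEnd :: l, h => simp [AtEnd] at h

theorem scanRows_entry {i j k m : ℕ} {a : Letter} {l : List Letter} (ha : IsEntry a) :
    scanRows i j k m (a :: l) = if j = i then none else scanRows i (j + 1) (k + 1) (m + 2) l := by
  rcases ha with rfl | rfl | rfl <;> rw [scanRows] <;> simp

/-- Induction along the adjacency matrix. -/
theorem letter_induction {P : List Letter → Prop} (hend : ∀ l, AtEnd l → P l)
    (hrow : ∀ l, P l → P (.rowEnd :: l)) (hentry : ∀ a l, IsEntry a → P l → P (a :: l))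
    (l : List Letter) : P l := by
  induction l with
  | nil => exact hend _ atEnd_nil
  | cons a l ih =>
    cases a with
    | noEdge => exact hentry _ _ (.inl rfl) ih
    | nonredEdge => exact hentry _ _ (.inr (.inl rfl)) ih
    | redEdge => exact hentry _ _ (.inr (.inr rfl)) ih
    | rowEnd => exact hrow _ ih
    | bit b => exact hend _ (atEnd_bit b l)

/-! ### Correctness of the parser: the matrix and the number `k` -/

variable {pre l : List Letter} {a : Letter}

theorem succ_length_le (hx : x = pre ++ a :: l) (hi : i = pre.length + 1) : i ≤ x.length := by
  simp [hx, hi]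

theorem does_rowsBody_of_atEnd (hx : x = pre ++ l) (hi : i = pre.length + 1) (h3 : r.three = 3)
    (hl : AtEnd l) : rowsBody.Does x s i r o (.inr (decide (r.j = 3))) i r o := by
  refine (does_look hx hi).bind ?_
  have : ((eq .j .three).bind fun b => ret (.inr b) : Prog (Unit ⊕ Bool)).Does x s i r o
      (.inr (decide (r.j = r.three))) i r o := (does_eq (by decide)).bind does_ret
  rw [h3] at this
  rcases hl with h | ⟨b, h⟩ <;> rw [h] <;> exact this

theorem does_rowsBody_fail (hx : x = pre ++ a :: l) (hi : i = pre.length + 1)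
    (h : (a = .rowEnd ∧ r.j ≠ r.i) ∨ (IsEntry a ∧ r.j = r.i)) :
    rowsBody.Does x s i r o (.inr false) i r o := by
  refine (does_look hx hi).bind ?_
  rcases h with ⟨rfl, h⟩ | ⟨rfl | rfl | rfl, h⟩
  · refine (does_eq (by decide)).bind ?_
    change Does (if decide (r.j = r.i) then _ else _) _ _ _ _ _ _ _ _ _
    rw [decide_eq_false h, if_neg (by decide)]
    exact does_ret
  all_goals
    refine (does_eq (by decide)).bind ?_
    change Does (if decide (r.j = r.i) then _ else _) _ _ _ _ _ _ _ _ _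
    rw [decide_eq_true h, if_pos rfl]
    exact does_ret

theorem does_rowsBody_rowEnd (hs : 3 ≤ s) (hx : x = pre ++ .rowEnd :: l) (hi : i = pre.length + 1)
    (h : r.j = r.i) (hbi : r.i + 1 < 2 ^ s) (hbm : r.m + 1 < 2 ^ s) :
    rowsBody.Does x s i r o (.inl ()) (i + 1) { r with i := r.i + 1, j := 3, m := r.m + 1 } o := by
  refine (does_look hx hi).bind ((does_eq (by decide)).bind ?_)
  change Does (if decide (r.j = r.i) then _ else _) _ _ _ _ _ _ _ _ _
  rw [decide_eq_true h, if_pos rfl]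
  exact (does_inc (t := .i) (by exact hbi)).seq ((does_setThree (t := .j) hs).seq
    ((does_inc (t := .m) (by exact hbm)).seq ((does_advance (succ_length_le hx hi)).seq does_ret)))

theorem does_rowsBody_entry (hx : x = pre ++ a :: l) (hi : i = pre.length + 1) (ha : IsEntry a)
    (h : r.j ≠ r.i) (hbj : r.j + 1 < 2 ^ s) (hbk : r.k + 1 < 2 ^ s) (hbm : r.m + 2 < 2 ^ s) :
    rowsBody.Does x s i r o (.inl ()) (i + 1)
      { r with j := r.j + 1, k := r.k + 1, m := r.m + 2 } o := by
  refine (does_look hx hi).bind ?_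
  have key : ((eq .j .i).bind fun b => if b then ret (.inr false) else
      (inc .j).seq ((inc .k).seq ((inc .m).seq ((inc .m).seq (advance.seq (ret (.inl ())))))) :
      Prog (Unit ⊕ Bool)).Does x s i r o (.inl ()) (i + 1)
      { r with j := r.j + 1, k := r.k + 1, m := r.m + 2 } o := by
    refine (does_eq (by decide)).bind ?_
    change Does (if decide (r.j = r.i) then _ else _) _ _ _ _ _ _ _ _ _
    rw [decide_eq_false h, if_neg (by decide)]
    exact (does_inc (t := .j) (by exact hbj)).seq ((does_inc (t := .k) (by exact hbk)).seq
      ((does_inc (t := .m) (by change r.m + 1 < _; omega)).seq ((does_inc (t := .m) (by exact hbm)).seq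
      ((does_advance (succ_length_le hx hi)).seq does_ret))))
  rcases ha with rfl | rfl | rfl <;> exact key

/-- A letter raises no counter by more than two, so the remaining length bounds `i`, `k` and `m`,
while `j ≤ i` bounds `j`. After a failure the memory is irrelevant and stays unspecified, apart from
the output. -/
theorem does_rows (hs : 3 ≤ s) (hx : x = pre ++ l) (hi : i = pre.length + 1)
    (h3 : r.three = 3) (hri : 3 ≤ r.i) (hji : r.j ≤ r.i) (hbi : r.i + l.length < 2 ^ s)
    (hbk : r.k + l.length < 2 ^ s) (hbm : r.m + 2 * l.length < 2 ^ s) :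
    match scanRows r.i r.j r.k r.m l with
    | none => ∃ i' r', rows.Does x s i r o false i' r' o
    | some (n, k, m, l') => ∃ pre', x = pre' ++ l' ∧ rows.Does x s i r o true (pre'.length + 1)
        { r with i := n, j := 3, k := k, m := m } o := by
  induction l using letter_induction generalizing pre i r with
  | hend l hl =>
    have h := Does.iter_exit (F := fun _ : Unit => rowsBody) (a := ())
      (does_rowsBody_of_atEnd (s := s) (o := o) hx hi h3 hl)
    rw [scanRows_of_atEnd hl]
    split_ifs with hj
    · refine ⟨pre, hx, ?_⟩
      rw [decide_eq_true hj] at h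
      rw [← hi, ← hj]
      exact h
    · rw [decide_eq_false hj] at h
      exact ⟨i, r, h⟩
  | hrow l ih =>
    simp only [List.length_cons] at hbi hbk hbm
    rw [scanRows]
    split_ifs with hj
    · have h := does_rowsBody_rowEnd (s := s) (o := o) hs hx hi hj (by omega) (by omega)
      have ih := ih (pre := pre ++ [.rowEnd]) (i := i + 1)
        (r := { r with i := r.i + 1, j := 3, m := r.m + 1 }) (by simp [hx]) (by simp [hi]) h3
        (by simp only; omega) (by simp only; omega) (by simp only; omega) (by simp only; omega)
        (by simp only; omega)
      simp only at ih
      split at ih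
      · obtain ⟨i', r', ih⟩ := ih
        exact ⟨i', r', h.iter_step ih⟩
      · obtain ⟨pre', hpre', ih⟩ := ih
        exact ⟨pre', hpre', h.iter_step ih⟩
    · exact ⟨i, r, (does_rowsBody_fail hx hi (.inl ⟨rfl, hj⟩)).iter_exit⟩
  | hentry a l ha ih =>
    simp only [List.length_cons] at hbi hbk hbm
    rw [scanRows_entry ha]
    split_ifs with hj
    · exact ⟨i, r, (does_rowsBody_fail hx hi (.inr ⟨ha, hj⟩)).iter_exit⟩
    · have h := does_rowsBody_entry (s := s) (o := o) hx hi ha hj (by omega) (by omega) (by omega)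
      have ih := ih (pre := pre ++ [a]) (i := i + 1)
        (r := { r with j := r.j + 1, k := r.k + 1, m := r.m + 2 }) (by simp [hx]) (by simp [hi]) h3
        hri (by simp only; omega) (by simp only; omega) (by simp only; omega) (by simp only; omega)
      simp only at ih
      split at ih
      · obtain ⟨i', r', ih⟩ := ih
        exact ⟨i', r', h.iter_step ih⟩
      · obtain ⟨pre', hpre', ih⟩ := ih
        exact ⟨pre', hpre', h.iter_step ih⟩

/-- `tmp` counts up, together with `k` if `b` is set, until it meets `pow` or `i`. Testing `pow`
first lets a tie count as `pow ≤ i`. The cutoff at `i` keeps `k` small even when the test fails. -/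
theorem does_addPow_loop (b : Bool) (hi : r.i < 2 ^ s) (hk : r.k + r.i < 2 ^ s) (n v : ℕ)
    (hn : v + n = min r.pow r.i) :
    (iter (fun _ => addPowBody b) () : Prog Bool).Does x s i
      { r with tmp := v, k := r.k + if b then v else 0 } o (decide (r.pow ≤ r.i)) i
      { r with tmp := min r.pow r.i, k := r.k + if b then min r.pow r.i else 0 } o := by
  induction n generalizing v with
  | zero =>
    obtain rfl : v = min r.pow r.i := by omega
    refine Does.iter_exit ((does_eq (by decide)).bind ?_)
    change Does (if decide (min r.pow r.i = r.pow) then _ else _) _ _ _ _ _ _ _ _ _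
    by_cases h : r.pow ≤ r.i
    · rw [decide_eq_true (by omega), if_pos rfl, decide_eq_true h]
      exact does_ret
    · rw [decide_eq_false (by omega), if_neg (by decide), decide_eq_false h]
      refine (does_eq (by decide)).bind ?_
      change Does (if decide (min r.pow r.i = r.i) then _ else _) _ _ _ _ _ _ _ _ _
      rw [decide_eq_true (by omega), if_pos rfl]
      exact does_ret
  | succ n ih =>
    refine Does.iter_step (b := ()) ((does_eq (by decide)).bind ?_) (ih (v + 1) (by omega))
    change Does (if decide (v = r.pow) then _ else _) _ _ _ _ _ _ _ _ _
    rw [decide_eq_false (by omega), if_neg (by decide)]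
    refine (does_eq (by decide)).bind ?_
    change Does (if decide (v = r.i) then _ else _) _ _ _ _ _ _ _ _ _
    rw [decide_eq_false (by omega), if_neg (by decide)]
    refine (does_inc (t := .tmp) (by change v + 1 < _; omega)).seq ?_
    cases b with
    | false => exact does_ret
    | true => exact (does_inc (t := .k) (by change r.k + v + 1 < _; omega)).seq does_ret

theorem does_addPow (b : Bool) (hi : r.i < 2 ^ s) (hk : r.k + r.i < 2 ^ s) :
    (addPow b).Does x s i r o (decide (r.pow ≤ r.i)) i
      { r with tmp := min r.pow r.i, k := r.k + if b then min r.pow r.i else 0 } o := by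
  have := does_addPow_loop (x := x) (i := i) (o := o) b hi hk (min r.pow r.i) 0 (by omega)
  rw [ite_self] at this
  exact (does_clear (t := .tmp)).seq this

/-- The loop is bounded by `tmp`, since `pow` itself changes in it. -/
theorem does_doublePow (h : r.pow + r.tmp < 2 ^ s) :
    doublePow.Does x s i r o () i { r with cnt := r.tmp, pow := r.pow + r.tmp } o := by
  refine (does_clear (t := .cnt)).seq (does_whileNe (by decide)
    (fun v => { r with cnt := v, pow := r.pow + v }) (fun _ => o) r.tmp rfl
    (fun v hv => ⟨hv.ne, ?_⟩) rfl rfl rfl rfl)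
  exact (does_inc (t := .cnt) (by change v + 1 < _; omega)).seq
    (does_inc (t := .pow) (by change r.pow + v + 1 < _; omega))

theorem does_bitsBody_bit {last b : Bool} (hx : x = pre ++ .bit b :: l) (hi : i = pre.length + 1)
    (hpow : r.pow ≤ r.i) (hp : r.pow + r.pow < 2 ^ s) (hbi : r.i < 2 ^ s)
    (hk : r.k + r.i < 2 ^ s) :
    (bitsBody last).Does x s i r o (.inl b) (i + 1)
      { r with tmp := r.pow, cnt := r.pow, pow := r.pow + r.pow,
               k := r.k + if b then r.pow else 0 } o := by
  refine (does_look hx hi).bind ((does_addPow b hbi hk).bind ?_)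
  rw [decide_eq_true hpow, if_pos rfl, min_eq_left hpow]
  exact (does_doublePow hp).seq ((does_advance (succ_length_le hx hi)).seq does_ret)

/-- `K` stands for the value of `k` before the first bit. The bits read so far add less than `pow`,
the weight of the next bit, which gives `hk`. Since `pow` is doubled only if `pow ≤ i`, it never
exceeds `2 * i`, and all registers stay below `K + 4 * i`, up to those untouched. -/
theorem does_bits (hx : x = pre ++ l) (hi : i = pre.length + 1) {last : Bool} (K : ℕ)
    (hk : r.k < K + r.pow) (hpow : r.pow ≤ 2 * r.i) (hK : K + 4 * r.i < 2 ^ s) :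
    match scanBits r.i r.pow r.k last l with
    | none => ∃ i' r', (iter bitsBody last : Prog Bool).Does x s i r o false i' r' o
    | some k => ∃ i' p t c, (iter bitsBody last : Prog Bool).Does x s i r o true i'
        { r with k := k, pow := p, tmp := t, cnt := c } o := by
  induction l generalizing pre i r last with
  | nil =>
    have h : (iter bitsBody last : Prog Bool).Does x s i r o last i r o := by
      refine Does.iter_exit ((does_look hx hi).bind ?_)
      exact does_ret
    rw [scanBits]
    cases last with
    | false => exact ⟨i, r, h⟩
    | true => exact ⟨i, r.pow, r.tmp, r.cnt, h⟩
  | cons a l ih =>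
    have hother : (∀ b, a ≠ .bit b) → scanBits r.i r.pow r.k last (a :: l) = none ∧
        ∃ i' r', (iter bitsBody last : Prog Bool).Does x s i r o false i' r' o := by
      intro h
      refine ⟨by cases a <;> simp_all [scanBits], i, r, Does.iter_exit ((does_look hx hi).bind ?_)⟩
      cases a <;> first | exact does_ret | exact absurd rfl (h _)
    by_cases ha : ∃ b, a = .bit b
    · obtain ⟨b, rfl⟩ := ha
      rw [scanBits]
      by_cases hp : r.pow ≤ r.i
      · rw [if_pos hp]
        have h := does_bitsBody_bit (s := s) (o := o) (last := last) hx hi hp (by omega) (by omega)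
          (by omega)
        have ih := ih (pre := pre ++ [.bit b]) (i := i + 1) (last := b)
          (r := { r with tmp := r.pow, cnt := r.pow, pow := r.pow + r.pow,
                         k := r.k + if b then r.pow else 0 }) (by simp [hx]) (by simp [hi])
          (by simp only; split_ifs <;> omega) (by simp only; omega) hK
        simp only at ih
        split at ih
        · obtain ⟨i', r', ih⟩ := ih
          exact ⟨i', r', h.iter_step ih⟩
        · obtain ⟨i', p, t, c, ih⟩ := ih
          exact ⟨i', p, t, c, h.iter_step ih⟩
      · rw [if_neg hp]
        refine ⟨i, { r with tmp := min r.pow r.i, k := r.k + if b then min r.pow r.i else 0 },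
          Does.iter_exit ((does_look hx hi).bind
          ((does_addPow b (by omega) (by omega)).bind ?_))⟩
        rw [decide_eq_false hp, if_neg (by decide)]
        exact does_ret
    · obtain ⟨h1, h2⟩ := hother fun b h => ha ⟨b, h⟩
      rw [h1]
      exact h2

end Reduction

/-! ### Correctness of the two passes that print the votes -/

namespace Reduction

open ExactMatching Logspace Frag

variable {x : List Letter} {s i : ℕ} {r : Regs} {o : List Voting.Letter} {pre l : List Letter}
  {a : Letter}

theorem registeredString_of_atEnd {m i j : ℕ} {even : Bool} (hl : AtEnd l) :
    registeredString m even i j l = [] := by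
  match l, hl with
  | [], _ => rw [registeredString] <;> simp
  | .bit b :: l, _ => rw [registeredString] <;> simp
  | .noEdge :: l, h => simp [AtEnd] at h
  | .nonredEdge :: l, h => simp [AtEnd] at h
  | .redEdge :: l, h => simp [AtEnd] at h
  | .rowEnd :: l, h => simp [AtEnd] at h

theorem unregisteredString_of_atEnd {m d i j : ℕ} (hl : AtEnd l) :
    unregisteredString m d i j l = [] := by
  match l, hl with
  | [], _ => rw [unregisteredString] <;> simp
  | .bit b :: l, _ => rw [unregisteredString] <;> simp
  | .noEdge :: l, h => simp [AtEnd] at h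
  | .nonredEdge :: l, h => simp [AtEnd] at h
  | .redEdge :: l, h => simp [AtEnd] at h
  | .rowEnd :: l, h => simp [AtEnd] at h

theorem does_registeredVotesBody_of_atEnd {even : Bool} (hx : x = pre ++ l)
    (hi : i = pre.length + 1) (hl : AtEnd l) :
    (registeredVotesBody even).Does x s i r o (.inr ()) i r o := by
  refine (does_look hx hi).bind ?_
  rcases hl with h | ⟨b, h⟩ <;> rw [h] <;> exact does_ret

theorem does_registeredVotesBody_rowEnd {even : Bool} (hs : 3 ≤ s)
    (hx : x = pre ++ .rowEnd :: l) (hi : i = pre.length + 1) (h1 : r.one = 1) (h2 : r.two = 2)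
    (hbi : r.i + 1 < 2 ^ s) (hm : r.m < 2 ^ s) :
    ∃ c, (registeredVotesBody even).Does x s i r o (.inl !even) (i + 1)
      { r with i := r.i + 1, j := 3, c := c }
      (o ++ if even then voteString r.m 1 2 else []) := by
  have key := fun (r : Regs) (hbi : r.i + 1 < 2 ^ s) (o : List Voting.Letter) =>
    (does_inc (t := .i) (i := i) (x := x) (o := o) hbi).seq ((does_setThree (t := .j) hs).seq
      ((does_advance (succ_length_le hx hi)).seq (does_ret (e := Sum.inl (β := Unit) !even))))
  cases even with
  | true =>
    refine ⟨r.m, (does_look hx hi).bind (.seq ?_ (key { r with c := r.m } hbi _))⟩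
    have := does_vote (x := x) (i := i) (o := o) (a := .one) (b := .two) (by decide) (by decide) hm
    rwa [show r.get .one = 1 from h1, show r.get .two = 2 from h2] at this
  | false =>
    refine ⟨r.c, (does_look hx hi).bind (.seq ?_ (key r hbi _))⟩
    rw [if_neg (by simp), if_neg (by simp), List.append_nil]
    exact does_ret

theorem does_registeredVotesBody_entry {even : Bool} (hx : x = pre ++ a :: l)
    (hi : i = pre.length + 1) (ha : IsEntry a) (h1 : r.one = 1) (h2 : r.two = 2)
    (hbj : r.j + 1 < 2 ^ s) (hm : r.m < 2 ^ s) :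
    (registeredVotesBody even).Does x s i r o (.inl even) (i + 1)
      { r with j := r.j + 1, c := r.m }
      (o ++ if a = .nonredEdge then voteString r.m r.i r.j else voteString r.m 1 2) := by
  have key := fun (o : List Voting.Letter) =>
    (does_inc (t := .j) (i := i) (x := x) (r := { r with c := r.m }) (o := o) hbj).seq
      ((does_advance (succ_length_le hx hi)).seq (does_ret (e := Sum.inl (β := Unit) even)))
  have hbad := does_vote (x := x) (i := i) (o := o) (a := .one) (b := .two) (by decide) (by decide) hm
  rw [show r.get .one = 1 from h1, show r.get .two = 2 from h2] at hbad
  have hgood := does_vote (x := x) (i := i) (o := o) (a := .i) (b := .j) (by decide) (by decide) hm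
  refine (does_look hx hi).bind ?_
  rcases ha with rfl | rfl | rfl
  · rw [if_neg (show Letter.noEdge ≠ .nonredEdge by simp)]
    exact hbad.seq (key _)
  · rw [if_pos rfl]
    exact hgood.seq (key _)
  · rw [if_neg (show Letter.redEdge ≠ .nonredEdge by simp)]
    exact hbad.seq (key _)

theorem registeredString_entry {m i j : ℕ} {even : Bool} (ha : IsEntry a) :
    registeredString m even i j (a :: l) =
      (if a = .nonredEdge then voteString m i j else voteString m 1 2) ++
        registeredString m even i (j + 1) l := by
  rcases ha with rfl | rfl | rfl <;> rw [registeredString] <;> simp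

/-- The final values of `i`, `j` and `c` may stay unspecified, because `startPass` and `vote` set
them afresh. -/
theorem does_registeredVotes (hs : 3 ≤ s) {even : Bool} (hx : x = pre ++ l)
    (hi : i = pre.length + 1) (h1 : r.one = 1) (h2 : r.two = 2) (h3 : 3 + l.length < 2 ^ s)
    (hbi : r.i + l.length < 2 ^ s) (hbj : r.j + l.length < 2 ^ s) (hm : r.m < 2 ^ s) :
    ∃ i' n j c, (iter registeredVotesBody even : Prog Unit).Does x s i r o () i'
      { r with i := n, j := j, c := c } (o ++ registeredString r.m even r.i r.j l) := by
  induction l using letter_induction generalizing pre i r even o with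
  | hend l hl =>
    rw [registeredString_of_atEnd hl, List.append_nil]
    exact ⟨i, r.i, r.j, r.c, (does_registeredVotesBody_of_atEnd hx hi hl).iter_exit⟩
  | hrow l ih =>
    simp only [List.length_cons] at hbi hbj h3
    obtain ⟨c, h⟩ := does_registeredVotesBody_rowEnd (s := s) (o := o) (even := even) hs hx hi h1 h2
      (by omega) hm
    obtain ⟨i', n, j, c, ih⟩ := ih (pre := pre ++ [.rowEnd]) (i := i + 1) (even := !even)
      (r := { r with i := r.i + 1, j := 3, c := c })
      (o := o ++ if even then voteString r.m 1 2 else []) (by simp [hx]) (by simp [hi]) h1 h2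
      (by omega) (by simp only; omega) (by simp only; omega) hm
    rw [registeredString, ← List.append_assoc]
    exact ⟨i', n, j, c, h.iter_step ih⟩
  | hentry a l ha ih =>
    simp only [List.length_cons] at hbi hbj h3
    have h := does_registeredVotesBody_entry (s := s) (o := o) (even := even) hx hi ha h1 h2
      (by omega) hm
    obtain ⟨i', n, j, c, ih⟩ := ih (pre := pre ++ [a]) (i := i + 1) (even := even)
      (r := { r with j := r.j + 1, c := r.m })
      (o := o ++ if a = .nonredEdge then voteString r.m r.i r.j else voteString r.m 1 2)
      (by simp [hx]) (by simp [hi]) h1 h2 (by omega) (by simp only; omega) (by simp only; omega) hm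
    rw [registeredString_entry ha, ← List.append_assoc]
    exact ⟨i', n, j, c, h.iter_step ih⟩

theorem does_unregisteredVotesBody_of_atEnd (hx : x = pre ++ l)
    (hi : i = pre.length + 1) (hl : AtEnd l) :
    unregisteredVotesBody.Does x s i r o (.inr ()) i r o := by
  refine (does_look hx hi).bind ?_
  rcases hl with h | ⟨b, h⟩ <;> rw [h] <;> exact does_ret

theorem does_unregisteredVotesBody_rowEnd (hs : 3 ≤ s)
    (hx : x = pre ++ .rowEnd :: l) (hi : i = pre.length + 1) (hbi : r.i + 1 < 2 ^ s) :
    unregisteredVotesBody.Does x s i r o (.inl ()) (i + 1) { r with i := r.i + 1, j := 3 } o :=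
  (does_look hx hi).bind ((does_inc (t := .i) (by exact hbi)).seq ((does_setThree (t := .j) hs).seq
      ((does_advance (succ_length_le hx hi)).seq does_ret)))

theorem does_nextPad (hi : i ≤ x.length) (hd : r.d + 2 < 2 ^ s) (he : r.e + 2 < 2 ^ s)
    (hj : r.j + 1 < 2 ^ s) :
    nextPad.Does x s i r o (.inl ()) (i + 1)
      { r with d := r.d + 2, e := r.e + 2, j := r.j + 1 } o :=
  (does_inc (t := .d) (by change r.d + 1 < _; omega)).seq ((does_inc (t := .d) (by exact hd)).seq
    ((does_inc (t := .e) (by change r.e + 1 < _; omega)).seq ((does_inc (t := .e) (by exact he)).seq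
    ((does_inc (t := .j) (by exact hj)).seq ((does_advance hi).seq does_ret)))))

theorem does_unregisteredVotesBody_entry (hx : x = pre ++ a :: l)
    (hi : i = pre.length + 1) (ha : IsEntry a) (hd : r.d + 2 < 2 ^ s) (he : r.e + 2 < 2 ^ s)
    (hbj : r.j + 1 < 2 ^ s) (hm : r.m < 2 ^ s) :
    unregisteredVotesBody.Does x s i r o (.inl ()) (i + 1)
      { r with d := r.d + 2, e := r.e + 2, j := r.j + 1, c := r.m }
      (o ++ voteString r.m r.d r.e ++ if a = .redEdge then voteString r.m r.i r.j else []) := by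
  have key := fun (o : List Voting.Letter) => does_nextPad (i := i) (x := x)
    (r := { r with c := r.m }) (o := o) (succ_length_le hx hi) hd he hbj
  have hpad := does_vote (x := x) (i := i) (o := o) (a := .d) (b := .e) (by decide) (by decide) hm
  have hred := fun (o : List Voting.Letter) => does_vote (x := x) (i := i) (o := o)
    (r := { r with c := r.m }) (a := .i) (b := .j) (by decide) (by decide) hm
  refine (does_look hx hi).bind ?_
  rcases ha with rfl | rfl | rfl
  · rw [if_neg (by simp), List.append_nil]
    exact hpad.seq (key _)
  · rw [if_neg (by simp), List.append_nil]
    exact hpad.seq (key _)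
  · rw [if_pos rfl]
    exact hpad.seq ((hred _).seq (key _))

theorem unregisteredString_entry {m d i j : ℕ} (ha : IsEntry a) :
    unregisteredString m d i j (a :: l) =
      voteString m d (d + 1) ++ (if a = .redEdge then voteString m i j else []) ++
        unregisteredString m (d + 2) i (j + 1) l := by
  rcases ha with rfl | rfl | rfl <;> rw [unregisteredString] <;> simp

/-- The invariant `e = d + 1` makes `vote .d .e` print a padding pair. Both registers grow by two
per entry, whence the bound `hd`. -/
theorem does_unregisteredVotes (hs : 3 ≤ s) (hx : x = pre ++ l)
    (hi : i = pre.length + 1) (he : r.e = r.d + 1) (h3 : 3 + l.length < 2 ^ s)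
    (hd : r.d + 1 + 2 * l.length < 2 ^ s)
    (hbi : r.i + l.length < 2 ^ s) (hbj : r.j + l.length < 2 ^ s) (hm : r.m < 2 ^ s) :
    ∃ i' r', unregisteredVotes.Does x s i r o () i' r'
      (o ++ unregisteredString r.m r.d r.i r.j l) := by
  induction l using letter_induction generalizing pre i r o with
  | hend l hl =>
    rw [unregisteredString_of_atEnd hl, List.append_nil]
    exact ⟨i, r, Does.iter_exit (does_unregisteredVotesBody_of_atEnd hx hi hl)⟩
  | hrow l ih =>
    simp only [List.length_cons] at hbi hbj h3 hd
    have h := does_unregisteredVotesBody_rowEnd (s := s) (r := r) (o := o) hs hx hi (by omega)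
    obtain ⟨i', r', ih⟩ := ih (pre := pre ++ [.rowEnd]) (i := i + 1)
      (r := { r with i := r.i + 1, j := 3 }) (o := o) (by simp [hx]) (by simp [hi]) he
      (by omega) (by simp only; omega) (by simp only; omega) (by simp only; omega) hm
    rw [unregisteredString]
    exact ⟨i', r', h.iter_step ih⟩
  | hentry a l ha ih =>
    simp only [List.length_cons] at hbi hbj h3 hd
    have h := does_unregisteredVotesBody_entry (s := s) (o := o) hx hi ha (by omega) (by omega)
      (by omega) hm
    rw [he] at h
    obtain ⟨i', r', ih⟩ := ih (pre := pre ++ [a]) (i := i + 1)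
      (r := { r with d := r.d + 2, e := r.d + 1 + 2, j := r.j + 1, c := r.m })
      (o := o ++ voteString r.m r.d (r.d + 1) ++ if a = .redEdge then voteString r.m r.i r.j else [])
      (by simp [hx]) (by simp [hi]) rfl (by omega) (by simp only; omega)
      (by simp only; omega) (by simp only; omega) hm
    rw [unregisteredString_entry ha, ← List.append_assoc, ← List.append_assoc]
    exact ⟨i', r', h.iter_step ih⟩

end Reduction

/-! ### Correctness of the whole program and its space bound -/

namespace Reduction

open ExactMatching Logspace Frag

variable {x : List Letter} {s i : ℕ} {r : Regs} {o : List Voting.Letter}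

/-- The part of the output before the passes over the input. -/
def headString (k m : ℕ) : List Voting.Letter :=
  (List.range m).flatMap Voting.encodeNat ++ [.semicolon] ++ Voting.encodeNat 0 ++
    Voting.encodeNat k ++ voteString m 0 1

/-- After the first pass `i` is the number of vertices plus `3`, that is, the first padding
candidate; so `d` and `e` start as the first padding pair. -/
theorem does_outputHead {F : Prog Unit} {i' : ℕ} {r' : Regs} {o' : List Voting.Letter}
    (h0 : r.zero = 0) (h1 : r.one = 1) (hm : r.m < 2 ^ s) (hi : r.i + 1 < 2 ^ s)
    (hF : F.Does x s i { r with d := r.i, e := r.i + 1, c := r.m } (o ++ headString r.k r.m) ()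
      i' r' o') :
    ((copy .d .i).seq ((copy .e .i).seq ((inc .e).seq (candidates.seq ((emitNat .zero).seq
      ((emitNat .k).seq ((vote .zero .one).seq F)))))) : Prog Unit).Does x s i r o () i' r' o' := by
  have s1 : (copy .d .i : Prog Unit).Does x s i r o () i { r with d := r.i } o :=
    does_copy (t := .d) (u := .i) (by decide) (show r.i < 2 ^ s by omega)
  have s2 : (copy .e .i : Prog Unit).Does x s i { r with d := r.i } o () i
      { r with d := r.i, e := r.i } o :=
    does_copy (t := .e) (u := .i) (by decide) (show r.i < 2 ^ s by omega)
  have s3 : (inc .e : Prog Unit).Does x s i { r with d := r.i, e := r.i } o () i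
      { r with d := r.i, e := r.i + 1 } o := does_inc (t := .e) (show r.i + 1 < 2 ^ s by omega)
  have s4 := does_candidates (x := x) (s := s) (i := i) (o := o)
    (r := { r with d := r.i, e := r.i + 1 }) hm
  have s5 := fun o => does_emitNat (x := x) (s := s) (i := i) (o := o) (t := .zero)
    (r := { r with d := r.i, e := r.i + 1, c := r.m })
  have s6 := fun o => does_emitNat (x := x) (s := s) (i := i) (o := o) (t := .k)
    (r := { r with d := r.i, e := r.i + 1, c := r.m })
  have s7 := fun o => does_vote (x := x) (s := s) (i := i) (a := .zero) (b := .one) (o := o)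
    (r := { r with d := r.i, e := r.i + 1, c := r.m }) (by decide) (by decide) hm
  refine s1.seq (s2.seq (s3.seq (s4.seq ((s5 _).seq ((s6 _).seq ((s7 _).seq ?_))))))
  convert hF using 1
  simp [headString, Regs.get, h0, h1]

theorem does_output (hs : 3 ≤ s) (h0 : r.zero = 0) (h1 : r.one = 1) (h2 : r.two = 2)
    (hm : r.m < 2 ^ s) (hi : r.i + 1 + 2 * x.length < 2 ^ s) (h3 : 3 + x.length < 2 ^ s) :
    ∃ i' r', output.Does x s i r o () i' r' (o ++ outputString x r.i r.k r.m) := by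
  obtain ⟨i1, n1, j1, c1, hX⟩ := does_registeredVotes (x := x) (s := s) (pre := []) (l := x) (i := 1)
    (even := true) (r := { r with d := r.i, e := r.i + 1, c := r.m, i := 3, j := 3 })
    (o := o ++ headString r.k r.m) hs rfl rfl h1 h2 h3 h3 h3 hm
  obtain ⟨i2, r2, hY⟩ := does_unregisteredVotes (x := x) (s := s) (pre := []) (l := x) (i := 1)
    (r := { r with d := r.i, e := r.i + 1, c := c1, i := 3, j := 3 })
    (o := o ++ headString r.k r.m ++ registeredString r.m true 3 3 x ++ [.bar]) hs rfl rfl rfl h3 hi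
    h3 h3 hm
  have hsp := does_startPass (x := x) (i := i1) (s := s)
    (o := o ++ headString r.k r.m ++ registeredString r.m true 3 3 x ++ [.bar])
    (r := { r with d := r.i, e := r.i + 1, c := c1, i := n1, j := j1 }) hs
  have hsp' := does_startPass (x := x) (i := i) (s := s) (o := o ++ headString r.k r.m)
    (r := { r with d := r.i, e := r.i + 1, c := r.m }) hs
  have ho : o ++ outputString x r.i r.k r.m = o ++ headString r.k r.m ++
      registeredString r.m true 3 3 x ++ [.bar] ++ unregisteredString r.m r.i 3 3 x := by
    simp [outputString, headString]
  rw [ho]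
  exact ⟨i2, r2, does_outputHead h0 h1 hm (by omega)
    (hsp'.seq (hX.seq (does_emit.seq (hsp.seq hY))))⟩

theorem scanRows_bounds {i j k m n k' m' : ℕ} {l l' : List Letter}
    (h : scanRows i j k m l = some (n, k', m', l')) :
    i ≤ n ∧ n ≤ i + l.length ∧ k' ≤ k + l.length ∧ m' ≤ m + 2 * l.length := by
  induction l using letter_induction generalizing i j k m with
  | hend l hl =>
    rw [scanRows_of_atEnd hl] at h
    split_ifs at h
    obtain ⟨rfl, rfl, rfl, rfl⟩ : i = n ∧ k = k' ∧ m = m' ∧ l = l' := by simpa using h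
    omega
  | hrow l ih =>
    rw [scanRows] at h
    split_ifs at h
    have := ih h
    simp only [List.length_cons]
    omega
  | hentry a l ha ih =>
    rw [scanRows_entry ha] at h
    split_ifs at h
    have := ih h
    simp only [List.length_cons]
    omega

/-- The registers before the first step. -/
def zeroRegs : Regs where
  i := 0
  j := 0
  k := 0
  m := 0
  c := 0
  d := 0
  e := 0
  pow := 0
  tmp := 0
  cnt := 0
  zero := 0
  one := 0
  two := 0
  three := 0

theorem does_init (hs : 3 ≤ s) :
    init.Does x s i zeroRegs o () 1
      { zeroRegs with i := 3, j := 3, m := 3, pow := 1, one := 1, two := 2, three := 3 } o := by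
  have hs' : 2 ^ 3 ≤ 2 ^ s := Nat.pow_le_pow_right (by omega) hs
  exact (does_inc (t := .one) (by change 0 + 1 < _; omega)).seq
    ((does_inc (t := .two) (by change 0 + 1 < _; omega)).seq
    ((does_inc (t := .two) (by change 0 + 1 + 1 < _; omega)).seq
    ((does_inc (t := .pow) (by change 0 + 1 < _; omega)).seq
    ((does_setThree (t := .three) hs).seq ((does_setThree (t := .m) hs).seq
    (does_startPass hs))))))

/-- By `scanRows_bounds` the first pass ends with `i ≤ |x| + 3`, `k ≤ |x|` and `m ≤ 2|x| + 3`. The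
largest demand is `k + 4 * i` from `does_bits`, and `32 * (|x| + 1)` exceeds it. -/
theorem does_program (hs : 3 ≤ s) (hx : 32 * (x.length + 1) ≤ 2 ^ s) :
    ∃ i' r', program.Does x s i zeroRegs [] () i' r' (reduction x) := by
  have hrows := does_rows (x := x) (s := s) (i := 1) (pre := []) (l := x) (o := [])
    (r := { zeroRegs with i := 3, j := 3, m := 3, pow := 1, one := 1, two := 2, three := 3 })
    hs rfl rfl rfl le_rfl le_rfl (by simp only; omega) (by simp only [zeroRegs]; omega)
    (by simp only; omega)
  rw [reduction]
  simp only [zeroRegs] at hrows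
  rcases hsr : scanRows 3 3 0 3 x with _ | ⟨n, k, m, l⟩
  · rw [hsr] at hrows
    obtain ⟨i', r', hrows⟩ := hrows
    exact ⟨i', r', (does_init hs).seq (hrows.bind does_ret)⟩
  · rw [hsr] at hrows
    obtain ⟨pre, hpre, hrows⟩ := hrows
    obtain ⟨hb1, hb2, hb3, hb4⟩ := scanRows_bounds hsr
    have hbits := does_bits (s := s) (o := []) (last := true) (r := { zeroRegs with
      i := n, j := 3, k := k, m := m, pow := 1, one := 1, two := 2, three := 3 }) hpre rfl k
      (Nat.lt_succ_self k) (by simp only; omega) (by simp only; omega)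
    simp only at hbits ⊢
    rcases hsb : scanBits n 1 k true l with _ | k'
    · rw [hsb] at hbits
      obtain ⟨i', r', hbits⟩ := hbits
      exact ⟨i', r', (does_init hs).seq (hrows.bind (Does.bind hbits does_ret))⟩
    · rw [hsb] at hbits
      obtain ⟨i', p, t, c, hbits⟩ := hbits
      obtain ⟨i2, r2, hout⟩ := does_output (x := x) (s := s) (i := i') (o := []) (r := { zeroRegs with
        i := n, j := 3, k := k', m := m, pow := p, one := 1, two := 2, three := 3, tmp := t, cnt := c })
        hs rfl rfl rfl (by simp only; omega) (by simp only; omega) (by omega)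
      exact ⟨i2, r2, (does_init hs).seq (hrows.bind (Does.bind hbits hout))⟩

theorem computable_reduction : Computable reduction := by
  -- Of the factor `6`, five parts pay for the constant `32` and one for `|x| + 1`.
  refine computable_of_runs program none reduction 6 fun x => ?_
  have hs : 3 ≤ 6 * (Nat.log 2 x.length + 1) := by omega
  have hx : 32 * (x.length + 1) ≤ 2 ^ (6 * (Nat.log 2 x.length + 1)) := by
    have h1 : x.length + 1 ≤ 2 ^ (Nat.log 2 x.length + 1) :=
      Nat.lt_pow_succ_log_self (by omega) _
    calc 32 * (x.length + 1) ≤ 2 ^ (5 * (Nat.log 2 x.length + 1)) * 2 ^ (Nat.log 2 x.length + 1) :=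
          Nat.mul_le_mul (Nat.pow_le_pow_right (n := 2) (i := 5) (by omega) (by omega)) h1
      _ = 2 ^ (6 * (Nat.log 2 x.length + 1)) := by rw [← pow_add]; congr 1; ring
  obtain ⟨i', r', h⟩ := does_program (i := 0) hs hx
  -- The number `0` has no binary digits, so blank tapes are registers with value `0`.
  have h0 : Mem.init Voting.Letter Reg none = mem 0 zeroRegs.bits (fun _ => 0) [] := by
    rw [Mem.init, mem, Mem.mk.injEq]
    refine ⟨rfl, ?_, rfl, rfl⟩
    funext t z
    have : zeroRegs.bits t = [] := by cases t <;> exact Nat.zero_bits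
    rw [this, tape_nil]
  rw [h0]
  exact ⟨(), _, (h hs fun t => by cases t <;> exact Nat.two_pow_pos _).1, rfl⟩

end Reduction

/-! ### Elections given by pairs of approved candidates -/

namespace Reduction

/-- The number of pairs of `F` in which `d` occurs. -/
def degree (d : ℕ) (F : Multiset (ℕ × ℕ)) : ℕ := F.countP fun e => e.1 = d ∨ e.2 = d

theorem degree_add (d : ℕ) (F F' : Multiset (ℕ × ℕ)) :
    degree d (F + F') = degree d F + degree d F' := Multiset.countP_add ..

theorem degree_cons (d : ℕ) (e : ℕ × ℕ) (F : Multiset (ℕ × ℕ)) :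
    degree d (e ::ₘ F) = degree d F + if e.1 = d ∨ e.2 = d then 1 else 0 :=
  Multiset.countP_cons ..

theorem degree_mono (d : ℕ) {F F' : Multiset (ℕ × ℕ)} (h : F ≤ F') : degree d F ≤ degree d F' :=
  Multiset.countP_le_of_le _ h

theorem degree_eq_zero {d : ℕ} {F : Multiset (ℕ × ℕ)} (h : ∀ e ∈ F, e.1 ≠ d ∧ e.2 ≠ d) :
    degree d F = 0 := by
  rw [degree, Multiset.countP_eq_zero]
  intro e he
  have := h e he
  tauto

theorem degree_pos {d : ℕ} {F : Multiset (ℕ × ℕ)} : 0 < degree d F ↔ ∃ e ∈ F, e.1 = d ∨ e.2 = d :=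
  Multiset.countP_pos

/-- The handshake lemma. -/
theorem sum_degree (s : Finset ℕ) (F : Multiset (ℕ × ℕ))
    (h : ∀ e ∈ F, e.1 ∈ s ∧ e.2 ∈ s ∧ e.1 ≠ e.2) : ∑ v ∈ s, degree v F = 2 * F.card := by
  induction F using Multiset.induction with
  | empty => simp [degree]
  | cons e F ih =>
    obtain ⟨h1, h2, h3⟩ := h e (Multiset.mem_cons_self _ _)
    simp only [degree_cons, Finset.sum_add_distrib, Multiset.card_cons]
    rw [ih fun e he => h e (Multiset.mem_cons_of_mem he)]
    have : ∀ v, (if e.1 = v ∨ e.2 = v then 1 else 0) =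
        (if e.1 = v then 1 else 0) + if e.2 = v then 1 else 0 := by
      intro v
      split_ifs <;> omega
    simp only [this, Finset.sum_add_distrib, Finset.sum_ite_eq, h1, h2, if_true]
    ring

/-- Which replacements of voters make `0` a winner. -/
theorem exists_replacement_iff {n N k L m : ℕ} {A C : Finset (ℕ × ℕ)} {D : Multiset (ℕ × ℕ)}
    (hA : ∀ e ∈ A, 3 ≤ e.2 ∧ e.2 < e.1 ∧ e.1 < n + 3)
    (hC : ∀ e ∈ C, 3 ≤ e.2 ∧ e.2 < e.1 ∧ e.1 < n + 3)
    (hD : ∀ e ∈ D, n + 3 ≤ e.1 ∧ n + 3 ≤ e.2 ∧ e.1 < m) (hD1 : ∀ d, degree d D ≤ 1)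
    (hDN : D.card = N) (hL : L + A.card = N + (n + 1) / 2) (hm : n + 3 ≤ m) :
    (∃ P Q, P ≤ (0, 1) ::ₘ (Multiset.replicate L (1, 2) + A.val) ∧ Q ≤ D + C.val ∧
      P.card = N + k ∧ Q.card = N + k ∧ ∀ d < m,
        degree d ((0, 1) ::ₘ (Multiset.replicate L (1, 2) + A.val) - P + Q) ≤
        degree 0 ((0, 1) ::ₘ (Multiset.replicate L (1, 2) + A.val) - P + Q)) ↔
    ∃ A' ⊆ A, ∃ C' ⊆ C, C'.card = k ∧
      ∀ v ∈ Finset.Ico 3 (n + 3), degree v (A'.val + C'.val) = 1 := by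
  set X := (0, 1) ::ₘ (Multiset.replicate L (1, 2) + A.val) with hX
  have hXcard : X.card = N + (n + 1) / 2 + 1 := by
    rw [← hL, hX]; simp
  have hX0 : degree 0 X = 1 := by
    rw [hX, degree_cons, degree_eq_zero]
    · simp
    · intro e he
      rcases Multiset.mem_add.mp he with he | he
      · rw [Multiset.eq_of_mem_replicate he]; simp
      · have := hA e he
        omega
  have hedge : ∀ A' C' : Finset (ℕ × ℕ), A' ⊆ A → C' ⊆ C → ∑ v ∈ Finset.Ico 3 (n + 3),
      degree v (A'.val + C'.val) = 2 * (A'.card + C'.card) := by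
    intro A' C' hA' hC'
    rw [sum_degree]
    · simp
    · intro e he
      have : 3 ≤ e.2 ∧ e.2 < e.1 ∧ e.1 < n + 3 := by
        rcases Multiset.mem_add.mp he with he | he
        exacts [hA e (hA' he), hC e (hC' he)]
      simp only [Finset.mem_Ico]
      omega
  constructor
  · rintro ⟨P, Q, hP, hQ, hPk, hQk, hwin⟩
    -- The kept voters `S = X - P` number `1 + ⌈n/2⌉ - k`.
    have hSX : X - P ≤ X := tsub_le_self
    have hScard : (X - P).card + (N + k) = N + (n + 1) / 2 + 1 := by
      rw [← hXcard, ← hPk, ← Multiset.card_add, tsub_add_cancel_of_le hP]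
    generalize X - P = S at *
    have hQ0 : degree 0 Q = 0 := by
      refine degree_eq_zero fun e he => ?_
      rcases Multiset.mem_add.mp (Multiset.mem_of_le hQ he) with he | he
      · have := hD e he
        omega
      · have := hC e he
        omega
    have hF0 : degree 0 (S + Q) ≤ 1 := by
      rw [degree_add, hQ0, ← hX0]
      exact degree_mono 0 hSX
    -- The final election has a voter, so some candidate has a positive score, and hence so has the
    -- winner `0`.
    have hS0 : 0 < degree 0 S := by
      have hcard : 0 < (S + Q).card := by
        rw [Multiset.card_add]; omega
      obtain ⟨e, he⟩ := Multiset.card_pos_iff_exists_mem.mp hcard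
      have hem : e.1 < m := by
        rcases Multiset.mem_add.mp he with he | he
        · rcases Multiset.mem_cons.mp (Multiset.mem_of_le hSX he) with rfl | he
          · simp only; omega
          · rcases Multiset.mem_add.mp he with he | he
            · rw [Multiset.eq_of_mem_replicate he]; simp only; omega
            · have := hA e he
              omega
        · rcases Multiset.mem_add.mp (Multiset.mem_of_le hQ he) with he | he
          · exact (hD e he).2.2
          · have := hC e he
            omega
      have h1 := hwin e.1 hem
      have h2 : 0 < degree e.1 (S + Q) := degree_pos.mpr ⟨e, he, .inl rfl⟩
      rw [degree_add 0, hQ0] at h1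
      omega
    have hmem : (0, 1) ∈ S := by
      obtain ⟨e, he, he0⟩ := degree_pos.mp hS0
      rcases Multiset.mem_cons.mp (Multiset.mem_of_le hSX he) with rfl | he'
      · exact he
      · rcases Multiset.mem_add.mp he' with he' | he'
        · rw [Multiset.eq_of_mem_replicate he'] at he0
          simp at he0
        · have := hA e he'
          omega
    obtain ⟨S, rfl⟩ := Multiset.exists_cons_of_mem hmem
    rw [hX, Multiset.cons_le_cons_iff] at hSX
    -- Candidate `1` already has a point from `(0, 1)`; another one would put it ahead of `0`.
    have h12 : (1, 2) ∉ S := by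
      intro h
      have h1 := hwin 1 (by omega)
      have h2 : 0 < degree 1 S := degree_pos.mpr ⟨_, h, .inl rfl⟩
      rw [degree_add 1, degree_cons] at h1
      simp only [or_true, if_true] at h1
      omega
    have hSA : S ≤ A.val := by
      have h1 : S.filter (· ≠ (1, 2)) = S := Multiset.filter_eq_self.mpr fun e he h => h12 (h ▸ he)
      have h2 : (Multiset.replicate L ((1 : ℕ), 2)).filter (· ≠ (1, 2)) = 0 :=
        Multiset.filter_eq_nil.mpr fun e he h => h (Multiset.eq_of_mem_replicate he)
      have h3 := Multiset.filter_le_filter (· ≠ (1, 2)) hSX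
      rw [h1, Multiset.filter_add, h2, zero_add] at h3
      exact h3.trans (Multiset.filter_le _ _)
    -- The first component tells edges (below `n + 3`) from padding pairs.
    have hQC : Q.filter (fun e => e.1 < n + 3) ≤ C.val := by
      have h2 : D.filter (fun e => e.1 < n + 3) = 0 :=
        Multiset.filter_eq_nil.mpr fun e he h => by have := hD e he; omega
      have h3 := Multiset.filter_le_filter (fun e => e.1 < n + 3) hQ
      rw [Multiset.filter_add, h2, zero_add] at h3
      exact h3.trans (Multiset.filter_le _ _)
    have hQD : Q.filter (fun e => ¬ e.1 < n + 3) ≤ D := by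
      have h2 : C.val.filter (fun e => ¬ e.1 < n + 3) = 0 :=
        Multiset.filter_eq_nil.mpr fun e he h => by have := hC e he; omega
      have h3 := Multiset.filter_le_filter (fun e => ¬ e.1 < n + 3) hQ
      rw [Multiset.filter_add, h2, add_zero] at h3
      exact h3.trans (Multiset.filter_le _ _)
    have hQeq := Multiset.filter_add_not (fun e : ℕ × ℕ => e.1 < n + 3) Q
    generalize Q.filter (fun e => e.1 < n + 3) = Q1 at *
    generalize Q.filter (fun e => ¬ e.1 < n + 3) = Q2 at *
    subst hQeq
    have hle : ∀ v ∈ Finset.Ico 3 (n + 3), degree v (S + Q1) ≤ 1 := by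
      intro v hv
      have h1 := hwin v (by rw [Finset.mem_Ico] at hv; omega)
      have h2 : degree v (S + Q1) ≤ degree v ((0, 1) ::ₘ S + (Q1 + Q2)) :=
        degree_mono v (add_le_add (Multiset.le_cons_self _ _) (Multiset.le_add_right _ _))
      omega
    have hsum := hedge ⟨S, Multiset.nodup_of_le hSA A.nodup⟩ ⟨Q1, Multiset.nodup_of_le hQC C.nodup⟩
      (Finset.val_le_iff.mp hSA) (Finset.val_le_iff.mp hQC)
    simp only [Finset.card_mk] at hsum
    have hsum1 : ∑ v ∈ Finset.Ico 3 (n + 3), 1 = n := by simp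
    have hsumle := Finset.sum_le_sum hle
    have hQ2 := Multiset.card_le_card hQD
    rw [Multiset.card_add] at hQk
    rw [Multiset.card_cons] at hScard
    -- The pairs in `Q2` are at most `N`, so `Q1` has at least `k` edges, and `S` and `Q1` together
    -- at least `⌈n/2⌉`. By `hsum` and `hsumle` they have at most `n / 2`. So equality holds
    -- throughout, which gives `k` red edges and degree one at every vertex.
    refine ⟨⟨S, Multiset.nodup_of_le hSA A.nodup⟩, Finset.val_le_iff.mp hSA,
      ⟨Q1, Multiset.nodup_of_le hQC C.nodup⟩, Finset.val_le_iff.mp hQC, ?_,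
      (Finset.sum_eq_sum_iff_of_le hle).mp ?_⟩
    · rw [Finset.card_mk]
      omega
    · omega
  · rintro ⟨A', hA', C', hC', hk, hdeg⟩
    have hsum := hedge A' C' hA' hC'
    rw [Finset.sum_congr rfl hdeg] at hsum
    simp only [Finset.sum_const, Nat.card_Ico, smul_eq_mul] at hsum
    have hle : (0, 1) ::ₘ A'.val ≤ X := by
      rw [hX, Multiset.cons_le_cons_iff]
      exact (Finset.val_le_iff.mpr hA').trans (Multiset.le_add_left _ _)
    -- Keep only `(0, 1)` and the nonred edges of the matching; add its red edges and all padding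
    -- pairs.
    refine ⟨X - (0, 1) ::ₘ A'.val, D + C'.val, tsub_le_self,
      add_le_add_right (Finset.val_le_iff.mpr hC') _, ?_, ?_, ?_⟩
    · have h1 := congrArg Multiset.card (tsub_add_cancel_of_le hle)
      rw [Multiset.card_add, hXcard, Multiset.card_cons, Finset.card_val] at h1
      omega
    · rw [Multiset.card_add, hDN, Finset.card_val, hk]
    · rw [tsub_tsub_cancel_of_le hle]
      intro d hd
      have h0 : 1 ≤ degree 0 ((0, 1) ::ₘ A'.val + (D + C'.val)) := degree_pos.mpr ⟨(0, 1), by simp⟩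
      refine le_trans ?_ h0
      rw [show (0, 1) ::ₘ A'.val + (D + C'.val) = (0, 1) ::ₘ (D + (A'.val + C'.val)) by
        rw [Multiset.cons_add, add_left_comm], degree_cons, degree_add]
      have hAC : ∀ e ∈ A'.val + C'.val, 3 ≤ e.2 ∧ e.2 < e.1 ∧ e.1 < n + 3 := by
        intro e he
        rcases Multiset.mem_add.mp he with he | he
        exacts [hA e (hA' he), hC e (hC' he)]
      -- Candidates below `3` get points only from `(0, 1)`, vertices only from the matching, and
      -- padding candidates only from `D`.
      rcases lt_or_ge d 3 with h3 | h3
      · rw [degree_eq_zero fun e he => by have := hD e he; omega,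
          degree_eq_zero fun e he => by have := hAC e he; omega]
        split_ifs <;> omega
      · rw [if_neg (by simp only; omega)]
        rcases lt_or_ge d (n + 3) with h4 | h4
        · rw [degree_eq_zero fun e he => by have := hD e he; omega,
            hdeg d (Finset.mem_Ico.mpr ⟨h3, h4⟩)]
        · rw [degree_eq_zero (F := A'.val + C'.val) fun e he => by have := hAC e he; omega]
          have := hD1 d
          omega

end Reduction

/-! ### The strings of valid inputs and outputs -/

namespace Reduction

open ExactMatching

/-- The encoding of the matrix `c` below the diagonal. -/
def matrixString (n : ℕ) (c : ℕ → ℕ → Letter) : List Letter :=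
  (List.range n).flatMap fun i => (List.range i).map (c i) ++ [.rowEnd]

/-- The number of pairs `j < i < n`. -/
def numPairs (n : ℕ) : ℕ := (List.range n).sum

theorem numPairs_succ (n : ℕ) : numPairs (n + 1) = numPairs n + n := by
  simp [numPairs, List.range_succ]

/-- The approved pairs of the registered voters other than the first one, from row `i` on. -/
noncomputable def registeredPairs (c : ℕ → ℕ → Letter) (n : ℕ) : List (ℕ × ℕ) :=
  (List.range n).flatMap fun i =>
    (List.range i).map (fun j => if c i j = .nonredEdge then (i + 3, j + 3) else (1, 2)) ++
      if i % 2 = 0 then [(1, 2)] else []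

/-- The approved pairs of the unregistered voters. -/
noncomputable def unregisteredPairs (c : ℕ → ℕ → Letter) (d n : ℕ) : List (ℕ × ℕ) :=
  (List.range n).flatMap fun i => (List.range i).flatMap fun j =>
    (d + 2 * (numPairs i + j), d + 2 * (numPairs i + j) + 1) ::
      if c i j = .redEdge then [(i + 3, j + 3)] else []

variable {c : ℕ → ℕ → Letter} {n : ℕ} {l : List Letter}

/-- Induction on the number `t` of entries left in row `i`, of which the first `j` have been read.
-/
theorem scanRows_row (hc : ∀ i j, IsEntry (c i j)) (i k m t j : ℕ) (hj : j + t = i) :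
    scanRows (i + 3) (j + 3) k m ((List.range' j t).map (c i) ++ .rowEnd :: l) =
      scanRows (i + 4) 3 (k + t) (m + 2 * t + 1) l := by
  induction t generalizing j k m with
  | zero =>
    rw [List.range'_zero, List.map_nil, List.nil_append, scanRows, if_pos (by omega)]
    rfl
  | succ t ih =>
    rw [List.range'_succ, List.map_cons, List.cons_append, scanRows_entry (hc _ _),
      if_neg (by omega), show j + 3 + 1 = j + 1 + 3 by omega, ih _ _ _ (by omega)]
    congr 1 <;> omega

theorem scanRows_matrix (hc : ∀ i j, IsEntry (c i j)) (i k m t : ℕ) :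
    scanRows (i + 3) 3 k m ((List.range' i t).flatMap (fun i => (List.range i).map (c i) ++
      [.rowEnd]) ++ l) = scanRows (i + t + 3) 3 (k + (List.range' i t).sum)
        (m + 2 * (List.range' i t).sum + t) l := by
  induction t generalizing i k m with
  | zero => simp
  | succ t ih =>
    have h := fun l' => scanRows_row (l := l') hc i k m i 0 (by omega)
    rw [zero_add] at h
    rw [List.range'_succ, List.flatMap_cons, List.append_assoc, List.append_assoc,
      List.singleton_append, List.range_eq_range', h, show i + 4 = i + 1 + 3 by omega, ih,
      List.sum_cons]
    congr 1 <;> omega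

theorem scanRows_matrixString (hc : ∀ i j, IsEntry (c i j)) (hl : AtEnd l) :
    scanRows 3 3 0 3 (matrixString n c ++ l) =
      some (n + 3, numPairs n, n + 3 + 2 * numPairs n, l) := by
  have := scanRows_matrix (l := l) hc 0 0 3 n
  rw [← List.range_eq_range', scanRows_of_atEnd hl, if_pos rfl] at this
  rw [matrixString, this, numPairs]
  simp only [Option.some.injEq, Prod.mk.injEq, and_true]
  omega

theorem registeredString_row (hc : ∀ i j, IsEntry (c i j)) (M i t j : ℕ) (even : Bool)
    (hj : j + t = i) :
    registeredString M even (i + 3) (j + 3) ((List.range' j t).map (c i) ++ .rowEnd :: l) =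
      ((List.range' j t).map (fun j => if c i j = Letter.nonredEdge then (i + 3, j + 3) else (1, 2)) ++
        if even then [(1, 2)] else []).flatMap (fun e : ℕ × ℕ => voteString M e.1 e.2) ++
      registeredString M (!even) (i + 4) 3 l := by
  induction t generalizing j with
  | zero =>
    rw [List.range'_zero, List.map_nil, List.nil_append, registeredString]
    cases even <;> simp
  | succ t ih =>
    rw [List.range'_succ, List.map_cons, List.cons_append, registeredString_entry (hc _ _),
      show j + 3 + 1 = j + 1 + 3 by omega, ih _ (by omega), List.map_cons, List.cons_append,
      List.flatMap_cons, List.append_assoc]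
    congr 1
    split_ifs <;> rfl

theorem registeredString_matrix (hc : ∀ i j, IsEntry (c i j)) (hl : AtEnd l) (M i t : ℕ)
    (even : Bool) (he : even = decide (i % 2 = 0)) :
    registeredString M even (i + 3) 3 ((List.range' i t).flatMap (fun i => (List.range i).map (c i) ++
      [.rowEnd]) ++ l) = ((List.range' i t).flatMap fun i =>
        (List.range i).map (fun j => if c i j = .nonredEdge then (i + 3, j + 3) else (1, 2)) ++
          if i % 2 = 0 then [(1, 2)] else []).flatMap fun e => voteString M e.1 e.2 := by
  subst he
  induction t generalizing i with
  | zero => simp [registeredString_of_atEnd hl]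
  | succ t ih =>
    have h := fun l' => registeredString_row (l := l') hc M i i 0 (decide (i % 2 = 0)) (by omega)
    rw [zero_add] at h
    have h2 : (!decide (i % 2 = 0)) = decide ((i + 1) % 2 = 0) := by
      rw [← decide_not, decide_eq_decide]
      omega
    rw [List.range'_succ, List.flatMap_cons, List.append_assoc, List.append_assoc,
      List.singleton_append, List.range_eq_range', h, show i + 4 = i + 1 + 3 by omega, h2, ih,
      List.flatMap_cons]
    simp only [decide_eq_true_eq, List.range_eq_range', List.flatMap_append]

theorem registeredString_matrixString (hc : ∀ i j, IsEntry (c i j)) (hl : AtEnd l) (M : ℕ) :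
    registeredString M true 3 3 (matrixString n c ++ l) =
      (registeredPairs c n).flatMap fun e => voteString M e.1 e.2 := by
  have := registeredString_matrix (l := l) hc hl M 0 n true rfl
  rwa [← List.range_eq_range'] at this

theorem unregisteredString_row (hc : ∀ i j, IsEntry (c i j)) (M d i t j : ℕ) (hj : j + t = i) :
    unregisteredString M (d + 2 * j) (i + 3) (j + 3) ((List.range' j t).map (c i) ++ .rowEnd :: l) =
      ((List.range' j t).flatMap fun j => (d + 2 * j, d + 2 * j + 1) ::
        if c i j = .redEdge then [(i + 3, j + 3)] else []).flatMap
          (fun e => voteString M e.1 e.2) ++ unregisteredString M (d + 2 * i) (i + 4) 3 l := by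
  induction t generalizing j with
  | zero =>
    obtain rfl : j = i := by omega
    rw [List.range'_zero, List.map_nil, List.nil_append, unregisteredString]
    simp
  | succ t ih =>
    rw [List.range'_succ, List.map_cons, List.cons_append, unregisteredString_entry (hc _ _),
      show j + 3 + 1 = j + 1 + 3 by omega, show d + 2 * j + 2 = d + 2 * (j + 1) by omega,
      ih _ (by omega), List.flatMap_cons, List.flatMap_append, List.append_assoc, List.append_assoc]
    split_ifs <;> simp

/-- `numPairs i + j` is the number of entries read before the entry `(i, j)`, so a running counter
yields the padding pair of each entry. -/
theorem unregisteredString_matrix (hc : ∀ i j, IsEntry (c i j)) (hl : AtEnd l) (M d i t : ℕ) :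
    unregisteredString M (d + 2 * numPairs i) (i + 3) 3 ((List.range' i t).flatMap
      (fun i => (List.range i).map (c i) ++ [.rowEnd]) ++ l) =
      ((List.range' i t).flatMap fun i => (List.range i).flatMap fun j =>
        (d + 2 * (numPairs i + j), d + 2 * (numPairs i + j) + 1) ::
          if c i j = .redEdge then [(i + 3, j + 3)] else []).flatMap
            fun e => voteString M e.1 e.2 := by
  induction t generalizing i with
  | zero => simp [unregisteredString_of_atEnd hl]
  | succ t ih =>
    have h := fun l' => unregisteredString_row (l := l') hc M (d + 2 * numPairs i) i i 0 (by omega)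
    rw [mul_zero, add_zero, zero_add] at h
    rw [List.range'_succ, List.flatMap_cons, List.append_assoc, List.append_assoc,
      List.singleton_append, List.range_eq_range', h, show i + 4 = i + 1 + 3 by omega,
      show d + 2 * numPairs i + 2 * i = d + 2 * numPairs (i + 1) by rw [numPairs_succ]; ring, ih,
      List.flatMap_cons, List.flatMap_append]
    simp only [List.range_eq_range', mul_add, add_assoc]

theorem unregisteredString_matrixString (hc : ∀ i j, IsEntry (c i j)) (hl : AtEnd l) (M d : ℕ) :
    unregisteredString M d 3 3 (matrixString n c ++ l) =
      (unregisteredPairs c d n).flatMap fun e => voteString M e.1 e.2 := by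
  have := unregisteredString_matrix (l := l) hc hl M d 0 n
  rwa [← List.range_eq_range'] at this

theorem matrixString_succ (n : ℕ) (c : ℕ → ℕ → Letter) :
    matrixString (n + 1) c = matrixString n c ++ (List.range n).map (c n) ++ [.rowEnd] := by
  simp [matrixString, List.range_succ]

/-- Every string accepted by `scanRows` starts with a matrix, of which a part has been read. -/
theorem exists_matrix_of_scanRows {i j k m n' k' m' : ℕ} {l' : List Letter}
    (h : scanRows (i + 3) (j + 3) k m l = some (n', k', m', l')) (hc : ∀ i j, IsEntry (c i j)) :
    ∃ (c' : ℕ → ℕ → Letter) (n : ℕ), (∀ i j, IsEntry (c' i j)) ∧ AtEnd l' ∧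
      matrixString i c ++ (List.range j).map (c i) ++ l = matrixString n c' ++ l' := by
  induction l using letter_induction generalizing i j k m c with
  | hend l hl =>
    rw [scanRows_of_atEnd hl] at h
    split_ifs at h with hj
    obtain rfl : l = l' := by simp at h; exact h.2.2.2
    obtain rfl : j = 0 := by omega
    exact ⟨c, i, hc, hl, by simp⟩
  | hrow l ih =>
    rw [scanRows] at h
    split_ifs at h with hj
    obtain rfl : j = i := by omega
    obtain ⟨c', n, h1, h2, h3⟩ := ih (i := j + 1) (j := 0) (c := c) h hc
    refine ⟨c', n, h1, h2, ?_⟩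
    rw [← h3, matrixString_succ]
    simp
  | hentry a l ha ih =>
    rw [scanRows_entry ha] at h
    split_ifs at h with hj
    -- `c` records the letters read so far. The new letter is stored at `(i, j)`, outside the part
    -- already read, so that part of the string is unchanged (`e1`, `e2`).
    obtain ⟨c', n, h1, h2, h3⟩ := ih (i := i) (j := j + 1)
      (c := Function.update c i (Function.update (c i) j a)) h (fun i' j' => by
        by_cases hi : i' = i
        · subst hi
          rw [Function.update_self, Function.update_apply]
          split_ifs
          exacts [ha, hc _ _]
        · rw [Function.update_of_ne hi]
          exact hc _ _)
    refine ⟨c', n, h1, h2, ?_⟩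
    have e1 : matrixString i (Function.update c i (Function.update (c i) j a)) =
        matrixString i c := by
      rw [matrixString, matrixString]
      refine List.flatMap_congr fun i' hi => ?_
      rw [Function.update_of_ne (List.mem_range.mp hi).ne]
    have e2 : (List.range j).map (Function.update (c i) j a) = (List.range j).map (c i) :=
      List.map_congr_left fun j' hj => Function.update_of_ne (List.mem_range.mp hj).ne _ _
    rw [← h3, e1, List.range_succ, List.map_append, Function.update_self, e2]
    simp

/-- If the scan stops early, then `pow > i` while bits remain. The last of these is `1`, so the
remaining value `pow * K` is at least `pow`. The hypothesis `hK` excludes a numeral that ends in a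
zero. -/
theorem scanBits_bits (i pow k K : ℕ) (last : Bool) (hK : K = 0 → last = true) :
    (scanBits i pow k last (K.bits.map .bit) = some (k + pow * K)) ∨
      scanBits i pow k last (K.bits.map .bit) = none ∧ i < pow * K := by
  induction K using Nat.binaryRec' generalizing pow k last with
  | zero => simp [scanBits, hK rfl]
  | bit b K h ih =>
    rw [Nat.bits_append_bit _ _ h, List.map_cons, scanBits]
    split_ifs with hp hb
    · have := ih (pow + pow) (k + pow) b h
      subst hb
      rw [Nat.bit_val]
      have e : pow * (2 * K + true.toNat) = (pow + pow) * K + pow := by simp; ring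
      rw [e, add_comm ((pow + pow) * K) pow, ← add_assoc]
      exact this.imp id fun h => ⟨h.1, by omega⟩
    · have := ih (pow + pow) (k + 0) b h
      rw [Nat.bit_val]
      have hb : b = false := by simpa using hb
      subst hb
      have e : pow * (2 * K + false.toNat) = (pow + pow) * K := by simp; ring
      rw [e]
      exact this
    · refine .inr ⟨rfl, lt_of_lt_of_le (not_le.mp hp) (Nat.le_mul_of_pos_right _ ?_)⟩
      rw [Nat.bit_val]
      rcases Nat.eq_zero_or_pos K with h0 | h0
      · simp [h h0]
      · omega

/-- The check of the last bit leaves only numerals of the form `Nat.bits K`. -/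
theorem exists_bits_of_scanBits {i pow k k' : ℕ} {last : Bool}
    (h : scanBits i pow k last l = some k') :
    ∃ K : ℕ, (K = 0 → last = true) ∧ l = K.bits.map .bit := by
  induction l generalizing pow k last with
  | nil =>
    rw [scanBits] at h
    exact ⟨0, fun _ => by by_contra hl; simp [hl] at h, by simp⟩
  | cons a l ih =>
    cases a with
    | bit b =>
      rw [scanBits] at h
      split_ifs at h <;>
      · obtain ⟨K, hK, rfl⟩ := ih h
        refine ⟨Nat.bit b K, fun h0 => ?_, by rw [Nat.bits_append_bit _ _ hK, List.map_cons]⟩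
        rw [Nat.bit_val] at h0
        have hK0 : K = 0 := by omega
        have := hK hK0
        subst this
        simp at h0
    | _ => simp [scanBits] at h

end Reduction

/-! ### The multisets of approved pairs -/

namespace Reduction

open ExactMatching

/-- The pairs of vertices (shifted by `3`) whose entry is `a`. -/
noncomputable def edgeList (c : ℕ → ℕ → Letter) (a : Letter) (n : ℕ) : List (ℕ × ℕ) :=
  (List.range n).flatMap fun i =>
    ((List.range i).filter fun j => c i j = a).map fun j => (i + 3, j + 3)

variable {c : ℕ → ℕ → Letter} {n : ℕ} {a : Letter}

theorem mem_edgeList {e : ℕ × ℕ} :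
    e ∈ edgeList c a n ↔ ∃ i j, j < i ∧ i < n ∧ c i j = a ∧ e = (i + 3, j + 3) := by
  simp only [edgeList, List.mem_flatMap, List.mem_range, List.mem_map, List.mem_filter,
    decide_eq_true_eq]
  constructor
  · rintro ⟨i, hi, j, ⟨hj, h⟩, rfl⟩
    exact ⟨i, j, hj, hi, h, rfl⟩
  · rintro ⟨i, j, hj, hi, h, rfl⟩
    exact ⟨i, hi, j, ⟨hj, h⟩, rfl⟩

theorem nodup_edgeList : (edgeList c a n).Nodup := by
  rw [edgeList, List.nodup_flatMap]
  refine ⟨fun i _ => (List.nodup_range.filter _).map fun j j' h => ?_,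
    List.nodup_range.imp fun {i i'} hne => ?_⟩
  · simpa using h
  · intro e h1 h2
    simp only [List.mem_map] at h1 h2
    obtain ⟨j, -, rfl⟩ := h1
    obtain ⟨j', -, h⟩ := h2
    simp only [Prod.mk.injEq] at h
    omega

/-- The set of the pairs of vertices (shifted by `3`) whose entry is `a`. -/
noncomputable def edgePairs (c : ℕ → ℕ → Letter) (a : Letter) (n : ℕ) : Finset (ℕ × ℕ) :=
  ⟨edgeList c a n, Multiset.coe_nodup.mpr nodup_edgeList⟩

theorem val_edgePairs : (edgePairs c a n).val = edgeList c a n := rfl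

theorem mem_edgePairs {e : ℕ × ℕ} :
    e ∈ edgePairs c a n ↔ ∃ i j, j < i ∧ i < n ∧ c i j = a ∧ e = (i + 3, j + 3) :=
  mem_edgeList

theorem bounds_of_mem_edgePairs {e : ℕ × ℕ} (h : e ∈ edgePairs c a n) :
    3 ≤ e.2 ∧ e.2 < e.1 ∧ e.1 < n + 3 := by
  obtain ⟨i, j, h1, h2, -, rfl⟩ := mem_edgePairs.mp h
  simp only
  omega

theorem filter_registeredPairs :
    (registeredPairs c n).filter (· ≠ (1, 2)) = edgeList c .nonredEdge n := by
  rw [registeredPairs, edgeList, List.filter_flatMap]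
  refine List.flatMap_congr fun i _ => ?_
  have h : (if i % 2 = 0 then [((1 : ℕ), 2)] else []).filter (· ≠ (1, 2)) = [] := by
    split_ifs <;> simp
  rw [List.filter_append, h, List.append_nil]
  generalize List.range i = r
  induction r with
  | nil => rfl
  | cons j r ih =>
    rw [List.map_cons, List.filter_cons, List.filter_cons, ih]
    by_cases hj : c i j = .nonredEdge <;> simp [hj]

/-- One vote per entry and one more per row of even index: the parity flag produces `⌈n/2⌉` without
a division. -/
theorem length_registeredPairs : (registeredPairs c n).length = numPairs n + (n + 1) / 2 := by
  induction n with
  | zero => rfl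
  | succ n ih =>
    rw [registeredPairs, List.range_succ, List.flatMap_append, List.length_append, ← registeredPairs,
      ih, numPairs_succ, List.flatMap_singleton, List.length_append, List.length_map,
      List.length_range]
    split_ifs <;> simp <;> omega

theorem exists_registeredPairs_eq (c : ℕ → ℕ → Letter) (n : ℕ) :
    ∃ L, L + (edgePairs c .nonredEdge n).card = numPairs n + (n + 1) / 2 ∧
      (registeredPairs c n : Multiset (ℕ × ℕ)) =
        Multiset.replicate L (1, 2) + (edgePairs c .nonredEdge n).val := by
  have h := Multiset.filter_add_not (· = ((1 : ℕ), 2)) (registeredPairs c n : Multiset (ℕ × ℕ))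
  rw [Multiset.filter_eq'] at h
  have h2 : Multiset.filter (fun e => ¬ e = (1, 2)) (registeredPairs c n : Multiset (ℕ × ℕ)) =
      (edgePairs c .nonredEdge n).val := by
    rw [val_edgePairs, ← filter_registeredPairs, Multiset.filter_coe]
  rw [h2] at h
  refine ⟨_, ?_, h.symm⟩
  have := congrArg Multiset.card h
  rwa [Multiset.card_add, Multiset.card_replicate, Multiset.coe_card, length_registeredPairs] at this

/-- The disjoint pairs of padding candidates. -/
def padPairs (d N : ℕ) : List (ℕ × ℕ) := (List.range N).map fun t => (d + 2 * t, d + 2 * t + 1)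

/-- A candidate `v` can occur only in the pair with index `(v - d) / 2`. -/
theorem degree_padPairs_le (d N v : ℕ) : degree v (padPairs d N) ≤ 1 := by
  rw [degree, Multiset.coe_countP, padPairs, List.countP_map]
  refine le_trans (List.countP_mono_left (q := (· == (v - d) / 2)) fun t _ h => ?_)
    (List.nodup_iff_count_le_one.mp List.nodup_range ((v - d) / 2))
  simp only [Function.comp_apply, decide_eq_true_eq] at h
  simp only [beq_iff_eq]
  omega

theorem coe_unregisteredPairs (d : ℕ) :
    (unregisteredPairs c d n : Multiset (ℕ × ℕ)) =
      padPairs d (numPairs n) + (edgePairs c .redEdge n).val := by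
  induction n with
  | zero => rfl
  | succ n ih =>
    rw [unregisteredPairs, List.range_succ, List.flatMap_append, ← Multiset.coe_add,
      ← unregisteredPairs, ih, List.flatMap_singleton]
    have h1 : padPairs d (numPairs (n + 1)) = padPairs d (numPairs n) ++
        (List.range n).map fun j => (d + 2 * (numPairs n + j), d + 2 * (numPairs n + j) + 1) := by
      rw [numPairs_succ, padPairs, List.range_add, List.map_append, List.map_map]
      rfl
    have h2 : (edgePairs c .redEdge (n + 1)).val = (edgePairs c .redEdge n).val +
        (((List.range n).filter fun j => c n j = .redEdge).map fun j => (n + 3, j + 3) :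
          List (ℕ × ℕ)) := by
      rw [val_edgePairs, val_edgePairs, Multiset.coe_add, edgeList, List.range_succ,
        List.flatMap_append, List.flatMap_singleton, ← edgeList]
    have h3 : ∀ r : List ℕ, ((r.flatMap fun j => (d + 2 * (numPairs n + j),
        d + 2 * (numPairs n + j) + 1) :: if c n j = .redEdge then [(n + 3, j + 3)] else [] :
          List (ℕ × ℕ)) : Multiset (ℕ × ℕ)) =
        (r.map fun j => (d + 2 * (numPairs n + j), d + 2 * (numPairs n + j) + 1) : List (ℕ × ℕ)) +
        ((r.filter fun j => c n j = .redEdge).map fun j => (n + 3, j + 3) : List (ℕ × ℕ)) := by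
      intro r
      induction r with
      | nil => rfl
      | cons j r ih =>
        rw [List.flatMap_cons, ← Multiset.coe_add, ih, List.map_cons, List.filter_cons,
          ← Multiset.cons_coe, ← Multiset.cons_coe]
        by_cases hj : c n j = .redEdge
        · simpa [hj] using List.perm_middle.symm
        · simp [hj]
    rw [h1, h2, h3, ← Multiset.coe_add]
    abel

end Reduction

/-! ### The encoding of elections -/

namespace Voting

theorem bits_injective : Function.Injective Nat.bits := fun a b h => by
  have := congrArg (fun l => Nat.ofDigits 2 (l.map fun b => cond b 1 0)) h
  simpa [← Nat.digits_two_eq_bits, Nat.ofDigits_digits] using this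

theorem encodeNat_append_inj {a b : ℕ} {l l' : List Letter}
    (h : encodeNat a ++ l = encodeNat b ++ l') : a = b ∧ l = l' := by
  have key : ∀ x y : List Bool, x.map Letter.bit ++ Letter.comma :: l =
      y.map Letter.bit ++ Letter.comma :: l' → x = y ∧ l = l' := by
    intro x
    induction x with
    | nil => rintro (_ | ⟨b, y⟩) h <;> simp_all
    | cons a x ih =>
      rintro (_ | ⟨b, y⟩) h
      · simp at h
      · simp only [List.map_cons, List.cons_append, List.cons.injEq, Letter.bit.injEq] at h
        obtain ⟨rfl, rfl⟩ := ih y h.2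
        exact ⟨by rw [h.1], rfl⟩
  simp only [encodeNat, List.append_assoc, List.singleton_append] at h
  obtain ⟨h1, h2⟩ := key _ _ h
  exact ⟨bits_injective h1, h2⟩

/-- A numeral starts with a bit, or with the comma if the number is `0`. -/
theorem encodeNat_append_ne_semicolon {a : ℕ} {l l' : List Letter} :
    encodeNat a ++ l ≠ .semicolon :: l' := by
  rw [encodeNat]
  cases Nat.bits a <;> simp

theorem encodeNat_append_ne_bar {a : ℕ} {l l' : List Letter} :
    encodeNat a ++ l ≠ .bar :: l' := by
  rw [encodeNat]
  cases Nat.bits a <;> simp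

theorem flatMap_encodeNat_append_inj {x y : List ℕ} {l l' : List Letter}
    (h : x.flatMap encodeNat ++ .semicolon :: l = y.flatMap encodeNat ++ .semicolon :: l') :
    x = y ∧ l = l' := by
  induction x generalizing y with
  | nil =>
    cases y with
    | nil => simpa using h
    | cons b y =>
      rw [List.flatMap_cons, List.append_assoc] at h
      exact absurd h.symm encodeNat_append_ne_semicolon
  | cons a x ih =>
    cases y with
    | nil =>
      rw [List.flatMap_cons, List.append_assoc] at h
      exact absurd h encodeNat_append_ne_semicolon
    | cons b y =>
      rw [List.flatMap_cons, List.append_assoc, List.flatMap_cons, List.append_assoc] at h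
      obtain ⟨rfl, h1⟩ := encodeNat_append_inj h
      obtain ⟨rfl, h2⟩ := ih h1
      exact ⟨rfl, h2⟩

variable {m : ℕ}

/-- The candidates of a vote from the top to the bottom. -/
def ranking (v : Vote m) : List ℕ := (List.finRange m).map fun i => (v i : ℕ)

theorem encodeVote_eq (v : Vote m) :
    encodeVote v = (ranking v).flatMap encodeNat ++ [.semicolon] := by
  rw [encodeVote, ranking, List.flatMap_map]

theorem ranking_refl : ranking (Equiv.refl (Fin m)) = List.range m := by
  exact List.ext_getElem (by simp [ranking]) fun i h1 h2 => by simp [ranking]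

theorem ranking_injective : Function.Injective (ranking (m := m)) := fun v w h => by
  ext i
  exact List.map_inj_left.mp h i (List.mem_finRange i)

theorem encodeVote_append_inj {v w : Vote m} {l l' : List Letter}
    (h : encodeVote v ++ l = encodeVote w ++ l') : v = w ∧ l = l' := by
  simp only [encodeVote_eq, List.append_assoc, List.singleton_append] at h
  obtain ⟨h1, h2⟩ := flatMap_encodeNat_append_inj h
  exact ⟨ranking_injective h1, h2⟩

theorem encodeVote_append_ne_bar (v : Vote m) {l l' : List Letter} :
    encodeVote v ++ l ≠ .bar :: l' := by
  rw [encodeVote_eq]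
  cases ranking v with
  | nil => simp
  | cons a r =>
    rw [List.flatMap_cons, List.append_assoc, List.append_assoc]
    exact encodeNat_append_ne_bar

theorem flatMap_encodeVote_append_bar_inj {x y : List (Vote m)} {l l' : List Letter}
    (h : x.flatMap encodeVote ++ .bar :: l = y.flatMap encodeVote ++ .bar :: l') :
    x = y ∧ l = l' := by
  induction x generalizing y with
  | nil =>
    cases y with
    | nil => simpa using h
    | cons b y =>
      rw [List.flatMap_cons, List.append_assoc] at h
      exact absurd h.symm (encodeVote_append_ne_bar b)
  | cons a x ih =>
    cases y with
    | nil =>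
      rw [List.flatMap_cons, List.append_assoc] at h
      exact absurd h (encodeVote_append_ne_bar a)
    | cons b y =>
      rw [List.flatMap_cons, List.append_assoc, List.flatMap_cons, List.append_assoc] at h
      obtain ⟨rfl, h1⟩ := encodeVote_append_inj h
      obtain ⟨rfl, h2⟩ := ih h1
      exact ⟨rfl, h2⟩

/-- Membership in the language only provides some instance with the given encoding. Every numeral
and vote has its own terminator, so the string can be decoded from the left; the list of all
candidates comes first and determines `m`. -/
theorem encode_injective : Function.Injective Instance.encode := by
  rintro ⟨m, x, y, k, p⟩ ⟨m', x', y', k', p'⟩ h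
  simp only [Instance.encode, encodeVote_eq (Equiv.refl _), ranking_refl, List.append_assoc,
    List.cons_append, List.nil_append] at h
  obtain ⟨h1, h2⟩ := flatMap_encodeNat_append_inj h
  obtain rfl : m = m' := by simpa using congrArg List.length h1
  obtain ⟨h3, h4⟩ := encodeNat_append_inj h2
  obtain rfl : p = p' := Fin.ext h3
  obtain ⟨rfl, h5⟩ := encodeNat_append_inj h4
  obtain ⟨rfl, h6⟩ := flatMap_encodeVote_append_bar_inj h5
  -- The unregistered votes extend to the end of the string; a bar is appended to reuse the lemma.
  obtain ⟨rfl, -⟩ := flatMap_encodeVote_append_bar_inj (l := []) (l' := [])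
    (congrArg (· ++ [Letter.bar]) h6)
  rfl

theorem encode_mem_CCRVExact {E : VotingRule} {I : Instance} :
    I.encode ∈ CCRVExact E ↔ I.IsYesExact E :=
  ⟨fun ⟨_, h, hI⟩ => encode_injective hI ▸ h, fun h => ⟨I, h, rfl⟩⟩

theorem nil_notMem_CCRVExact {E : VotingRule} : [] ∉ CCRVExact E :=
  fun ⟨I, _, h⟩ => by simp [Instance.encode] at h

/-! ### Votes with a given pair of top candidates -/

theorem exists_ranking_eq {r : List ℕ} (hr : r.Nodup) (hmem : ∀ a, a ∈ r ↔ a < m) :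
    ∃ v : Vote m, ranking v = r := by
  have hlen : r.length = m := by
    have : r.Perm (List.range m) := (List.perm_ext_iff_of_nodup hr List.nodup_range).mpr (by simpa)
    simpa using this.length_eq
  have hlt : ∀ i : Fin m, r[i]'(by omega) < m := fun i => (hmem _).mp (List.getElem_mem _)
  have hinj : Function.Injective fun i : Fin m => (⟨r[i]'(by omega), hlt i⟩ : Fin m) := by
    intro i j h
    simp only [Fin.mk.injEq] at h
    exact Fin.ext ((hr.getElem_inj_iff).mp h)
  refine ⟨Equiv.ofBijective _ (Finite.injective_iff_bijective.mp hinj), ?_⟩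
  refine List.ext_getElem (by simp [ranking, hlen]) fun i h1 h2 => ?_
  simp [ranking]

end Voting

/-! ### The election of an instance of Exact Perfect Matching -/

namespace Reduction

open ExactMatching Voting

variable {m : ℕ}

/-- The pairs of distinct candidates. -/
def IsPair (m : ℕ) (e : ℕ × ℕ) : Prop := e.1 < m ∧ e.2 < m ∧ e.1 ≠ e.2

theorem exists_ranking_eq_cons {e : ℕ × ℕ} (h : IsPair m e) : ∃ v : Vote m,
    ranking v = e.1 :: e.2 :: (List.range m).filter fun c => c ≠ e.1 ∧ c ≠ e.2 := by
  obtain ⟨h1, h2, h3⟩ := h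
  refine exists_ranking_eq ?_ fun c => ?_
  · simp [h3, List.nodup_range.filter]
  · simp only [List.mem_cons, List.mem_filter, List.mem_range, decide_eq_true_eq]
    by_cases c = e.1 <;> by_cases c = e.2 <;> simp_all

open Classical in
/-- The vote with the given pair of candidates on top, followed by the other candidates in order. -/
noncomputable def topVote (m : ℕ) (e : ℕ × ℕ) : Vote m :=
  if h : IsPair m e then (exists_ranking_eq_cons h).choose else Equiv.refl _

theorem ranking_topVote {e : ℕ × ℕ} (h : IsPair m e) : ranking (topVote m e) =
    e.1 :: e.2 :: (List.range m).filter fun c => c ≠ e.1 ∧ c ≠ e.2 := by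
  rw [topVote, dif_pos h]
  exact (exists_ranking_eq_cons h).choose_spec

theorem encodeVote_topVote {e : ℕ × ℕ} (h : IsPair m e) :
    encodeVote (topVote m e) = voteString m e.1 e.2 := by
  rw [encodeVote_eq, ranking_topVote h, voteString]
  simp only [List.flatMap_cons, List.append_assoc]

theorem flatMap_encodeVote {l : List (ℕ × ℕ)} (h : ∀ e ∈ l, IsPair m e) :
    (l.map (topVote m)).flatMap encodeVote = l.flatMap fun e => voteString m e.1 e.2 := by
  rw [List.flatMap_map]
  exact List.flatMap_congr fun e he => encodeVote_topVote (h e he)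

theorem topVote_symm_lt_two {e : ℕ × ℕ} (h : IsPair m e) (c : Fin m) :
    ((topVote m e).symm c : ℕ) < 2 ↔ e.1 = c ∨ e.2 = c := by
  have h0 : ∀ i : Fin m, (ranking (topVote m e))[(i : ℕ)]? = some (topVote m e i : ℕ) := by
    intro i
    simp [ranking]
  rw [ranking_topVote h] at h0
  obtain ⟨i, rfl⟩ := (topVote m e).surjective c
  rw [Equiv.symm_apply_apply]
  have hm : 1 < m := by
    obtain ⟨h1, h2, h3⟩ := h
    omega
  have e0 := h0 ⟨0, by omega⟩
  have e1 := h0 ⟨1, hm⟩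
  simp only [List.getElem?_cons_zero, List.getElem?_cons_succ, Option.some.injEq] at e0 e1
  rw [e0, e1, Fin.val_inj, Fin.val_inj, (topVote m e).injective.eq_iff,
    (topVote m e).injective.eq_iff, Fin.ext_iff, Fin.ext_iff]
  simp only
  omega

theorem score_map_topVote {F : Multiset (ℕ × ℕ)} (h : ∀ e ∈ F, IsPair m e) (c : Fin m) :
    score (fun i => if (i : ℕ) < 2 then 1 else 0) (F.map (topVote m)) c = degree c F := by
  induction F using Multiset.induction with
  | empty => simp [score, degree]
  | cons e F ih =>
    have := ih fun e he => h e (Multiset.mem_cons_of_mem he)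
    simp only [score] at this
    rw [score, Multiset.map_cons, Multiset.map_cons, Multiset.sum_cons, this, degree_cons]
    simp only [topVote_symm_lt_two (h e (Multiset.mem_cons_self _ _))]
    push_cast
    ring

/-- Turns a choice of votes into a choice of pairs. Injectivity of `f` is not needed, since
preimages are chosen with multiplicity. -/
theorem exists_le_of_le_map {α β : Type*} {f : α → β} {X : Multiset α} {V : Multiset β}
    (h : V ≤ X.map f) : ∃ P ≤ X, P.map f = V := by
  induction X using Multiset.induction generalizing V with
  | empty => exact ⟨0, le_rfl, (Multiset.le_zero.mp h).symm⟩
  | cons a X ih =>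
    classical
    rw [Multiset.map_cons] at h
    by_cases ha : f a ∈ V
    · obtain ⟨W, rfl⟩ := Multiset.exists_cons_of_mem ha
      obtain ⟨P, hP, rfl⟩ := ih ((Multiset.cons_le_cons_iff _).mp h)
      exact ⟨a ::ₘ P, (Multiset.cons_le_cons_iff _).mpr hP, by simp⟩
    · obtain ⟨P, hP, rfl⟩ := ih ((Multiset.le_cons_of_notMem ha).mp h)
      exact ⟨P, hP.trans (Multiset.le_cons_self _ _), rfl⟩

/-- Control by replacing voters in 2-Approval, in terms of pairs of approved candidates. -/
theorem isYesExact_iff {x y : List (ℕ × ℕ)} (hx : ∀ e ∈ x, IsPair m e) (hy : ∀ e ∈ y, IsPair m e)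
    (k : ℕ) (p : Fin m) :
    Voting.Instance.IsYesExact twoApproval ⟨m, x.map (topVote m), y.map (topVote m), k, p⟩ ↔
      ∃ P Q : Multiset (ℕ × ℕ), P ≤ x ∧ Q ≤ y ∧ P.card = k ∧ Q.card = k ∧
        ∀ d < m, degree d (x - P + Q) ≤ degree p (x - P + Q) := by
  have key : ∀ P Q : Multiset (ℕ × ℕ), P ≤ x → Q ≤ y →
      (p ∈ twoApproval m (((x : Multiset (ℕ × ℕ)).map (topVote m)) - P.map (topVote m) +
        Q.map (topVote m)) ↔ ∀ d < m, degree d (x - P + Q) ≤ degree p (x - P + Q)) := by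
    intro P Q hP hQ
    -- Subtraction of multisets commutes with `map` here because `P` is contained in `x`.
    have hsub : (x : Multiset (ℕ × ℕ)).map (topVote m) - P.map (topVote m) =
        ((x : Multiset (ℕ × ℕ)) - P).map (topVote m) := by
      conv_lhs => rw [← tsub_add_cancel_of_le hP, Multiset.map_add]
      exact add_tsub_cancel_right _ _
    have hF : ∀ e ∈ (x : Multiset (ℕ × ℕ)) - P + Q, IsPair m e := by
      intro e he
      rcases Multiset.mem_add.mp he with he | he
      exacts [hx e (Multiset.mem_of_le tsub_le_self he), hy e (Multiset.mem_of_le hQ he)]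
    rw [hsub, ← Multiset.map_add, twoApproval, scoringRule, Set.mem_ofPred_eq]
    simp only [score_map_topVote hF, Nat.cast_le]
    exact ⟨fun h d hd => h ⟨d, hd⟩, fun h d => h d d.2⟩
  simp only [Voting.Instance.IsYesExact, ← Multiset.map_coe]
  constructor
  · rintro ⟨V, W, hV, hW, hVk, hWk, hp⟩
    obtain ⟨P, hP, rfl⟩ := exists_le_of_le_map hV
    obtain ⟨Q, hQ, rfl⟩ := exists_le_of_le_map hW
    rw [Multiset.card_map] at hVk hWk
    exact ⟨P, Q, hP, hQ, hVk, hWk, (key P Q hP hQ).mp hp⟩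
  · rintro ⟨P, Q, hP, hQ, hPk, hQk, h⟩
    exact ⟨_, _, Multiset.map_le_map hP, Multiset.map_le_map hQ, by rwa [Multiset.card_map],
      by rwa [Multiset.card_map], (key P Q hP hQ).mpr h⟩

variable {c : ℕ → ℕ → ExactMatching.Letter} {n : ℕ}

theorem isPair_of_mem_registeredPairs {e : ℕ × ℕ} (he : e ∈ (0, 1) :: registeredPairs c n) :
    IsPair (n + 3 + 2 * numPairs n) e := by
  rcases List.mem_cons.mp he with rfl | he
  · simp only [IsPair]
    omega
  obtain ⟨L, -, h⟩ := exists_registeredPairs_eq c n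
  rw [← Multiset.mem_coe, h, Multiset.mem_add] at he
  rcases he with he | he
  · rw [Multiset.eq_of_mem_replicate he]
    simp only [IsPair]
    omega
  · have := bounds_of_mem_edgePairs (Finset.mem_val.mp he)
    simp only [IsPair]
    omega

theorem bounds_of_mem_padPairs {d N : ℕ} {e : ℕ × ℕ} (h : e ∈ padPairs d N) :
    d ≤ e.1 ∧ e.2 = e.1 + 1 ∧ e.2 < d + 2 * N := by
  obtain ⟨t, ht, rfl⟩ := List.mem_map.mp h
  rw [List.mem_range] at ht
  exact ⟨Nat.le_add_right _ _, rfl, by simp only; omega⟩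

theorem isPair_of_mem_unregisteredPairs {e : ℕ × ℕ} (he : e ∈ unregisteredPairs c (n + 3) n) :
    IsPair (n + 3 + 2 * numPairs n) e := by
  rw [← Multiset.mem_coe, coe_unregisteredPairs, Multiset.mem_add] at he
  rcases he with he | he
  · have := bounds_of_mem_padPairs (Multiset.mem_coe.mp he)
    simp only [IsPair]
    omega
  · have := bounds_of_mem_edgePairs (Finset.mem_val.mp he)
    simp only [IsPair]
    omega

/-- Whether a valid output is a yes-instance. -/
theorem outputString_mem_iff (hc : ∀ i j, IsEntry (c i j)) {l : List ExactMatching.Letter}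
    (hl : AtEnd l) (k : ℕ) :
    outputString (matrixString n c ++ l) (n + 3) (numPairs n + k) (n + 3 + 2 * numPairs n) ∈
      CCRVExact twoApproval ↔
    ∃ A ⊆ edgePairs c .nonredEdge n, ∃ C ⊆ edgePairs c .redEdge n, C.card = k ∧
      ∀ v ∈ Finset.Ico 3 (n + 3), degree v (A.val + C.val) = 1 := by
  set m := n + 3 + 2 * numPairs n with hm
  have hx : ∀ e ∈ (0, 1) :: registeredPairs c n, IsPair m e :=
    fun e he => isPair_of_mem_registeredPairs he
  have hy : ∀ e ∈ unregisteredPairs c (n + 3) n, IsPair m e :=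
    fun e he => isPair_of_mem_unregisteredPairs he
  have henc : outputString (matrixString n c ++ l) (n + 3) (numPairs n + k) m = Voting.Instance.encode
      ⟨m, ((0, 1) :: registeredPairs c n).map (topVote m),
        (unregisteredPairs c (n + 3) n).map (topVote m), numPairs n + k, ⟨0, by omega⟩⟩ := by
    rw [outputString, Voting.Instance.encode, registeredString_matrixString hc hl,
      unregisteredString_matrixString hc hl, encodeVote_eq, ranking_refl]
    simp only
    rw [flatMap_encodeVote hx, flatMap_encodeVote hy, List.flatMap_cons]
    simp only [List.append_assoc]
  obtain ⟨L, hL, hreg⟩ := exists_registeredPairs_eq c n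
  rw [henc, encode_mem_CCRVExact, isYesExact_iff hx hy, ← Multiset.cons_coe, hreg,
    coe_unregisteredPairs]
  refine exists_replacement_iff (fun e he => bounds_of_mem_edgePairs he)
    (fun e he => bounds_of_mem_edgePairs he) (fun e he => ?_) (degree_padPairs_le _ _)
    (by simp [padPairs]) hL (by omega)
  have := bounds_of_mem_padPairs (Multiset.mem_coe.mp he)
  omega

end Reduction

/-! ### Perfect matchings as sets of pairs -/

namespace Reduction

open ExactMatching

/-- The pair of the vertices `u` and `w` (shifted by `3`), the greater one first. -/
def sortedPair (u w : ℕ) : ℕ × ℕ := (max u w + 3, min u w + 3)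

theorem sortedPair_comm (u w : ℕ) : sortedPair u w = sortedPair w u := by
  rw [sortedPair, sortedPair, max_comm, min_comm]

theorem sortedPair_eq_iff {u w u' w' : ℕ} :
    sortedPair u w = sortedPair u' w' ↔ u = u' ∧ w = w' ∨ u = w' ∧ w = u' := by
  simp only [sortedPair, Prod.mk.injEq]
  omega

theorem degree_val_eq_one {v : ℕ} {B : Finset (ℕ × ℕ)} :
    degree v B.val = 1 ↔ ∃! e, e ∈ B ∧ (e.1 = v ∨ e.2 = v) := by
  have : degree v B.val = (B.filter fun e => e.1 = v ∨ e.2 = v).card := by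
    rw [degree, Multiset.countP_eq_card_filter]
    rfl
  rw [this, Finset.card_eq_one, Finset.singleton_iff_unique_mem]
  simp only [Finset.mem_filter]

/-- Every pair of `B` that contains `u + 3` is `sortedPair u w` for exactly one `w`, so a unique
incident pair is the same as a unique partner. -/
theorem forall_degree_eq_one_iff {n : ℕ} {B : Finset (ℕ × ℕ)}
    (hB : ∀ e ∈ B, 3 ≤ e.2 ∧ e.2 < e.1 ∧ e.1 < n + 3) :
    (∀ v ∈ Finset.Ico 3 (n + 3), degree v B.val = 1) ↔
      ∀ u : Fin n, ∃! w : Fin n, sortedPair u w ∈ B := by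
  have key : ∀ u : Fin n, degree (u + 3) B.val = 1 ↔ ∃! w : Fin n, sortedPair u w ∈ B := by
    intro u
    rw [degree_val_eq_one]
    constructor
    · rintro ⟨⟨i, j⟩, ⟨he, hu⟩, huniq⟩
      obtain ⟨h1, h2, h3⟩ := hB _ he
      simp only at h1 h2 h3 hu
      have h4 : ∃ w : Fin n, sortedPair u w = (i, j) := by
        rcases hu with hu | hu
        · exact ⟨⟨j - 3, by omega⟩, by simp only [sortedPair, Prod.mk.injEq]; omega⟩
        · exact ⟨⟨i - 3, by omega⟩, by simp only [sortedPair, Prod.mk.injEq]; omega⟩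
      obtain ⟨w, hw⟩ := h4
      refine ⟨w, by simpa only [hw] using he, fun w' hw' => ?_⟩
      have := huniq _ ⟨hw', by simp only [sortedPair]; omega⟩
      rw [← hw, sortedPair_eq_iff] at this
      omega
    · rintro ⟨w, hw, huniq⟩
      refine ⟨_, ⟨hw, by simp only [sortedPair]; omega⟩, ?_⟩
      rintro ⟨i, j⟩ ⟨he, hu⟩
      obtain ⟨h1, h2, h3⟩ := hB _ he
      simp only at h1 h2 h3 hu
      have h4 : ∃ w : Fin n, sortedPair u w = (i, j) := by
        rcases hu with hu | hu
        · exact ⟨⟨j - 3, by omega⟩, by simp only [sortedPair, Prod.mk.injEq]; omega⟩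
        · exact ⟨⟨i - 3, by omega⟩, by simp only [sortedPair, Prod.mk.injEq]; omega⟩
      obtain ⟨w', hw'⟩ := h4
      rw [← hw'] at he ⊢
      rw [huniq w' he]
  refine ⟨fun h u => (key u).mp (h _ (by simp)), fun h v hv => ?_⟩
  rw [Finset.mem_Ico] at hv
  have := (key ⟨v - 3, by omega⟩).mpr (h _)
  rwa [show v - 3 + 3 = v by omega] at this

/-! ### Instances as colored matrices, and their matchings -/

variable {I : ExactMatching.Instance}

/-- The matrix of an instance. -/
noncomputable def matrix (I : ExactMatching.Instance) (i j : ℕ) : Letter :=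
  if h : i < I.n ∧ j < I.n then I.entry ⟨i, h.1⟩ ⟨j, h.2⟩ else .noEdge

theorem matrix_coe (u w : Fin I.n) : matrix I u w = I.entry u w := dif_pos ⟨u.2, w.2⟩

theorem entry_comm (u w : Fin I.n) : I.entry u w = I.entry w u := by
  rw [ExactMatching.Instance.entry, ExactMatching.Instance.entry, Sym2.eq_swap, I.G.adj_comm u]

theorem isEntry_matrix (i j : ℕ) : IsEntry (matrix I i j) := by
  rw [matrix, IsEntry]
  split_ifs
  · rw [ExactMatching.Instance.entry]
    split_ifs <;> simp
  · simp

theorem entry_eq_redEdge {u w : Fin I.n} : I.entry u w = .redEdge ↔ s(u, w) ∈ I.red := by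
  rw [ExactMatching.Instance.entry]
  split_ifs <;> simp_all

theorem entry_eq_nonredEdge {u w : Fin I.n} :
    I.entry u w = .nonredEdge ↔ I.G.Adj u w ∧ s(u, w) ∉ I.red := by
  rw [ExactMatching.Instance.entry]
  split_ifs <;> simp_all

theorem exists_of_mem_edgePairs {a : Letter} {e : ℕ × ℕ} (h : e ∈ edgePairs (matrix I) a I.n) :
    ∃ u w : Fin I.n, e = sortedPair u w := by
  obtain ⟨i, j, hj, hi, -, rfl⟩ := mem_edgePairs.mp h
  refine ⟨⟨i, hi⟩, ⟨j, hj.trans hi⟩, ?_⟩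
  simp only [sortedPair, Prod.mk.injEq]
  omega

theorem sortedPair_mem_edgePairs {a : Letter} {u w : Fin I.n} :
    sortedPair u w ∈ edgePairs (matrix I) a I.n ↔ u ≠ w ∧ I.entry u w = a := by
  wlog h : w ≤ u generalizing u w
  · rw [sortedPair_comm, this (le_of_not_ge h), entry_comm, ne_comm]
  have h' : (w : ℕ) ≤ u := h
  rw [sortedPair, max_eq_left h', min_eq_right h', mem_edgePairs]
  constructor
  · rintro ⟨i, j, hj, hi, hc, he⟩
    simp only [Prod.mk.injEq, Nat.add_right_cancel_iff] at he
    obtain ⟨rfl, rfl⟩ := he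
    rw [matrix_coe] at hc
    exact ⟨fun h => by simp [h] at hj, hc⟩
  · rintro ⟨hne, hc⟩
    exact ⟨u, w, lt_of_le_of_ne h' fun h => hne (Fin.ext h.symm), u.2, by rwa [matrix_coe], rfl⟩

/-- `sortedPair` induces an injection on unordered pairs that maps the red edges of `M` onto `C`. -/
theorem ncard_edgeSet_inter_red {M : I.G.Subgraph} {C : Finset (ℕ × ℕ)}
    (hC : C ⊆ edgePairs (matrix I) .redEdge I.n)
    (h : ∀ u w : Fin I.n, s(u, w) ∈ I.red → (sortedPair u w ∈ C ↔ M.Adj u w)) :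
    (M.edgeSet ∩ I.red).ncard = C.card := by
  let f : Sym2 (Fin I.n) → ℕ × ℕ :=
    Sym2.lift ⟨fun u w => sortedPair u w, fun u w => sortedPair_comm u w⟩
  have hf : f.Injective := by
    intro a b
    induction a using Sym2.ind
    induction b using Sym2.ind
    intro h
    simp only [f, Sym2.lift_mk, sortedPair_eq_iff] at h
    simp only [Sym2.eq_iff, Fin.ext_iff]
    exact h
  have : (C : Set (ℕ × ℕ)) = f '' (M.edgeSet ∩ I.red) := by
    ext e
    constructor
    · intro he
      obtain ⟨u, w, rfl⟩ := exists_of_mem_edgePairs (hC he)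
      have hred := entry_eq_redEdge.mp (sortedPair_mem_edgePairs.mp (hC he)).2
      exact ⟨s(u, w), ⟨(h u w hred).mp he, hred⟩, rfl⟩
    · rintro ⟨a, ⟨h1, h2⟩, rfl⟩
      induction a using Sym2.ind with
      | _ u w => exact (h u w h2).mpr h1
  rw [← Set.ncard_coe_finset, this, Set.ncard_image_of_injective _ hf]

theorem disjoint_edgePairs {c : ℕ → ℕ → Letter} {n : ℕ} {a b : Letter} (hab : a ≠ b) :
    Disjoint (edgePairs c a n) (edgePairs c b n) := by
  rw [Finset.disjoint_left]
  intro e h1 h2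
  obtain ⟨i, j, -, -, rfl, rfl⟩ := mem_edgePairs.mp h1
  obtain ⟨i', j', -, -, rfl, h⟩ := mem_edgePairs.mp h2
  simp only [Prod.mk.injEq, Nat.add_right_cancel_iff] at h
  exact hab (by rw [h.1, h.2])

/-- The existence of a perfect matching with `k` red edges, in terms of the matrix. -/
def HasMatching (c : ℕ → ℕ → Letter) (n k : ℕ) : Prop :=
  ∃ A ⊆ edgePairs c .nonredEdge n, ∃ C ⊆ edgePairs c .redEdge n, C.card = k ∧
    ∀ v ∈ Finset.Ico 3 (n + 3), degree v (A.val + C.val) = 1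

theorem isYes_iff_hasMatching : I.IsYes ↔ HasMatching (matrix I) I.n I.k := by
  classical
  -- The two color classes are disjoint, so the multiset sum is the union, without multiplicities.
  have hval : ∀ A ⊆ edgePairs (matrix I) .nonredEdge I.n,
      ∀ C ⊆ edgePairs (matrix I) .redEdge I.n,
      ((∀ v ∈ Finset.Ico 3 (I.n + 3), degree v (A.val + C.val) = 1) ↔
        ∀ u : Fin I.n, ∃! w : Fin I.n, sortedPair u w ∈ A ∪ C) := by
    intro A hA C hC
    have hd := Finset.disjoint_of_subset_left hA
      (Finset.disjoint_of_subset_right hC (disjoint_edgePairs (by simp)))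
    rw [← Finset.disjUnion_eq_union _ _ hd]
    refine forall_degree_eq_one_iff (B := A.disjUnion C hd) fun e he => ?_
    rcases Finset.mem_disjUnion.mp he with he | he
    exacts [bounds_of_mem_edgePairs (hA he), bounds_of_mem_edgePairs (hC he)]
  constructor
  · rintro ⟨M, hM, hk⟩
    let P : ℕ × ℕ → Prop := fun e => ∃ u w : Fin I.n, M.Adj u w ∧ e = sortedPair u w
    have hP : ∀ u w : Fin I.n, P (sortedPair u w) ↔ M.Adj u w := by
      refine fun u w => ⟨?_, fun h => ⟨u, w, h, rfl⟩⟩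
      rintro ⟨u', w', h, he⟩
      rw [sortedPair_eq_iff] at he
      rcases he with ⟨h1, h2⟩ | ⟨h1, h2⟩
      · rwa [Fin.ext h1, Fin.ext h2]
      · rw [Fin.ext h1, Fin.ext h2]
        exact h.symm
    have hred : ∀ u w : Fin I.n, s(u, w) ∈ I.red →
        (sortedPair u w ∈ (edgePairs (matrix I) .redEdge I.n).filter P ↔ M.Adj u w) := by
      intro u w h
      rw [Finset.mem_filter, hP, sortedPair_mem_edgePairs, entry_eq_redEdge]
      exact ⟨fun h => h.2, fun h' => ⟨⟨h'.ne, h⟩, h'⟩⟩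
    refine ⟨(edgePairs (matrix I) .nonredEdge I.n).filter P, Finset.filter_subset _ _,
      (edgePairs (matrix I) .redEdge I.n).filter P, Finset.filter_subset _ _, ?_, ?_⟩
    · rw [← hk, ncard_edgeSet_inter_red (Finset.filter_subset _ _) hred]
    · rw [hval _ (Finset.filter_subset _ _) _ (Finset.filter_subset _ _)]
      have : ∀ u w : Fin I.n, sortedPair u w ∈ (edgePairs (matrix I) .nonredEdge I.n).filter P ∪
          (edgePairs (matrix I) .redEdge I.n).filter P ↔ M.Adj u w := by
        intro u w
        rw [Finset.mem_union, Finset.mem_filter, Finset.mem_filter, hP, sortedPair_mem_edgePairs,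
          sortedPair_mem_edgePairs, entry_eq_redEdge, entry_eq_nonredEdge]
        refine ⟨by tauto, fun h => ?_⟩
        have h1 := h.ne
        have h2 := h.adj_sub
        tauto
      simp only [this]
      exact SimpleGraph.Subgraph.isPerfectMatching_iff.mp hM
  · rintro ⟨A, hA, C, hC, hk, h⟩
    rw [hval A hA C hC] at h
    let M : I.G.Subgraph :=
      { verts := Set.univ
        Adj := fun u w => sortedPair u w ∈ A ∪ C
        adj_sub := fun {u w} h => by
          rcases Finset.mem_union.mp h with h | h
          · exact (entry_eq_nonredEdge.mp (sortedPair_mem_edgePairs.mp (hA h)).2).1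
          · exact I.red_subset (entry_eq_redEdge.mp (sortedPair_mem_edgePairs.mp (hC h)).2)
        edge_vert := fun _ => Set.mem_univ _
        symm := ⟨fun u w h => by rwa [sortedPair_comm]⟩ }
    refine ⟨M, SimpleGraph.Subgraph.isPerfectMatching_iff.mpr h, ?_⟩
    rw [← hk]
    refine ncard_edgeSet_inter_red hC fun u w hred => ?_
    change _ ↔ sortedPair u w ∈ A ∪ C
    rw [Finset.mem_union]
    refine ⟨.inr, fun h => h.resolve_left fun h => ?_⟩
    exact (entry_eq_nonredEdge.mp (sortedPair_mem_edgePairs.mp (hA h)).2).2 hred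

/-- This justifies rejecting numbers that exceed `n + 3`. -/
theorem two_mul_le_of_hasMatching {c : ℕ → ℕ → Letter} {n k : ℕ} (h : HasMatching c n k) :
    2 * k ≤ n := by
  obtain ⟨A, hA, C, hC, rfl, h⟩ := h
  have := sum_degree (Finset.Ico 3 (n + 3)) (A.val + C.val) fun e he => by
    have : 3 ≤ e.2 ∧ e.2 < e.1 ∧ e.1 < n + 3 := by
      rcases Multiset.mem_add.mp he with he | he
      exacts [bounds_of_mem_edgePairs (hA he), bounds_of_mem_edgePairs (hC he)]
    simp only [Finset.mem_Ico]
    omega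
  rw [Finset.sum_congr rfl h] at this
  simp at this
  omega

theorem filter_lt_range {i n : ℕ} (h : i ≤ n) :
    (List.range n).filter (fun j => decide (j < i)) = List.range i := by
  obtain ⟨t, rfl⟩ := Nat.exists_eq_add_of_le h
  rw [List.range_add, List.filter_append, List.filter_eq_self.mpr (by simp),
    List.filter_eq_nil_iff.mpr (by simp), List.append_nil]

theorem encode_eq (I : ExactMatching.Instance) :
    I.encode = matrixString I.n (matrix I) ++ I.k.bits.map .bit := by
  have hrange : ∀ n, (List.finRange n).map Fin.val = List.range n := fun n =>
    List.ext_getElem (by simp) fun i h1 h2 => by simp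
  rw [ExactMatching.Instance.encode, matrixString, ← hrange I.n, List.flatMap_map]
  congr 1
  refine List.flatMap_congr fun i _ => ?_
  congr 1
  have h1 : List.range i = ((List.finRange I.n).filter (· < i)).map Fin.val := by
    have h2 := List.filter_map (f := Fin.val) (p := fun j => decide (j < (i : ℕ)))
      (l := List.finRange I.n)
    rw [hrange] at h2
    change _ = List.map Fin.val (List.filter ((fun j => decide (j < (i : ℕ))) ∘ Fin.val) _)
    rw [← h2, filter_lt_range i.2.le]
  rw [h1, List.map_map]
  exact List.map_congr_left fun j _ => (matrix_coe i j).symm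

theorem edgePairs_congr {c c' : ℕ → ℕ → Letter} {n : ℕ}
    (h : ∀ i j, j < i → i < n → c i j = c' i j) (a : Letter) :
    edgePairs c a n = edgePairs c' a n := by
  ext e
  rw [mem_edgePairs, mem_edgePairs]
  constructor
  · rintro ⟨i, j, hj, hi, hc, rfl⟩
    exact ⟨i, j, hj, hi, h i j hj hi ▸ hc, rfl⟩
  · rintro ⟨i, j, hj, hi, hc, rfl⟩
    exact ⟨i, j, hj, hi, (h i j hj hi).trans hc, rfl⟩

/-- Every string that passes the parser therefore encodes an instance. Only the entries of `c` below
the diagonal matter. -/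
theorem exists_instance {c : ℕ → ℕ → Letter} (hc : ∀ i j, IsEntry (c i j)) (n k : ℕ) :
    ∃ I : ExactMatching.Instance, (I.IsYes ↔ HasMatching c n k) ∧
      I.encode = matrixString n c ++ k.bits.map .bit := by
  let S : (Letter → Prop) → Set (Sym2 (Fin n)) :=
    fun p => {e | ∃ i j : Fin n, j < i ∧ p (c i j) ∧ e = s(i, j)}
  -- The condition `j < i` orients each edge, so an unordered pair determines its entry.
  have hS : ∀ (p : Letter → Prop) (i j : Fin n), j < i → (s(i, j) ∈ S p ↔ p (c i j)) := by
    refine fun p i j hj => ⟨?_, fun h => ⟨i, j, hj, h, rfl⟩⟩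
    rintro ⟨i', j', hj', hp, he⟩
    rcases Sym2.eq_iff.mp he with ⟨rfl, rfl⟩ | ⟨rfl, rfl⟩
    · exact hp
    · exact absurd hj' hj.not_gt
  let I : ExactMatching.Instance :=
    { n := n
      G := .fromEdgeSet (S (· ≠ .noEdge))
      red := S (· = .redEdge)
      red_subset := by
        rintro _ ⟨i, j, hj, hp, rfl⟩
        rw [SimpleGraph.mem_edgeSet, SimpleGraph.fromEdgeSet_adj]
        exact ⟨(hS (· ≠ .noEdge) i j hj).mpr (by simp [hp]), hj.ne'⟩
      k := k }
  have hm : ∀ i j, j < i → i < n → matrix I i j = c i j := by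
    intro i j hj hi
    have h := matrix_coe (I := I) ⟨i, hi⟩ ⟨j, hj.trans hi⟩
    have h1 : s(⟨i, hi⟩, ⟨j, hj.trans hi⟩) ∈ I.red ↔ c i j = .redEdge :=
      hS (· = .redEdge) ⟨i, hi⟩ ⟨j, hj.trans hi⟩ hj
    have h2 := hS (· ≠ .noEdge) ⟨i, hi⟩ ⟨j, hj.trans hi⟩ hj
    have h3 : I.G.Adj ⟨i, hi⟩ ⟨j, hj.trans hi⟩ ↔ c i j ≠ .noEdge := by
      rw [← h2]
      refine (SimpleGraph.fromEdgeSet_adj _).trans (and_iff_left ?_)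
      simp [hj.ne']
    simp only at h
    rw [h, ExactMatching.Instance.entry]
    simp only [h1, h3]
    rcases hc i j with h | h | h <;> simp [h]
  refine ⟨I, ?_, ?_⟩
  · rw [isYes_iff_hasMatching, HasMatching, HasMatching, edgePairs_congr (c := matrix I) hm,
      edgePairs_congr (c := matrix I) hm]
  · rw [encode_eq]
    congr 1
    refine List.flatMap_congr fun i hi => ?_
    congr 1
    exact List.map_congr_left fun j hj => hm i j (List.mem_range.mp hj) (List.mem_range.mp hi)

/-! ### The correctness of the reduction -/

theorem atEnd_bits (k : ℕ) : AtEnd (k.bits.map .bit) := by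
  cases k.bits with
  | nil => exact atEnd_nil
  | cons b l => exact atEnd_bit b _

theorem reduction_mem_iff_hasMatching {c : ℕ → ℕ → Letter} (hc : ∀ i j, IsEntry (c i j)) (n k : ℕ) :
    reduction (matrixString n c ++ k.bits.map .bit) ∈ Voting.CCRVExact Voting.twoApproval ↔
      HasMatching c n k := by
  rw [reduction, scanRows_matrixString hc (atEnd_bits k)]
  simp only
  rcases scanBits_bits (n + 3) 1 (numPairs n) k true fun _ => rfl with h | ⟨h, hk⟩
  · rw [h]
    simp only [one_mul]
    exact outputString_mem_iff hc (atEnd_bits k) k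
  · rw [h]
    refine iff_of_false Voting.nil_notMem_CCRVExact fun h => ?_
    have := two_mul_le_of_hasMatching h
    omega

theorem mem_iff_reduction_mem (x : List Letter) :
    x ∈ ExactPerfectMatching ↔ reduction x ∈ Voting.CCRVExact Voting.twoApproval := by
  constructor
  · rintro ⟨I, hI, rfl⟩
    rw [encode_eq, reduction_mem_iff_hasMatching isEntry_matrix]
    exact isYes_iff_hasMatching.mp hI
  -- A nonrejected string splits into a matrix and a numeral, from which an instance is rebuilt. Any
  -- instance with this encoding will do, so the encoding of graphs need not be shown injective.
  · intro h
    cases h1 : scanRows 3 3 0 3 x with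
    | none =>
      rw [reduction, h1] at h
      exact absurd h Voting.nil_notMem_CCRVExact
    | some r =>
      obtain ⟨i, k, m, l⟩ := r
      cases h2 : scanBits i 1 k true l with
      | none =>
        rw [reduction, h1] at h
        simp only [h2] at h
        exact absurd h Voting.nil_notMem_CCRVExact
      | some K' =>
        obtain ⟨c, n, hc, -, hx⟩ := exists_matrix_of_scanRows (i := 0) (j := 0)
          (c := fun _ _ => .noEdge) h1 fun _ _ => .inl rfl
        obtain ⟨K, -, rfl⟩ := exists_bits_of_scanBits h2
        have hx : x = matrixString n c ++ K.bits.map .bit := by simpa [matrixString] using hx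
        subst hx
        rw [reduction_mem_iff_hasMatching hc] at h
        obtain ⟨I, hI, hx⟩ := exists_instance hc n K
        exact ⟨I, hI.mpr h, hx⟩

end Reduction

theorem mainTheorem11 :
    Logspace.ManyOneReducible ExactPerfectMatching (Voting.CCRVExact Voting.twoApproval) :=
  ⟨Reduction.reduction, Reduction.computable_reduction, Reduction.mem_iff_reduction_mem⟩
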